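/- \textbf{Setting.} Let $k,m\ge 1$ be integers, $a_0\in\mathbb R^k$ with $\|a_0\|_2=1$, $\theta\in(0,1)$, and let $x_0\in\mathbb R^m$ have i.i.d. Bernoulli–Gaussian entries $x_0(i)=\omega_i g_i$, where $\omega_i\sim\mathrm{Ber}(\theta)$ and $g_i\sim\mathcal N(0,1)$ are jointly independent. Let $y=a_0\circledast x_0\in\mathbb R^m$ be the circulant convolution, i.e. $y_t=\sum_{s=0}^{k-1}a_0(s)\,x_0([t-s]_m)$, where $[\cdot]_m$ is reduction modulo $m$ and indices start at $0$. Let $Y\in\mathbb R^{k\times m}$ be the matrix whose $i$-th column is $(y_{[i]_m},y_{[i+1]_m},\dots,y_{[i+k-1]_m})^T$. Let $A_0\in\mathbb R^{k\times(2k-1)}$ be the banded Toeplitz matrix with entries $(A_0)_{r,c}=a_0(r+k-1-c)$ for $0\le r\le k-1$, $0\le c\le 2k-2$ (and $0$ when $r+k-1-c\notin\{0,\dots,k-1\}$). Let $\sigma_{\min}$ be the smallest of its $k$ singular values (which is positive) and $\kappa$ its condition number. Put $A=(A_0A_0^T)^{-1/2}A_0$, with columns $a_1,\dots,a_{2k-1}$,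 and $\mu=\max_{i\ne j}|\langle a_i,a_j\rangle|$ ($\mu=0$ if $k=1$). On $\mathbb R^k$ define $$\psi(q)=-\frac1{4m}\big\|Y^T(YY^T)^{-1/2}q\big\|_4^4,\qquad \varphi(q)=-\frac14\|A^Tq\|_4^4 ,$$ and for $q$ in the unit sphere $\mathbb S^{k-1}$ let $\mathrm{Hess}[f](q)=P_{q^\perp}\big[\nabla^2f(q)-\langle\nabla f(q),q\rangle I\big]P_{q^\perp}$, $P_{q^\perp}=I-qq^T$, denote the Riemannian Hessian. For $C_\star>0$ let $\hat{\mathcal R}_{2C_\star}=\{q\in\mathbb S^{k-1}:\|A^Tq\|_4^6\ge 2C_\star\mu\kappa^2\}$. \textbf{Lemma.} For every $c\in(0,0.048]$ there is a constant $C>0$, depending only on $c$, such that the following holds for all $k,m,a_0,\theta$ as above and all $C_\star\ge 10$. Put $c_\star=1/C_\star$; then $0.048\le 3(1-6c_\star-36c_\star^2-24c_\star^3)$. If $\theta\ge 1/k$ and $$m\ \ge\ C\,\frac{\min\{(2C_\star\mu\kappa^2)^{-4/3},\,k^2\}}{(1-\theta)^2\sigma_{\min}^2}\,\kappa^6k^4\log^3(\kappa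 k)$$ (where the minimum is $k^2$ if $\mu=0$), then with probability at least $$1-e^{-k}-\theta^2(1-\theta)^2k^{-4}-2e^{-\theta k}-48k^{-7}-48m^{-5}-24k\exp\!\big(-\tfrac1{144}\min\{k,3\sqrt{\theta m}\}\big),$$ the following holds simultaneously for all $q\in\hat{\mathcal R}_{2C_\star}$: $YY^T$ is positive definite and $$\Big\|\mathrm{Hess}[\psi](q)-\frac{3(1-\theta)}{\theta m^2}\,\mathrm{Hess}[\varphi](q)\Big\|_2\ \le\ c\,\frac{1-\theta}{\theta m^2}\,\|A^Tq\|_4^4 ,$$ where $\|\cdot\|_2$ is the operator norm. -/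

import Mathlib

open MeasureTheory ProbabilityTheory
open scoped Matrix Gradient

noncomputable section

namespace BlindDeconv

/-! ### Observation model (all indices start at `0`) -/

/-- Law of a Bernoulli-Gaussian variable `ω * g`, where `ω ∼ Ber(θ)` and `g ∼ N(0, 1)` are
independent. -/
def bernoulliGaussian (θ : unitInterval) : Measure ℝ :=
  ((bernoulliMeasure (1 : ℝ) 0 θ).prod (gaussianReal 0 1)).map fun p => p.1 * p.2

/-- Law of a vector in `ℝ^m` with i.i.d. Bernoulli-Gaussian entries. -/
def bernoulliGaussianVec (m : ℕ) (θ : unitInterval) : Measure (Fin m → ℝ) :=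
  Measure.pi fun _ => bernoulliGaussian θ

variable {k m : ℕ}

/-- Circulant convolution `y = a ⊛ x ∈ ℝ^m` of a kernel `a ∈ ℝ^k` with `x ∈ ℝ^m`:
`y t = ∑ s, a s * x [t - s]_m` (subtraction in `Fin m` is modulo `m`). -/
def circConv [NeZero m] (a : EuclideanSpace ℝ (Fin k)) (x : Fin m → ℝ) : Fin m → ℝ :=
  fun t => ∑ s : Fin k, a s * x (t - Fin.ofNat m s)

/-- The `k × m` matrix `Y` whose `i`-th column consists of the `k` cyclically consecutive entries
`y [i]_m, …, y [i + k - 1]_m` of `y`. -/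
def windows [NeZero m] (k : ℕ) (y : Fin m → ℝ) : Matrix (Fin k) (Fin m) ℝ :=
  Matrix.of fun r i => y (i + Fin.ofNat m r)

/-- The matrix `Y` of the observation `a ⊛ x`. -/
def obs [NeZero m] (a : EuclideanSpace ℝ (Fin k)) (x : Fin m → ℝ) : Matrix (Fin k) (Fin m) ℝ :=
  windows k (circConv a x)

/-- The banded Toeplitz convolution matrix `A₀ ∈ ℝ^{k × (2k-1)}`. Its first row is
`(a_{k-1}, …, a_0, 0, …, 0)` and its last row is `(0, …, 0, a_{k-1}, …, a_0)`. -/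
def convMatrix (a : EuclideanSpace ℝ (Fin k)) : Matrix (Fin k) (Fin (2 * k - 1)) ℝ :=
  Matrix.of fun r c =>
    if h : (c : ℕ) ≤ r + (k - 1) ∧ (r : ℕ) + (k - 1) - c < k then a ⟨r + (k - 1) - c, h.2⟩ else 0

/-! ### Preconditioning and the parameters `σ_min`, `κ`, `μ` -/

/-- Inverse square root `M^{-1/2}` of a positive definite matrix `M`, by functional calculus. -/
def invSqrt {n : ℕ} (M : Matrix (Fin n) (Fin n) ℝ) : Matrix (Fin n) (Fin n) ℝ :=
  cfc (fun t : ℝ => (Real.sqrt t)⁻¹) M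

/-- The preconditioned convolution matrix `A = (A₀ A₀ᵀ)^{-1/2} A₀`. -/
def precond (a : EuclideanSpace ℝ (Fin k)) : Matrix (Fin k) (Fin (2 * k - 1)) ℝ :=
  invSqrt (convMatrix a * (convMatrix a)ᵀ) * convMatrix a

/-- The largest singular value of `A₀`. -/
def sigmaMax (a : EuclideanSpace ℝ (Fin k)) : ℝ :=
  (Matrix.toEuclideanLin (convMatrix a)).singularValues 0

/-- The smallest (that is, the `k`-th largest) singular value of the `k × (2k-1)` matrix `A₀`. -/
def sigmaMin (a : EuclideanSpace ℝ (Fin k)) : ℝ :=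
  (Matrix.toEuclideanLin (convMatrix a)).singularValues (k - 1)

/-- The condition number `κ` of `A₀`. -/
def kappa (a : EuclideanSpace ℝ (Fin k)) : ℝ := sigmaMax a / sigmaMin a

/-- The column coherence `μ = max_{i ≠ j} |⟨a_i, a_j⟩|` of `A` (zero if `A` has only one column). -/
def mu (a : EuclideanSpace ℝ (Fin k)) : ℝ :=
  ⨆ p : {p : Fin (2 * k - 1) × Fin (2 * k - 1) // p.1 ≠ p.2},
    |(precond a).col p.1.1 ⬝ᵥ (precond a).col p.1.2|

/-! ### Objective functions and their Riemannian Hessians -/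

/-- The `ℓ⁴` norm of a vector. -/
def norm4 {n : ℕ} (v : Fin n → ℝ) : ℝ := ‖(WithLp.toLp 4 v : PiLp 4 fun _ : Fin n => ℝ)‖

/-- The finite sample objective `ψ(q) = -(1 / (4 m)) ‖Yᵀ (Y Yᵀ)^{-1/2} q‖₄⁴`. -/
def psi (Y : Matrix (Fin k) (Fin m) ℝ) (q : EuclideanSpace ℝ (Fin k)) : ℝ :=
  -(1 / (4 * (m : ℝ))) * norm4 (Yᵀ *ᵥ (invSqrt (Y * Yᵀ) *ᵥ q.ofLp)) ^ 4

/-- The asymptotic objective `φ(q) = -(1 / 4) ‖Aᵀ q‖₄⁴`. -/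
def phi (a : EuclideanSpace ℝ (Fin k)) (q : EuclideanSpace ℝ (Fin k)) : ℝ :=
  -(1 / 4) * norm4 ((precond a)ᵀ *ᵥ q.ofLp) ^ 4

/-- The map `P = I - q qᵀ`; for a unit vector `q`, the orthogonal projection onto the tangent space
of the sphere at `q`. -/
def tangentProj (q : EuclideanSpace ℝ (Fin k)) :
    EuclideanSpace ℝ (Fin k) →L[ℝ] EuclideanSpace ℝ (Fin k) :=
  ContinuousLinearMap.id ℝ _ - (innerSL ℝ q).smulRight q

/-- The Riemannian Hessian `P [∇²f(q) - ⟨∇f(q), q⟩ I] P` at a point `q` of the unit sphere, of the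
restriction to the sphere of a smooth function `f` on `ℝ^k`. The tangent space is embedded in
`ℝ^k`. -/
def riemHess (f : EuclideanSpace ℝ (Fin k) → ℝ) (q : EuclideanSpace ℝ (Fin k)) :
    EuclideanSpace ℝ (Fin k) →L[ℝ] EuclideanSpace ℝ (Fin k) :=
  (tangentProj q).comp
    ((fderiv ℝ (∇ f) q - (inner ℝ (∇ f q) q) • ContinuousLinearMap.id ℝ _).comp (tangentProj q))

/-- The region `{q ∈ S^{k-1} | ‖Aᵀ q‖₄⁶ ≥ C μ κ²}`. -/
def regionHat (C : ℝ) (a : EuclideanSpace ℝ (Fin k)) : Set (EuclideanSpace ℝ (Fin k)) :=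
  {q | ‖q‖ = 1 ∧ C * mu a * kappa a ^ 2 ≤ norm4 ((precond a)ᵀ *ᵥ q.ofLp) ^ 6}

/-! ### Sample size and probability -/

/-- `min {(2 C⋆ μ κ²)^{-4/3}, k²}`, where `0^{-4/3} = ∞`, so that the value is `k²` if `μ = 0`. -/
def sizeFactor (Cstar : ℝ) (a : EuclideanSpace ℝ (Fin k)) : ℝ :=
  if mu a = 0 then (k : ℝ) ^ 2
  else min ((2 * Cstar * mu a * kappa a ^ 2) ^ (-(4 / 3) : ℝ)) ((k : ℝ) ^ 2)

/-- The bound on the failure probability. -/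
def failBound (k m : ℕ) (θ : ℝ) : ℝ :=
  Real.exp (-k) + θ ^ 2 * (1 - θ) ^ 2 / (k : ℝ) ^ 4 + 2 * Real.exp (-(θ * k))
    + 48 / (k : ℝ) ^ 7 + 48 / (m : ℝ) ^ 5
    + 24 * k * Real.exp (-(1 / 144) * min (k : ℝ) (3 * Real.sqrt (θ * m)))

end BlindDeconv

end

namespace BlindDeconv

/-! The observation factors as `Y = A₀ X`, where the columns of `X` are the cyclic windows of `x₀`
of length `2k - 1` (`obs_eq_mul`). Hence `ψ` depends on `x₀` only through empirical mixed moments of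
these windows. As bilinear forms, both Riemannian Hessians are contractions of a fourth moment
tensor. For `ψ` it is the empirical tensor, contracted with vectors `A₀ᵀ M^{-1/2} p`, where `M =
YYᵀ/(θm)`. For `φ`, after scaling by `3(1-θ)/(θm²)`, it is the exact tensor, contracted with `Aᵀ p`.

The second claim rests on an exact cancellation (`inner_riemHess_phi`). The fourth moment tensor is
`θ²` times the three pairings plus `3θ(1-θ)` times the diagonal tensor. Since `Aᵀ` is an isometry
and tangent vectors are orthogonal to `q`, the pairings drop out of the Riemannian Hessian, and the
diagonal tensor gives `φ`.

It remains to bound two errors. The second and fourth empirical moments are within `θE` of the exact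
ones in Frobenius norm (`exists_good_set`). By Cauchy-Schwarz (`contract_sq_le`), this controls all
contractions at once, so uniformity in `q` needs no net on the sphere. The second moments also show
that `M` is close to `A₀A₀ᵀ`; a perturbation bound for square roots (`invSqrt_sub_invSqrt_le`) then
gives `‖A₀ᵀ M^{-1/2} v - Aᵀ v‖ ≤ 2Eκ²‖v‖`. Together the Hessians differ by at most `424 Eκ²/(θm²)`
(`norm_riemHess_sub_le`). On the region, `‖Aᵀq‖₄⁴ ≥ 1/(2√s)` with `s` the size factor, which
dictates the choice of `E`.

Concentration is entrywise: truncation at level `√(12 log m)`, then Bernstein's inequality for sums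
with a sparse dependency graph. A moment whose index tuple has `d` distinct values has variance of
order `θ^d`. Distributing the tolerance accordingly costs only `(nθ)^p` in total
(`sum_pow_card_image_le`), which yields the sample size `k⁴ log k / E²`. -/

/-! ### Moments and tails of one Bernoulli-Gaussian variable -/

lemma bernoulliGaussian_eq (θ : unitInterval) :
    bernoulliGaussian θ = unitInterval.toNNReal θ • gaussianReal 0 1 +
      unitInterval.toNNReal (unitInterval.symm θ) • Measure.dirac 0 := by
  have hm : Measurable fun p : ℝ × ℝ => p.1 * p.2 := by fun_prop
  rw [bernoulliGaussian, bernoulliMeasure_def, Measure.add_prod, Measure.map_add _ _ hm,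
    Measure.prod_smul_left, Measure.prod_smul_left, Measure.map_smul, Measure.map_smul,
    Measure.dirac_prod, Measure.dirac_prod, Measure.map_map hm (by fun_prop),
    Measure.map_map hm (by fun_prop)]
  congr 2
  · simp [Function.comp_def]
  · simp [Function.comp_def]

instance (θ : unitInterval) : IsProbabilityMeasure (bernoulliGaussian θ) :=
  Measure.isProbabilityMeasure_map (by fun_prop)

instance (m : ℕ) (θ : unitInterval) : IsProbabilityMeasure (bernoulliGaussianVec m θ) := by
  unfold bernoulliGaussianVec; infer_instance

lemma integrable_bernoulliGaussian {θ : unitInterval} {f : ℝ → ℝ}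
    (hf : Integrable f (gaussianReal 0 1)) : Integrable f (bernoulliGaussian θ) := by
  rw [bernoulliGaussian_eq]
  exact (hf.smul_measure_nnreal).add_measure ((integrable_dirac (by simp)).smul_measure_nnreal)

lemma integral_bernoulliGaussian {θ : unitInterval} {f : ℝ → ℝ}
    (hf : Integrable f (gaussianReal 0 1)) :
    ∫ x, f x ∂bernoulliGaussian θ = θ * ∫ x, f x ∂gaussianReal 0 1 + (1 - θ) * f 0 := by
  rw [bernoulliGaussian_eq, integral_add_measure hf.smul_measure_nnreal
    ((integrable_dirac (by simp)).smul_measure_nnreal), integral_smul_nnreal_measure,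
    integral_smul_nnreal_measure, integral_dirac]
  rfl

lemma integrable_pow_gaussian (j : ℕ) : Integrable (fun x : ℝ => x ^ j) (gaussianReal 0 1) := by
  simpa using integrable_pow_of_mem_interior_integrableExpSet (X := id) (μ := gaussianReal 0 1)
    (by simp) j

lemma integral_odd_gaussian {j : ℕ} (hj : Odd j) : ∫ x, x ^ j ∂gaussianReal 0 1 = 0 := by
  have h := gaussianReal_map_neg (μ := 0) (v := 1)
  have h2 : ∫ x, x ^ j ∂gaussianReal 0 1 = ∫ x, (-x) ^ j ∂gaussianReal 0 1 := by
    conv_lhs => rw [show gaussianReal 0 1 = (gaussianReal 0 1).map (fun x : ℝ => -x) by simp [h]]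
    rw [integral_map (by fun_prop) (by fun_prop)]
  simp only [hj.neg_pow, integral_neg] at h2
  linarith

lemma integral_sq_gaussian : ∫ x, x ^ 2 ∂gaussianReal 0 1 = 1 := by
  have := variance_fun_id_gaussianReal (μ := 0) (v := 1)
  rw [variance_eq_integral measurable_id'.aemeasurable] at this
  simpa using this

/-- Fourth derivative of the moment generating function at `0`: differentiating `p(t) exp(t²/2)`
replaces the polynomial `p` by `p' + X p`. -/
lemma integral_pow_four_gaussian : ∫ x, x ^ 4 ∂gaussianReal 0 1 = 3 := by
  have h : ∫ x, x ^ 4 ∂gaussianReal 0 1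
      = iteratedDeriv 4 (mgf (fun x ↦ x) (gaussianReal 0 1)) 0 := by
    rw [iteratedDeriv_mgf_zero] <;> simp
  rw [h, mgf_fun_id_gaussianReal]
  have key : ∀ p q : Polynomial ℝ, q = p.derivative + Polynomial.X * p →
      deriv (fun t : ℝ => p.eval t * Real.exp (t ^ 2 / 2)) =
        fun t => q.eval t * Real.exp (t ^ 2 / 2) := by
    intro p q hq
    ext t
    have h1 : HasDerivAt (fun t : ℝ => Real.exp (t ^ 2 / 2)) (Real.exp (t ^ 2 / 2) * t) t := by
      have := ((hasDerivAt_pow 2 t).div_const 2).exp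
      convert this using 1
      simp
    rw [((p.hasDerivAt t).fun_mul h1).deriv, hq]
    simp
    ring
  have e0 : (fun t : ℝ => Real.exp (((0 : ℝ) * t + ((1 : NNReal) : ℝ) * t ^ 2 / 2))) =
      fun t => (1 : Polynomial ℝ).eval t * Real.exp (t ^ 2 / 2) := by
    ext t; simp
  rw [e0, iteratedDeriv_succ, iteratedDeriv_succ, iteratedDeriv_succ, iteratedDeriv_one,
    key 1 Polynomial.X (by simp), key _ (1 + Polynomial.X * Polynomial.X) (by simp),
    key _ (3 * Polynomial.X + Polynomial.X * Polynomial.X * Polynomial.X)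
      (by simp; ring),
    key _ _ rfl]
  simp


/-- The moments of a Bernoulli-Gaussian variable. -/
noncomputable def coordMoment (θ : unitInterval) (c : ℕ) : ℝ := ∫ x, x ^ c ∂bernoulliGaussian θ

lemma coordMoment_eq (θ : unitInterval) (c : ℕ) (hc : c ≠ 0) :
    coordMoment θ c = θ * ∫ x, x ^ c ∂gaussianReal 0 1 := by
  rw [coordMoment, integral_bernoulliGaussian (integrable_pow_gaussian c)]
  simp [hc]

lemma coordMoment_zero (θ : unitInterval) : coordMoment θ 0 = 1 := by
  simp [coordMoment]

lemma coordMoment_odd (θ : unitInterval) {c : ℕ} (hc : Odd c) : coordMoment θ c = 0 := by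
  rw [coordMoment_eq θ c hc.pos.ne', integral_odd_gaussian hc, mul_zero]

lemma coordMoment_two (θ : unitInterval) : coordMoment θ 2 = θ := by
  rw [coordMoment_eq θ 2 two_ne_zero, integral_sq_gaussian, mul_one]

lemma coordMoment_four (θ : unitInterval) : coordMoment θ 4 = 3 * θ := by
  rw [coordMoment_eq θ 4 four_ne_zero, integral_pow_four_gaussian, mul_comm]

/-- An upper bound for the even Gaussian moments of order at most `2 * p`. -/
noncomputable def momentBound (p : ℕ) : ℝ := 1 + ∫ x, x ^ (2 * p) ∂gaussianReal 0 1

lemma one_le_momentBound (p : ℕ) : 1 ≤ momentBound p := by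
  have : 0 ≤ ∫ x, x ^ (2 * p) ∂gaussianReal 0 1 :=
    integral_nonneg fun x => (even_two_mul p).pow_nonneg x
  simp only [momentBound]; linarith

/-- Pointwise `x^(2c) ≤ 1 + x^(2p)`. The factor `θ` is the weight of the Gaussian part, the atom at
`0` contributing nothing to a positive power. -/
lemma coordMoment_two_mul_le (θ : unitInterval) {c p : ℕ} (hc : c ≠ 0) (hcp : c ≤ p) :
    coordMoment θ (2 * c) ≤ momentBound p * θ := by
  rw [coordMoment_eq θ _ (by omega), mul_comm]
  refine mul_le_mul_of_nonneg_right ?_ θ.2.1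
  have h : momentBound p = ∫ x : ℝ, (1 + x ^ (2 * p)) ∂gaussianReal 0 1 := by
    rw [integral_add (integrable_const _) (integrable_pow_gaussian _)]; simp [momentBound]
  rw [h]
  refine integral_mono (integrable_pow_gaussian _)
    ((integrable_const _).add (integrable_pow_gaussian _)) fun x => ?_
  simp only [pow_mul]
  rcases le_total (x ^ 2) 1 with h1 | h1
  · have := pow_le_one₀ (n := c) (sq_nonneg x) h1
    have := pow_nonneg (sq_nonneg x) p
    linarith
  · have := pow_le_pow_right₀ h1 hcp
    linarith

/-- Chernoff's bound with parameter `L` on each side: the atom at `0` only lowers the moment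
generating function, which stays below the Gaussian `exp(t²/2)`. -/
lemma bernoulliGaussian_tail (θ : unitInterval) {L : ℝ} (hL : 0 ≤ L) :
    (bernoulliGaussian θ).real {x | L < |x|} ≤ 2 * Real.exp (-(L ^ 2 / 2)) := by
  have hint : ∀ t : ℝ, Integrable (fun x : ℝ => Real.exp (t * x)) (gaussianReal 0 1) :=
    fun t => integrable_exp_mul_gaussianReal t
  have hmgf : ∀ t : ℝ, ∫ x, Real.exp (t * x) ∂bernoulliGaussian θ ≤ Real.exp (t ^ 2 / 2) := by
    intro t
    have h := mgf_fun_id_gaussianReal (μ := 0) (v := 1)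
    have h2 := congrFun h t
    simp only [mgf] at h2
    rw [integral_bernoulliGaussian (hint t), h2]
    have h3 : 1 ≤ Real.exp (t ^ 2 / 2) := Real.one_le_exp (by positivity)
    have := θ.2.1
    have := θ.2.2
    simp
    nlinarith
  have h1 := measure_ge_le_exp_mul_mgf (μ := bernoulliGaussian θ) (X := fun x => x) L hL
    (integrable_bernoulliGaussian (hint L))
  have h2 := measure_ge_le_exp_mul_mgf (μ := bernoulliGaussian θ) (X := fun x => -x) L hL
    (by simpa using integrable_bernoulliGaussian (hint (-L)))
  have e : Real.exp (-L * L) * Real.exp (L ^ 2 / 2) = Real.exp (-(L ^ 2 / 2)) := by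
    rw [← Real.exp_add]; ring_nf
  have h1' : (bernoulliGaussian θ).real {x | L ≤ x} ≤ Real.exp (-(L ^ 2 / 2)) := by
    rw [← e]
    exact h1.trans (mul_le_mul_of_nonneg_left (hmgf L) (Real.exp_pos _).le)
  have h2' : (bernoulliGaussian θ).real {x | L ≤ -x} ≤ Real.exp (-(L ^ 2 / 2)) := by
    rw [← e]
    refine h2.trans (mul_le_mul_of_nonneg_left ?_ (Real.exp_pos _).le)
    have := hmgf (-L)
    simpa [mgf] using this
  calc (bernoulliGaussian θ).real {x | L < |x|}
      ≤ (bernoulliGaussian θ).real ({x | L ≤ x} ∪ {x | L ≤ -x}) := by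
        refine measureReal_mono (fun x hx => ?_)
        rcases lt_abs.1 (show L < |x| from hx) with h | h
        · exact Or.inl h.le
        · exact Or.inr h.le
    _ ≤ _ := measureReal_union_le _ _
    _ ≤ _ := by linarith

lemma bernoulliGaussianVec_tail (m : ℕ) (θ : unitInterval) {L : ℝ} (hL : 0 ≤ L) :
    (bernoulliGaussianVec m θ).real {x | ∃ i, L < |x i|} ≤
      m * (2 * Real.exp (-(L ^ 2 / 2))) := by
  have h : {x : Fin m → ℝ | ∃ i, L < |x i|} = ⋃ i ∈ (Finset.univ : Finset (Fin m)),
      (fun x : Fin m → ℝ => x i) ⁻¹' {t | L < |t|} := by ext; simp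
  rw [h]
  refine (measureReal_biUnion_finset_le _ _).trans ?_
  calc _ ≤ ∑ i : Fin m, 2 * Real.exp (-(L ^ 2 / 2)) := by
        refine Finset.sum_le_sum fun i _ => ?_
        rw [bernoulliGaussianVec, (measurePreserving_eval (fun _ => bernoulliGaussian θ) i).measureReal_preimage]
        · exact bernoulliGaussian_tail θ hL
        · exact (measurableSet_lt measurable_const (by fun_prop)).nullMeasurableSet
    _ = _ := by simp

/-! ### Mixed moments of independent coordinates -/

section Moments

variable {m n p : ℕ}

/-- The number of times that `f` takes the value `a`. -/
def multiplicity (f : Fin p → Fin n) (a : Fin n) : ℕ := (Finset.univ.filter fun j => f j = a).card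

lemma prod_comp_eq_prod_pow (f : Fin p → Fin n) (g : Fin n → ℝ) :
    ∏ j, g (f j) = ∏ a, g a ^ multiplicity f a := by
  rw [← Finset.prod_fiberwise' Finset.univ f g]
  simp [multiplicity]

/-- The function `h` is general because the identity, the square and the truncation are all needed.
-/
lemma integral_prod_comp (θ : unitInterval) {σ : Fin n → Fin m} (hσ : Function.Injective σ)
    {h : ℝ → ℝ} (hh : Measurable h) (f : Fin p → Fin n) :
    ∫ x, ∏ j, h (x (σ (f j))) ∂bernoulliGaussianVec m θ =
      ∏ a, ∫ t, h t ^ multiplicity f a ∂bernoulliGaussian θ := by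
  have hind : iIndepFun (fun (i : Fin m) (x : Fin m → ℝ) => x i) (bernoulliGaussianVec m θ) :=
    iIndepFun_pi (X := fun _ t => t) (fun i => aemeasurable_id)
  have := (hind.precomp hσ).integral_fun_prod_comp (f := fun a t => h t ^ multiplicity f a)
    (fun a => (measurable_pi_apply _).aemeasurable)
    (fun a => (hh.pow_const _).aestronglyMeasurable)
  simp_rw [fun x : Fin m → ℝ => prod_comp_eq_prod_pow f (fun a => h (x (σ a)))]
  refine this.trans (Finset.prod_congr rfl fun a _ => ?_)
  have hmp := measurePreserving_eval (fun _ : Fin m => bernoulliGaussian θ) (σ a)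
  rw [← hmp.map_eq, integral_map hmp.measurable.aemeasurable
    (hh.pow_const _).aestronglyMeasurable]
  rfl

/-- The mixed moments of a vector with i.i.d. Bernoulli-Gaussian entries. -/
noncomputable def mixedMoment (θ : unitInterval) (f : Fin p → Fin n) : ℝ :=
  ∏ a, coordMoment θ (multiplicity f a)

lemma integral_prod_eq_mixedMoment (θ : unitInterval) {σ : Fin n → Fin m}
    (hσ : Function.Injective σ) (f : Fin p → Fin n) :
    ∫ x, ∏ j, x (σ (f j)) ∂bernoulliGaussianVec m θ = mixedMoment θ f :=
  integral_prod_comp θ hσ measurable_id f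

lemma multiplicity_le (f : Fin p → Fin n) (a : Fin n) : multiplicity f a ≤ p := by
  simpa [multiplicity] using Finset.card_filter_le (Finset.univ : Finset (Fin p)) fun j => f j = a

lemma multiplicity_eq_zero_iff (f : Fin p → Fin n) (a : Fin n) :
    multiplicity f a = 0 ↔ a ∉ Finset.univ.image f := by
  simp [multiplicity, Finset.filter_eq_empty_iff]

/-- Each distinct index contributes one even moment, hence one factor `θ`. This is the variance
proxy in Bernstein's inequality. -/
lemma integral_prod_sq_le (θ : unitInterval) {σ : Fin n → Fin m}
    (hσ : Function.Injective σ) (f : Fin p → Fin n) :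
    ∫ x, (∏ j, x (σ (f j))) ^ 2 ∂bernoulliGaussianVec m θ ≤
      momentBound p ^ p * (θ : ℝ) ^ (Finset.univ.image f).card := by
  simp_rw [← Finset.prod_pow]
  rw [integral_prod_comp (h := fun t => t ^ 2) θ hσ (by fun_prop) f]
  have hM := one_le_momentBound p
  have h0 : ∀ a, ∫ t : ℝ, ((t ^ 2) ^ multiplicity f a) ∂bernoulliGaussian θ =
      coordMoment θ (2 * multiplicity f a) := fun a => by simp [coordMoment, pow_mul]
  simp_rw [h0]
  rw [← Finset.prod_subset (Finset.subset_univ (Finset.univ.image f))]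
  · calc _ ≤ ∏ a ∈ Finset.univ.image f, momentBound p * θ := by
          refine Finset.prod_le_prod (fun a _ => ?_) fun a ha => ?_
          · exact integral_nonneg fun x => (even_two_mul _).pow_nonneg x
          · exact coordMoment_two_mul_le θ (fun h => (multiplicity_eq_zero_iff f a).1 h ha)
              (multiplicity_le f a)
      _ = (momentBound p * θ) ^ (Finset.univ.image f).card := by simp
      _ ≤ _ := by
        rw [mul_pow]
        refine mul_le_mul_of_nonneg_right (pow_le_pow_right₀ hM ?_) (pow_nonneg θ.2.1 _)
        simpa using Finset.card_image_le (s := (Finset.univ : Finset (Fin p))) (f := f)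
  · intro a _ ha
    rw [(multiplicity_eq_zero_iff f a).2 ha, mul_zero, coordMoment_zero]

lemma integrable_prod_pow (θ : unitInterval) (F : Fin p → Fin m) (r : ℕ) :
    Integrable (fun x => (∏ j, x (F j)) ^ r) (bernoulliGaussianVec m θ) := by
  simp_rw [fun x : Fin m → ℝ => prod_comp_eq_prod_pow F x, ← Finset.prod_pow, ← pow_mul]
  exact Integrable.fintype_prod (f := fun i t => t ^ (multiplicity F i * r)) fun i =>
    integrable_bernoulliGaussian (integrable_pow_gaussian _)

end Moments


/-- Induction on the length of the tuple: a new index either repeats one of at most `p` old values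
at no cost, or is one of `n` values at the cost of a factor `θ`. So each step multiplies the sum by
at most `p + nθ ≤ (p + 1) nθ`. -/
lemma sum_pow_card_image_le {θ : ℝ} (hθ : 0 ≤ θ) {n : ℕ} (hn : 1 ≤ n * θ) (p : ℕ) :
    ∑ f : Fin p → Fin n, θ ^ (Finset.univ.image f).card ≤ p.factorial * (n * θ) ^ p := by
  induction p with
  | zero => simp
  | succ p ih =>
    rw [← (Fin.consEquiv fun _ => Fin n).sum_comp, Fintype.sum_prod_type, Finset.sum_comm]
    have himg : ∀ (a : Fin n) (g : Fin p → Fin n),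
        Finset.univ.image (Fin.cons a g : Fin (p + 1) → Fin n) =
          insert a (Finset.univ.image g) := by
      intro a g; ext b; simp [Fin.exists_fin_succ, eq_comm]
    have key : ∀ g : Fin p → Fin n, ∑ a : Fin n, θ ^ (insert a (Finset.univ.image g)).card ≤
        ((p + 1) * (n * θ)) * θ ^ (Finset.univ.image g).card := by
      intro g
      set S := Finset.univ.image g with hS
      have hSp : (S.card : ℝ) ≤ p := by
        exact_mod_cast (Finset.card_image_le (s := (Finset.univ : Finset (Fin p))) (f := g)).trans
          (by simp)
      have h1 : ∀ a : Fin n, θ ^ (insert a S).card ≤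
          (if a ∈ S then θ ^ S.card else 0) + θ * θ ^ S.card := by
        intro a
        by_cases ha : a ∈ S
        · simp only [ha, Finset.insert_eq_of_mem, if_true]
          have := mul_nonneg hθ (pow_nonneg hθ S.card)
          linarith
        · simp [ha, Finset.card_insert_of_notMem, pow_succ, mul_comm]
      refine (Finset.sum_le_sum fun a _ => h1 a).trans ?_
      rw [Finset.sum_add_distrib, Finset.sum_ite_mem]
      simp only [Finset.univ_inter, Finset.sum_const, Finset.card_univ, Fintype.card_fin,
        nsmul_eq_mul]
      have h0 := pow_nonneg hθ S.card
      have h2 : (S.card : ℝ) + n * θ ≤ (p + 1) * (n * θ) := by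
        have : (p : ℝ) ≤ p * (n * θ) := le_mul_of_one_le_right (Nat.cast_nonneg p) hn
        linarith
      nlinarith [mul_le_mul_of_nonneg_right h2 h0]
    calc _ = ∑ g : Fin p → Fin n, ∑ a : Fin n, θ ^ (insert a (Finset.univ.image g)).card := by
          refine Finset.sum_congr rfl fun g _ => Finset.sum_congr rfl fun a _ => ?_
          rw [← himg]; rfl
      _ ≤ ∑ g : Fin p → Fin n, ((p + 1) * (n * θ)) * θ ^ (Finset.univ.image g).card :=
          Finset.sum_le_sum fun g _ => key g
      _ = ((p + 1) * (n * θ)) * ∑ g : Fin p → Fin n, θ ^ (Finset.univ.image g).card := by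
          rw [Finset.mul_sum]
      _ ≤ ((p + 1) * (n * θ)) * (p.factorial * (n * θ) ^ p) :=
          mul_le_mul_of_nonneg_left ih (by positivity)
      _ = _ := by push_cast [Nat.factorial_succ]; ring

/-- Greedy colouring of a graph with degrees less than `N`. -/
lemma exists_coloring {α : Type*} [Fintype α] [DecidableEq α] (r : α → α → Prop)
    [DecidableRel r] (hr : ∀ a b, r a b → r b a) {N : ℕ} (hN : 0 < N)
    (h : ∀ a, (Finset.univ.filter fun b => r a b).card < N) :
    ∃ c : α → Fin N, ∀ a b, a ≠ b → r a b → c a ≠ c b := by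
  suffices H : ∀ s : Finset α, ∃ c : α → Fin N, ∀ a ∈ s, ∀ b ∈ s, a ≠ b → r a b → c a ≠ c b by
    obtain ⟨c, hc⟩ := H Finset.univ
    exact ⟨c, fun a b => hc a (Finset.mem_univ _) b (Finset.mem_univ _)⟩
  intro s
  induction s using Finset.induction_on with
  | empty => exact ⟨fun _ => ⟨0, hN⟩, by simp⟩
  | insert x s hx ih =>
    obtain ⟨c, hc⟩ := ih
    obtain ⟨y, hy⟩ : ∃ y : Fin N, y ∉ (Finset.univ.filter fun b => r x b).image c := by
      by_contra! hcon
      have h1 := Finset.card_le_card (show (Finset.univ : Finset (Fin N)) ⊆ _ from fun y _ => hcon y)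
      have h2 := Finset.card_image_le (s := Finset.univ.filter fun b => r x b) (f := c)
      have h3 := h x
      simp only [Finset.card_univ, Fintype.card_fin] at h1
      omega
    have hy' : ∀ b, r x b → c b ≠ y := fun b hb hcb =>
      hy (Finset.mem_image.2 ⟨b, by simpa using hb, hcb⟩)
    refine ⟨Function.update c x y, fun a ha b hb hab hrab => ?_⟩
    rcases Finset.mem_insert.1 ha with rfl | ha'
    · rw [Function.update_self, Function.update_of_ne hab.symm]
      exact (hy' b hrab).symm
    · rcases Finset.mem_insert.1 hb with rfl | hb'
      · rw [Function.update_self, Function.update_of_ne hab]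
        exact hy' a (hr _ _ hrab)
      · rw [Function.update_of_ne (ne_of_mem_of_not_mem ha' hx),
          Function.update_of_ne (ne_of_mem_of_not_mem hb' hx)]
        exact hc a ha' b hb' hab hrab

/-! ### Bernstein's inequality under local dependence -/

section Product

variable {ι : Type*} [Fintype ι] [DecidableEq ι] {μ : ι → Measure ℝ}
  [∀ i, IsProbabilityMeasure (μ i)]

lemma integral_mul_of_dependsOn {F G : (ι → ℝ) → ℝ} (hF : Measurable F) (hG : Measurable G)
    {S T : Finset ι} (hST : Disjoint S T) (hFS : DependsOn F S) (hGT : DependsOn G T) :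
    ∫ x, F x * G x ∂Measure.pi μ = (∫ x, F x ∂Measure.pi μ) * ∫ x, G x ∂Measure.pi μ := by
  have hind : iIndepFun (fun (i : ι) (x : ι → ℝ) => x i) (Measure.pi μ) :=
    iIndepFun_pi (X := fun _ t => t) (fun i => aemeasurable_id)
  have h := hind.indepFun_finset S T hST (fun i => measurable_pi_apply i)
  -- Extension by zero makes `F` and `G` functions of the restricted coordinates; the values outside
  -- `S` and `T` do not matter.
  let ext : (S : Finset ι) → (S → ℝ) → ι → ℝ := fun S y i => if h : i ∈ S then y ⟨i, h⟩ else 0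
  have hext : ∀ S, Measurable (ext S) := fun S => measurable_pi_lambda _ fun i => by
    by_cases h : i ∈ S <;> simp only [ext, h, dite_true, dite_false] <;> fun_prop
  have h2 := h.comp (hF.comp (hext S)) (hG.comp (hext T))
  have eF : (F ∘ ext S) ∘ (fun (x : ι → ℝ) (i : S) => x i) = F := by
    ext x; refine hFS fun i hi => ?_
    simp only [ext, Finset.mem_coe.1 hi, dite_true]
  have eG : (G ∘ ext T) ∘ (fun (x : ι → ℝ) (i : T) => x i) = G := by
    ext x; refine hGT fun i hi => ?_
    simp only [ext, Finset.mem_coe.1 hi, dite_true]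
  rw [eF, eG] at h2
  exact h2.integral_fun_mul_eq_mul_integral hF.aestronglyMeasurable hG.aestronglyMeasurable

lemma integral_prod_of_dependsOn {α : Type*} [DecidableEq α] {F : α → (ι → ℝ) → ℝ}
    (hF : ∀ a, Measurable (F a)) {S : α → Finset ι} (hFS : ∀ a, DependsOn (F a) (S a))
    (s : Finset α) (hS : ∀ a ∈ s, ∀ b ∈ s, a ≠ b → Disjoint (S a) (S b)) :
    ∫ x, ∏ a ∈ s, F a x ∂Measure.pi μ = ∏ a ∈ s, ∫ x, F a x ∂Measure.pi μ := by
  induction s using Finset.induction_on with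
  | empty => simp
  | insert b s hb ih =>
    simp_rw [Finset.prod_insert hb]
    rw [integral_mul_of_dependsOn (hF b) (Finset.measurable_fun_prod _ fun a _ => hF a)
      (T := s.biUnion S) _ (hFS b), ih fun a ha c hc => hS a (Finset.mem_insert_of_mem ha) c
      (Finset.mem_insert_of_mem hc)]
    · intro x y hxy
      refine Finset.prod_congr rfl fun a ha => hFS a fun i hi => hxy i ?_
      simpa using ⟨a, ha, hi⟩
    · rw [Finset.disjoint_biUnion_right]
      intro a ha
      exact hS b (Finset.mem_insert_self _ _) a (Finset.mem_insert_of_mem ha)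
        fun h => hb (h ▸ ha)

lemma exp_le_one_add_add_sq {x : ℝ} (hx : |x| ≤ 1) : Real.exp x ≤ 1 + x + x ^ 2 := by
  have := Real.abs_exp_sub_one_sub_id_le hx
  have := (abs_le.1 this).2
  linarith

/-- Second order expansion of the exponential, valid since `|l W| ≤ 1`; the linear term has mean
zero. -/
lemma integral_exp_le {Ω : Type*} [MeasurableSpace Ω] {P : Measure Ω} [IsProbabilityMeasure P]
    {W : Ω → ℝ} (hW : Measurable W) {R V l : ℝ} (hl : 0 ≤ l) (hlR : l * R ≤ 1)
    (hR : ∀ x, |W x| ≤ R) (h0 : ∫ x, W x ∂P = 0) (hV : ∫ x, W x ^ 2 ∂P ≤ V) :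
    ∫ x, Real.exp (l * W x) ∂P ≤ Real.exp (l ^ 2 * V) := by
  have hb : ∀ x, |l * W x| ≤ 1 := fun x => by
    rw [abs_mul, abs_of_nonneg hl]
    exact (mul_le_mul_of_nonneg_left (hR x) hl).trans hlR
  have hi1 : Integrable (fun x => l * W x) P :=
    Integrable.of_bound (by fun_prop) 1 (.of_forall fun x => hb x)
  have hi2 : Integrable (fun x => (l * W x) ^ 2) P :=
    Integrable.of_bound (by fun_prop) 1 (.of_forall fun x => by
      rw [Real.norm_eq_abs, abs_pow]; exact pow_le_one₀ (abs_nonneg _) (hb x))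
  have hi3 : Integrable (fun x => Real.exp (l * W x)) P :=
    Integrable.of_bound (by fun_prop) (Real.exp 1) (.of_forall fun x => by
      rw [Real.norm_eq_abs, abs_of_pos (Real.exp_pos _)]
      exact Real.exp_le_exp.2 ((le_abs_self _).trans (hb x)))
  calc _ ≤ ∫ x, (1 + l * W x + (l * W x) ^ 2) ∂P :=
        integral_mono hi3 (((integrable_const _).add hi1).add hi2)
          fun x => exp_le_one_add_add_sq (hb x)
    _ = 1 + l ^ 2 * ∫ x, W x ^ 2 ∂P := by
        rw [integral_add ((integrable_const 1).fun_add hi1) hi2,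
          integral_add (integrable_const _) hi1,
          integral_const_mul, h0]
        simp_rw [mul_pow]
        rw [integral_const_mul]
        simp
    _ ≤ 1 + l ^ 2 * V := by gcongr
    _ ≤ _ := by linarith [Real.add_one_le_exp (l ^ 2 * V)]

variable {α : Type*} [Fintype α] [DecidableEq α]

/-- A colouring with `N` colours splits the sum into classes of independent terms. Convexity bounds
the exponential of the whole sum by the average over the classes, which is why the exponent carries
`l / N` instead of `l`. -/
lemma integral_exp_sum_le {W : α → (ι → ℝ) → ℝ} (hW : ∀ a, Measurable (W a))
    {S : α → Finset ι} (hWS : ∀ a, DependsOn (W a) (S a)) {N : ℕ} (hN : 0 < N)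
    (hdeg : ∀ a, (Finset.univ.filter fun b => ¬ Disjoint (S a) (S b)).card < N)
    {R V l : ℝ} (hl : 0 ≤ l) (hlR : l * R ≤ 1) (hR : ∀ a x, |W a x| ≤ R)
    (h0 : ∀ a, ∫ x, W a x ∂Measure.pi μ = 0)
    (hV : ∀ a, ∫ x, W a x ^ 2 ∂Measure.pi μ ≤ V) (hV0 : 0 ≤ V) :
    ∫ x, Real.exp (l / N * ∑ a, W a x) ∂Measure.pi μ ≤
      Real.exp (l ^ 2 * V * Fintype.card α) := by
  obtain ⟨c, hc⟩ := exists_coloring (fun a b => ¬ Disjoint (S a) (S b))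
    (fun a b h h' => h h'.symm) hN hdeg
  have hN' : (N : ℝ) ≠ 0 := by positivity
  have hR0 : ∀ a x, |l * W a x| ≤ 1 := fun a x => by
    rw [abs_mul, abs_of_nonneg hl]
    exact (mul_le_mul_of_nonneg_left (hR a x) hl).trans hlR
  have hclass : ∀ y : Fin N, ∫ x, ∏ a ∈ Finset.univ.filter (fun a => c a = y),
      Real.exp (l * W a x) ∂Measure.pi μ ≤ Real.exp (l ^ 2 * V * Fintype.card α) := by
    intro y
    rw [integral_prod_of_dependsOn (F := fun a x => Real.exp (l * W a x)) (S := S)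
      (fun a => by have := hW a; fun_prop)
      (fun a x z hxz => by simp only [hWS a hxz])]
    · calc _ ≤ ∏ a ∈ Finset.univ.filter (fun a => c a = y), Real.exp (l ^ 2 * V) :=
            Finset.prod_le_prod (fun a _ => integral_nonneg fun x => (Real.exp_pos _).le)
              fun a _ => integral_exp_le (hW a) hl hlR (hR a) (h0 a) (hV a)
        _ = Real.exp (l ^ 2 * V * (Finset.univ.filter (fun a => c a = y)).card) := by
            rw [Finset.prod_const, ← Real.exp_nat_mul]; ring_nf
        _ ≤ _ := by
            refine Real.exp_le_exp.2 (mul_le_mul_of_nonneg_left ?_ (by positivity))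
            exact_mod_cast Finset.card_filter_le _ _
    · intro a ha b hb hab
      by_contra h
      simp only [Finset.mem_filter, Finset.mem_univ, true_and] at ha hb
      exact hc a b hab h (ha.trans hb.symm)
  have hint : ∀ y : Fin N, Integrable (fun x => ∏ a ∈ Finset.univ.filter (fun a => c a = y),
      Real.exp (l * W a x)) (Measure.pi μ) := by
    intro y
    refine Integrable.of_bound (C := ∏ a ∈ Finset.univ.filter (fun a => c a = y), Real.exp 1)
      (Finset.measurable_fun_prod _ fun a _ => by have := hW a; fun_prop).aestronglyMeasurable
      (.of_forall fun x => ?_)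
    rw [Real.norm_eq_abs, abs_of_nonneg (Finset.prod_nonneg fun a _ => (Real.exp_pos _).le)]
    exact Finset.prod_le_prod (fun a _ => (Real.exp_pos _).le) fun a _ =>
      Real.exp_le_exp.2 ((le_abs_self _).trans (hR0 a x))
  -- Jensen's inequality with weight `1/N` on each colour.
  have hpt : ∀ x, Real.exp (l / N * ∑ a, W a x) ≤ ∑ y : Fin N, (N : ℝ)⁻¹ *
      ∏ a ∈ Finset.univ.filter (fun a => c a = y), Real.exp (l * W a x) := by
    intro x
    have hJ := convexOn_exp.map_sum_le (t := (Finset.univ : Finset (Fin N)))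
      (w := fun _ => (N : ℝ)⁻¹)
      (p := fun y => ∑ a ∈ Finset.univ.filter (fun a => c a = y), l * W a x)
      (fun _ _ => by positivity) (by simp [hN']) (fun _ _ => Set.mem_univ _)
    simp only [smul_eq_mul, Real.exp_sum] at hJ
    refine le_trans (le_of_eq ?_) hJ
    rw [← Real.exp_sum, ← Finset.mul_sum, Finset.sum_fiberwise, ← Finset.mul_sum]
    congr 1
    ring
  calc _ ≤ ∫ x, ∑ y : Fin N, (N : ℝ)⁻¹ *
      ∏ a ∈ Finset.univ.filter (fun a => c a = y), Real.exp (l * W a x) ∂Measure.pi μ := by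
        refine integral_mono_of_nonneg (.of_forall fun x => (Real.exp_pos _).le)
          (integrable_finsetSum _ fun y _ => (hint y).const_mul _) (.of_forall hpt)
    _ = ∑ y : Fin N, (N : ℝ)⁻¹ * ∫ x,
      ∏ a ∈ Finset.univ.filter (fun a => c a = y), Real.exp (l * W a x) ∂Measure.pi μ := by
        rw [integral_finsetSum _ fun y _ => (hint y).const_mul _]
        simp_rw [integral_const_mul]
    _ ≤ ∑ y : Fin N, (N : ℝ)⁻¹ * Real.exp (l ^ 2 * V * Fintype.card α) :=
        Finset.sum_le_sum fun y _ => mul_le_mul_of_nonneg_left (hclass y) (by positivity)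
    _ = _ := by simp [hN']

/-- Bernstein's inequality for a sum of bounded variables whose dependency graph has bounded
degrees. -/
lemma measureReal_abs_sum_sub_ge_le {Z : α → (ι → ℝ) → ℝ} (hZ : ∀ a, Measurable (Z a))
    {S : α → Finset ι} (hZS : ∀ a, DependsOn (Z a) (S a)) {N : ℕ} (hN : 0 < N)
    (hdeg : ∀ a, (Finset.univ.filter fun b => ¬ Disjoint (S a) (S b)).card < N)
    {R V l t c : ℝ} (hl : 0 ≤ l) (hlR : 2 * l * R ≤ 1) (hR : ∀ a x, |Z a x| ≤ R)
    (hc : ∀ a, ∫ x, Z a x ∂Measure.pi μ = c)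
    (hV : ∀ a, ∫ x, Z a x ^ 2 ∂Measure.pi μ ≤ V) (hV0 : 0 ≤ V) :
    (Measure.pi μ).real {x | t ≤ |∑ a, (Z a x - c)|} ≤
      2 * Real.exp (-(l * t / N) + l ^ 2 * V * Fintype.card α) := by
  have hi1 : ∀ a, Integrable (Z a) (Measure.pi μ) := fun a =>
    Integrable.of_bound (hZ a).aestronglyMeasurable R (.of_forall fun x => hR a x)
  have hi2 : ∀ a, Integrable (fun x => Z a x ^ 2) (Measure.pi μ) := fun a =>
    Integrable.of_bound ((hZ a).pow_const 2).aestronglyMeasurable (R ^ 2) (.of_forall fun x => by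
      rw [Real.norm_eq_abs, abs_pow]; exact pow_le_pow_left₀ (abs_nonneg _) (hR a x) 2)
  have hcR : ∀ a : α, |c| ≤ R := fun a => by
    rw [← hc a]
    have := norm_integral_le_of_norm_le_const (μ := Measure.pi μ) (f := Z a) (C := R)
      (.of_forall fun x => hR a x)
    simpa using this
  -- The signs `σ = ±1` serve the two tails. Centring doubles the sup bound, whence `2 * l * R ≤ 1`,
  -- and does not increase the second moment.
  have hmgf : ∀ σ : ℝ, σ ^ 2 = 1 →
      ∫ x, Real.exp (l / N * ∑ a, σ * (Z a x - c)) ∂Measure.pi μ ≤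
        Real.exp (l ^ 2 * V * Fintype.card α) := by
    intro σ hσ
    have hσ' : |σ| = 1 := by
      have : |σ| ^ 2 = 1 := by rw [sq_abs, hσ]
      nlinarith [abs_nonneg σ]
    refine integral_exp_sum_le (W := fun a x => σ * (Z a x - c)) (S := S) (R := 2 * R)
      (fun a => by have := hZ a; fun_prop) (fun a x y hxy => by simp only [hZS a hxy])
      hN hdeg hl (by linarith) (fun a x => ?_) (fun a => ?_) (fun a => ?_) hV0
    · rw [abs_mul, hσ', one_mul]
      refine (abs_sub _ _).trans ?_
      linarith [hR a x, hcR a]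
    · rw [integral_const_mul, integral_sub (hi1 a) (integrable_const _), hc a]; simp
    · have : ∀ x, (σ * (Z a x - c)) ^ 2 = Z a x ^ 2 - 2 * c * Z a x + c ^ 2 := fun x => by
        rw [mul_pow, hσ]; ring
      simp_rw [this]
      rw [integral_add (show Integrable (fun x => Z a x ^ 2 - 2 * c * Z a x) (Measure.pi μ)
          from (hi2 a).sub ((hi1 a).const_mul _)) (integrable_const _),
        integral_sub (hi2 a) ((hi1 a).const_mul _), integral_const_mul, hc a]
      simp
      nlinarith [hV a, sq_nonneg c]
  have hint : ∀ σ : ℝ, Integrable (fun x => Real.exp (l / N * ∑ a, σ * (Z a x - c)))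
      (Measure.pi μ) := by
    intro σ
    refine Integrable.of_bound (C := Real.exp (l / N * ∑ a : α, |σ| * (2 * R)))
      (by have := hZ; fun_prop) (.of_forall fun x => ?_)
    rw [Real.norm_eq_abs, abs_of_pos (Real.exp_pos _)]
    refine Real.exp_le_exp.2 (mul_le_mul_of_nonneg_left
      (Finset.sum_le_sum fun a _ => (le_abs_self _).trans ?_) (by positivity))
    rw [abs_mul]
    refine mul_le_mul_of_nonneg_left ((abs_sub _ _).trans ?_) (abs_nonneg _)
    linarith [hR a x, hcR a]
  have hone : ∀ σ : ℝ, σ ^ 2 = 1 → (Measure.pi μ).real {x | t ≤ ∑ a, σ * (Z a x - c)} ≤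
      Real.exp (-(l * t / N) + l ^ 2 * V * Fintype.card α) := by
    intro σ hσ
    refine (measure_ge_le_exp_mul_mgf (μ := Measure.pi μ)
      (X := fun x => ∑ a, σ * (Z a x - c)) t (t := l / N) (by positivity) (hint σ)).trans ?_
    rw [Real.exp_add, show -(l / N) * t = -(l * t / N) by ring]
    exact mul_le_mul_of_nonneg_left (hmgf σ hσ) (Real.exp_pos _).le
  calc (Measure.pi μ).real {x | t ≤ |∑ a, (Z a x - c)|}
      ≤ (Measure.pi μ).real ({x | t ≤ ∑ a, (1 : ℝ) * (Z a x - c)} ∪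
          {x | t ≤ ∑ a, (-1 : ℝ) * (Z a x - c)}) := by
        refine measureReal_mono (fun x hx => ?_)
        rcases le_abs.1 (show t ≤ |∑ a, (Z a x - c)| from hx) with h | h
        · left; simpa using h
        · right; simpa [← Finset.sum_neg_distrib] using h
    _ ≤ _ := measureReal_union_le _ _
    _ ≤ _ := by linarith [hone 1 (by norm_num), hone (-1) (by norm_num)]

end Product


/-- Truncation at level `L`. -/
noncomputable def trunc (L t : ℝ) : ℝ := if |t| ≤ L then t else 0

@[fun_prop]
lemma measurable_trunc (L : ℝ) : Measurable (trunc L) :=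
  Measurable.ite (measurableSet_le (by fun_prop) measurable_const) measurable_id measurable_const

lemma abs_trunc_le_abs (L t : ℝ) : |trunc L t| ≤ |t| := by
  unfold trunc; split_ifs <;> simp

lemma abs_trunc_le {L : ℝ} (hL : 0 ≤ L) (t : ℝ) : |trunc L t| ≤ L := by
  unfold trunc; split_ifs with h
  · exact h
  · simpa using hL

lemma trunc_of_le {L t : ℝ} (h : |t| ≤ L) : trunc L t = t := if_pos h

/-! ### Concentration of the empirical mixed moments -/

section Concentration

variable {m n p : ℕ}

/-- The mixed moments of truncated Bernoulli-Gaussian variables. -/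
noncomputable def truncMoment (θ : unitInterval) (L : ℝ) (f : Fin p → Fin n) : ℝ :=
  ∏ a, ∫ t, trunc L t ^ multiplicity f a ∂bernoulliGaussian θ

lemma integral_prod_trunc (θ : unitInterval) (L : ℝ) {σ : Fin n → Fin m}
    (hσ : Function.Injective σ) (f : Fin p → Fin n) :
    ∫ x, ∏ j, trunc L (x (σ (f j))) ∂bernoulliGaussianVec m θ = truncMoment θ L f :=
  integral_prod_comp θ hσ (measurable_trunc L) f

lemma abs_prod_trunc_le {L : ℝ} (hL : 0 ≤ L) (F : Fin p → Fin m) (x : Fin m → ℝ) :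
    |∏ j, trunc L (x (F j))| ≤ L ^ p := by
  rw [Finset.abs_prod]
  calc _ ≤ ∏ _j : Fin p, L := Finset.prod_le_prod (fun _ _ => abs_nonneg _)
        fun j _ => abs_trunc_le hL _
    _ = L ^ p := by simp

lemma integral_prod_trunc_sq_le (θ : unitInterval) {L : ℝ} (hL : 0 ≤ L) {σ : Fin n → Fin m}
    (hσ : Function.Injective σ) (f : Fin p → Fin n) :
    ∫ x, (∏ j, trunc L (x (σ (f j)))) ^ 2 ∂bernoulliGaussianVec m θ ≤
      momentBound p ^ p * (θ : ℝ) ^ (Finset.univ.image f).card := by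
  refine le_trans (integral_mono ?_ (integrable_prod_pow θ (fun j => σ (f j)) 2) fun x => ?_)
    (integral_prod_sq_le θ hσ f)
  · refine Integrable.of_bound (C := (L ^ p) ^ 2)
      (by fun_prop : Measurable fun x : Fin m → ℝ =>
        (∏ j, trunc L (x (σ (f j)))) ^ 2).aestronglyMeasurable (.of_forall fun x => ?_)
    rw [Real.norm_eq_abs, abs_pow]
    exact pow_le_pow_left₀ (abs_nonneg _) (abs_prod_trunc_le hL (fun j => σ (f j)) x) 2
  · refine sq_le_sq.2 ?_
    rw [Finset.abs_prod, Finset.abs_prod]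
    exact Finset.prod_le_prod (fun _ _ => abs_nonneg _) fun j _ => abs_trunc_le_abs L _

/-- Truncation changes the product only on the event that some coordinate exceeds `L`, and there by
at most `|z|`, as the truncated product is `z` or `0`. The inequality `2|z| ≤ z²/M + M` then
separates the second moment from the probability of the event. -/
lemma abs_truncMoment_sub_mixedMoment_le (θ : unitInterval) {L : ℝ} (hL : 0 ≤ L)
    {σ : Fin n → Fin m} (hσ : Function.Injective σ) (f : Fin p → Fin n) {M : ℝ} (hM : 0 < M) :
    |truncMoment θ L f - mixedMoment θ f| ≤
      momentBound p ^ p / M + M * (m * (2 * Real.exp (-(L ^ 2 / 2)))) := by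
  set bad : Set (Fin m → ℝ) := {x | ∃ i, L < |x i|} with hbad
  have hbadm : MeasurableSet bad := by
    have : bad = ⋃ i, {x | L < |x i|} := by ext; simp [hbad]
    rw [this]
    exact MeasurableSet.iUnion fun i => measurableSet_lt measurable_const (by fun_prop)
  have hi1 : Integrable (fun x => ∏ j, x (σ (f j))) (bernoulliGaussianVec m θ) := by
    simpa using integrable_prod_pow θ (fun j => σ (f j)) 1
  have hi2 := integrable_prod_pow θ (fun j => σ (f j)) 2
  have hi3 : Integrable (fun x => ∏ j, trunc L (x (σ (f j)))) (bernoulliGaussianVec m θ) :=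
    Integrable.of_bound (C := L ^ p)
      (by fun_prop : Measurable fun x : Fin m → ℝ =>
        ∏ j, trunc L (x (σ (f j)))).aestronglyMeasurable
      (.of_forall fun x => abs_prod_trunc_le hL (fun j => σ (f j)) x)
  have hi4 : Integrable (bad.indicator fun _ => M) (bernoulliGaussianVec m θ) :=
    (integrable_const M).indicator hbadm
  rw [← integral_prod_trunc θ L hσ f, ← integral_prod_eq_mixedMoment θ hσ f, ← integral_sub hi3 hi1]
  have hpt : ∀ x : Fin m → ℝ, ‖∏ j, trunc L (x (σ (f j))) - ∏ j, x (σ (f j))‖ ≤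
      (∏ j, x (σ (f j))) ^ 2 / M + bad.indicator (fun _ => M) x := by
    intro x
    set z := ∏ j, x (σ (f j)) with hz
    by_cases hx : x ∈ bad
    · rw [Set.indicator_of_mem hx]
      have h1 : |∏ j, trunc L (x (σ (f j))) - z| ≤ |z| := by
        by_cases hj : ∀ j, |x (σ (f j))| ≤ L
        · have : ∏ j, trunc L (x (σ (f j))) = z :=
            Finset.prod_congr rfl fun j _ => trunc_of_le (hj j)
          rw [this]; simp
        · push Not at hj
          obtain ⟨j, hj⟩ := hj
          rw [Finset.prod_eq_zero (Finset.mem_univ j) (if_neg (not_le.2 hj))]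
          simp
      refine h1.trans ?_
      have h2 : 0 ≤ (|z| - M) ^ 2 / M := by positivity
      have h3 : (|z| - M) ^ 2 / M = z ^ 2 / M + M - 2 * |z| := by
        rw [sub_sq, sq_abs]; field_simp
        ring
      have := abs_nonneg z
      linarith
    · have h1 : ∏ j, trunc L (x (σ (f j))) = z := by
        refine Finset.prod_congr rfl fun j _ => trunc_of_le ?_
        by_contra h
        exact hx ⟨_, not_le.1 h⟩
      rw [h1, Set.indicator_of_notMem hx]
      simp
      positivity
  calc |∫ x, (∏ j, trunc L (x (σ (f j))) - ∏ j, x (σ (f j))) ∂bernoulliGaussianVec m θ|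
      ≤ ∫ x, ((∏ j, x (σ (f j))) ^ 2 / M + bad.indicator (fun _ => M) x)
          ∂bernoulliGaussianVec m θ :=
        norm_integral_le_of_norm_le ((hi2.div_const M).add hi4) (.of_forall hpt)
    _ = (∫ x, (∏ j, x (σ (f j))) ^ 2 ∂bernoulliGaussianVec m θ) / M +
          M * (bernoulliGaussianVec m θ).real bad := by
        rw [integral_add (hi2.div_const M) hi4, integral_div, integral_indicator_const _ hbadm,
          smul_eq_mul, mul_comm M]
    _ ≤ _ := by
        have h1 := integral_prod_sq_le θ hσ f
        have h2 : momentBound p ^ p * (θ : ℝ) ^ (Finset.univ.image f).card ≤ momentBound p ^ p :=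
          mul_le_of_le_one_right (by have := one_le_momentBound p; positivity)
            (pow_le_one₀ θ.2.1 θ.2.2)
        have h3 := bernoulliGaussianVec_tail m θ hL
        gcongr
        linarith

/-- The allowed deviation of the empirical mixed moment of type `f`. -/
noncomputable def tolerance (θ : unitInterval) (τ : ℝ) (f : Fin p → Fin n) : ℝ :=
  τ * √((θ : ℝ) ^ (Finset.univ.image f).card / (p.factorial * (n * θ) ^ p))

/-- The normalisation in `tolerance` is exactly the bound of `sum_pow_card_image_le`, so entrywise
tolerances add up to Frobenius accuracy `τ`. -/
lemma sum_tolerance_sq_le {θ : unitInterval} (hn : 1 ≤ n * (θ : ℝ)) (τ : ℝ) :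
    ∑ f : Fin p → Fin n, tolerance θ τ f ^ 2 ≤ τ ^ 2 := by
  have hθ := θ.2.1
  have h0 : 0 < (p.factorial : ℝ) * (n * θ) ^ p := by
    have : 0 < (n : ℝ) * θ := by linarith
    positivity
  have h1 : ∀ f : Fin p → Fin n, tolerance θ τ f ^ 2 =
      τ ^ 2 / (p.factorial * (n * θ) ^ p) * (θ : ℝ) ^ (Finset.univ.image f).card := by
    intro f
    rw [tolerance, mul_pow, Real.sq_sqrt (by positivity)]
    ring
  simp_rw [h1]
  rw [← Finset.mul_sum, div_mul_eq_mul_div, div_le_iff₀ h0]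
  exact mul_le_mul_of_nonneg_left (sum_pow_card_image_le hθ hn p) (sq_nonneg τ)

lemma shift_injective {e : Fin n → Fin m} (he : Function.Injective e) (i : Fin m) :
    Function.Injective fun a => i + e a := fun _ _ h => he (add_left_cancel h)

variable [NeZero m]

/-- A shift `i'` that shares a coordinate with `i` has the form `i + F j - F j'`, which leaves at
most `p²` shifts. -/
lemma conflict_card_lt (F : Fin p → Fin m) (i : Fin m) :
    (Finset.univ.filter fun i' : Fin m =>
      ¬ Disjoint (Finset.univ.image fun j => i + F j)
        (Finset.univ.image fun j => i' + F j)).card < p ^ 2 + 1 := by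
  have hsub : (Finset.univ.filter fun i' : Fin m =>
      ¬ Disjoint (Finset.univ.image fun j => i + F j)
        (Finset.univ.image fun j => i' + F j)) ⊆
      (Finset.univ : Finset (Fin p × Fin p)).image fun q => i + F q.1 - F q.2 := by
    intro i' hi'
    simp only [Finset.mem_filter, Finset.mem_univ, true_and, Finset.not_disjoint_iff,
      Finset.mem_image] at hi'
    obtain ⟨x, ⟨j, rfl⟩, j', hj'⟩ := hi'
    simp only [Finset.mem_image, Finset.mem_univ, true_and, Prod.exists]
    exact ⟨j, j', by rw [← hj']; abel⟩
  have h1 := Finset.card_le_card hsub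
  have h2 := Finset.card_image_le (s := (Finset.univ : Finset (Fin p × Fin p)))
    (f := fun q => i + F q.1 - F q.2)
  simp only [Finset.card_univ, Fintype.card_prod, Fintype.card_fin] at h2
  rw [sq]
  omega

lemma measureReal_sum_prod_trunc_ge_le (θ : unitInterval) {L : ℝ} (hL : 0 ≤ L) {e : Fin n → Fin m}
    (he : Function.Injective e) (f : Fin p → Fin n) {l t : ℝ} (hl : 0 ≤ l)
    (hlL : 2 * l * L ^ p ≤ 1) :
    (bernoulliGaussianVec m θ).real
        {x | t ≤ |∑ i, (∏ j, trunc L (x (i + e (f j))) - truncMoment θ L f)|} ≤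
      2 * Real.exp (-(l * t / ((p ^ 2 + 1 : ℕ) : ℝ)) +
        l ^ 2 * (momentBound p ^ p * (θ : ℝ) ^ (Finset.univ.image f).card) * m) := by
  have hM := one_le_momentBound p
  have := measureReal_abs_sum_sub_ge_le (μ := fun _ : Fin m => bernoulliGaussian θ)
    (Z := fun (i : Fin m) x => ∏ j, trunc L (x (i + e (f j))))
    (fun i => by fun_prop) (S := fun i => Finset.univ.image fun j => i + e (f j))
    (fun i x y hxy => Finset.prod_congr rfl fun j _ => by
      rw [hxy (i + e (f j)) (by simp)])
    (Nat.succ_pos (p ^ 2)) (conflict_card_lt fun j => e (f j)) (t := t) hl hlL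
    (fun i x => abs_prod_trunc_le hL (fun j => i + e (f j)) x)
    (fun i => integral_prod_trunc θ L (shift_injective he i) f)
    (fun i => integral_prod_trunc_sq_le θ hL (shift_injective he i) f)
    (mul_nonneg (by positivity) (pow_nonneg θ.2.1 _))
  simpa [bernoulliGaussianVec] using this

/-- Constant for the concentration of the empirical mixed moments of degree `p`. -/
noncomputable def concConst (p : ℕ) : ℝ :=
  p.factorial * (400 * ((p ^ 2 + 1 : ℕ) : ℝ) ^ 2 * (momentBound p ^ p + 2))

/-- The worst case is a tuple of distinct indices; there the powers of `θ` cancel and the bound is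
free of `θ`. -/
lemma tolerance_lower {θ : unitInterval} {h : ℕ} (hn : 1 ≤ n * (θ : ℝ)) {τ : ℝ} (hτ : 0 ≤ τ)
    (f : Fin (2 * h) → Fin n) : τ / ((2 * h).factorial * (n : ℝ) ^ h) ≤ tolerance θ τ f := by
  have hθ : 0 < (θ : ℝ) := by
    rcases θ.2.1.eq_or_lt with h0 | h0
    · rw [← h0] at hn; norm_num at hn
    · exact h0
  have hn0 : 0 < (n : ℝ) := by
    rcases (Nat.cast_nonneg n : (0 : ℝ) ≤ n).eq_or_lt with h0 | h0
    · rw [← h0] at hn; norm_num at hn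
    · exact h0
  have hf : (1 : ℝ) ≤ (2 * h).factorial := by exact_mod_cast Nat.succ_le_of_lt (Nat.factorial_pos _)
  have hs : (Finset.univ.image f).card ≤ 2 * h := by
    simpa using Finset.card_image_le (s := (Finset.univ : Finset (Fin (2 * h)))) (f := f)
  rw [tolerance, div_eq_mul_inv]
  refine mul_le_mul_of_nonneg_left (Real.le_sqrt_of_sq_le ?_) hτ
  have h1 : (θ : ℝ) ^ (2 * h) ≤ (θ : ℝ) ^ (Finset.univ.image f).card :=
    pow_le_pow_of_le_one hθ.le θ.2.2 hs
  rw [le_div_iff₀ (by positivity), mul_pow, inv_pow]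
  refine le_trans ?_ h1
  rw [mul_pow, ← pow_mul (n : ℝ) h 2, mul_comm h 2]
  have h2 : (((2 * h).factorial : ℝ) ^ 2 * (n : ℝ) ^ (2 * h))⁻¹ *
      ((2 * h).factorial * ((n : ℝ) ^ (2 * h) * (θ : ℝ) ^ (2 * h))) =
      ((2 * h).factorial : ℝ)⁻¹ * (θ : ℝ) ^ (2 * h) := by
    field_simp
  rw [h2]
  exact mul_le_of_le_one_left (by positivity) (inv_le_one_of_one_le₀ hf)

lemma measureReal_exists_sum_ge_le {θ : unitInterval} {h : ℕ} {L τ ℓ : ℝ} (hL : 1 ≤ L)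
    (hτ : 0 < τ) (hℓ : 1 / 2 ≤ ℓ) {e : Fin n → Fin m} (he : Function.Injective e)
    (hn : 1 ≤ n * (θ : ℝ)) (h1 : concConst (2 * h) * ℓ * (n * θ) ^ (2 * h) ≤ m * τ ^ 2)
    (h2 : concConst (2 * h) * ℓ * L ^ (2 * h) * n ^ h ≤ m * τ) :
    (bernoulliGaussianVec m θ).real {x | ∃ f : Fin (2 * h) → Fin n, m * tolerance θ τ f / 2 ≤
        |∑ i, (∏ j, trunc L (x (i + e (f j))) - truncMoment θ L f)|} ≤
      n ^ (2 * h) * (2 * Real.exp (-(24 * ℓ))) := by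
  have hset : {x : Fin m → ℝ | ∃ f : Fin (2 * h) → Fin n, m * tolerance θ τ f / 2 ≤
        |∑ i, (∏ j, trunc L (x (i + e (f j))) - truncMoment θ L f)|} =
      ⋃ f ∈ (Finset.univ : Finset (Fin (2 * h) → Fin n)), {x : Fin m → ℝ | m * tolerance θ τ f / 2 ≤
        |∑ i, (∏ j, trunc L (x (i + e (f j))) - truncMoment θ L f)|} := by ext; simp
  rw [hset]
  refine (measureReal_biUnion_finset_le _ _).trans ?_
  have hone : ∀ f : Fin (2 * h) → Fin n,
      (bernoulliGaussianVec m θ).real {x | m * tolerance θ τ f / 2 ≤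
        |∑ i, (∏ j, trunc L (x (i + e (f j))) - truncMoment θ L f)|} ≤
        2 * Real.exp (-(24 * ℓ)) := by
    intro f
    have hθ : 0 < (θ : ℝ) := by
      rcases θ.2.1.eq_or_lt with h0 | h0
      · rw [← h0] at hn; norm_num at hn
      · exact h0
    have hn0 : 0 < (n : ℝ) := by
      rcases (Nat.cast_nonneg n : (0 : ℝ) ≤ n).eq_or_lt with h0 | h0
      · rw [← h0] at hn; norm_num at hn
      · exact h0
    have hm0 : (0 : ℝ) < m := by exact_mod_cast Nat.pos_of_neZero m
    have hM := one_le_momentBound (2 * h)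
    have htl := tolerance_lower hn hτ.le f
    have hpos : 0 < tolerance θ τ f := lt_of_lt_of_le (by positivity) htl
    have htsq : tolerance θ τ f ^ 2 = τ ^ 2 * ((θ : ℝ) ^ (Finset.univ.image f).card /
        ((2 * h).factorial * (n * θ) ^ (2 * h))) := by
      rw [tolerance, mul_pow, Real.sq_sqrt (by positivity)]
    set W := momentBound (2 * h) ^ (2 * h) with hW
    have hW1 : 1 ≤ W := one_le_pow₀ hM
    set N : ℝ := (((2 * h) ^ 2 + 1 : ℕ) : ℝ) with hN
    have hN1 : 1 ≤ N := by rw [hN]; exact_mod_cast Nat.le_add_left 1 _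
    set S := (θ : ℝ) ^ (Finset.univ.image f).card with hS
    have hS0 : 0 < S := by positivity
    set a := m * tolerance θ τ f / 2 with ha
    have ha0 : 0 < a := by positivity
    set F : ℝ := ((2 * h).factorial : ℝ) with hF
    have hF0 : 0 < F := by rw [hF]; exact_mod_cast Nat.factorial_pos _
    have hC : concConst (2 * h) = F * (400 * N ^ 2 * (W + 2)) := rfl
    have hℓ0 : 0 < ℓ := by linarith
    have hb1 : 100 * N ^ 2 * (W + 2) * ℓ * S * m ≤ a ^ 2 := by
      have e1 : a ^ 2 = m * (m * τ ^ 2) * (S / (F * (n * θ) ^ (2 * h))) / 4 := by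
        rw [ha, div_pow, mul_pow, htsq]; ring
      have e2 : 100 * N ^ 2 * (W + 2) * ℓ * S * m =
          m * (concConst (2 * h) * ℓ * (n * θ) ^ (2 * h)) * (S / (F * (n * θ) ^ (2 * h))) / 4 := by
        rw [hC]; field_simp
        norm_num
      rw [e1, e2]
      gcongr
    have hb2 : 200 * N ^ 2 * (W + 2) * ℓ * L ^ (2 * h) ≤ a := by
      have e2 : 200 * N ^ 2 * (W + 2) * ℓ * L ^ (2 * h) =
          concConst (2 * h) * ℓ * L ^ (2 * h) * n ^ h / (F * n ^ h) / 2 := by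
        rw [hC]; field_simp
        norm_num
      calc _ = _ := e2
        _ ≤ m * τ / (F * n ^ h) / 2 := by gcongr
        _ = m * (τ / (F * n ^ h)) / 2 := by ring
        _ ≤ a := by rw [ha]; gcongr
    -- Bernstein's parameter is `48 N ℓ / a`: the linear term of the exponent is `-48 ℓ`, `hb1`
    -- keeps the quadratic term below `24 ℓ`, and `hb2` provides the constraint against the sup
    -- bound `L ^ (2 * h)`.
    have hl0 : 0 ≤ 48 * N * ℓ / a := by positivity
    refine (measureReal_sum_prod_trunc_ge_le θ (by linarith) he f hl0 ?_).trans ?_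
    · have : 2 * (48 * N * ℓ / a) * L ^ (2 * h) = 96 * N * ℓ * L ^ (2 * h) / a := by ring
      rw [this, div_le_one ha0]
      refine le_trans ?_ hb2
      have : 96 * N ≤ 200 * N ^ 2 * (W + 2) := by nlinarith
      gcongr
    · refine mul_le_mul_of_nonneg_left (Real.exp_le_exp.2 ?_) (by norm_num)
      have e1 : 48 * N * ℓ / a * a / N = 48 * ℓ := by field_simp
      have e2 : (48 * N * ℓ / a) ^ 2 * (W * S) * m ≤ 24 * ℓ := by
        rw [div_pow, div_mul_eq_mul_div, div_mul_eq_mul_div, div_le_iff₀ (by positivity)]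
        have : (48 * N * ℓ) ^ 2 * (W * S) * m = 24 * ℓ * (96 * N ^ 2 * W * ℓ * S * m) := by ring
        rw [this]
        refine mul_le_mul_of_nonneg_left (le_trans ?_ hb1) (by positivity)
        have : 96 * N ^ 2 * W ≤ 100 * N ^ 2 * (W + 2) := by nlinarith [sq_nonneg N]
        gcongr
      rw [e1]
      linarith
  calc _ ≤ ∑ _f : Fin (2 * h) → Fin n, 2 * Real.exp (-(24 * ℓ)) :=
        Finset.sum_le_sum fun f _ => hone f
    _ = _ := by simp

/-- The empirical mixed moments of the windows of `x` with offsets `e`. -/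
noncomputable def empMoment (e : Fin n → Fin m) (x : Fin m → ℝ) (f : Fin p → Fin n) : ℝ :=
  (m : ℝ)⁻¹ * ∑ i, ∏ j, x (i + e (f j))

/-- Half of each tolerance pays for the fluctuation of the truncated moment, the other half for the
truncation bias. -/
lemma sum_empMoment_sub_mixedMoment_sq_le {θ : unitInterval} {h : ℕ} {L τ ℓ : ℝ} (hL : 1 ≤ L)
    (hLm : L ^ 2 = 12 * Real.log m)
    (hτ : 0 < τ) (hℓ : 1 / 2 ≤ ℓ) {e : Fin n → Fin m} (he : Function.Injective e)
    (hn : 1 ≤ n * (θ : ℝ))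
    (h2 : concConst (2 * h) * ℓ * L ^ (2 * h) * n ^ h ≤ m * τ) {x : Fin m → ℝ}
    (hx : ∀ i, |x i| ≤ L)
    (hxf : ∀ f : Fin (2 * h) → Fin n,
      |∑ i, (∏ j, trunc L (x (i + e (f j))) - truncMoment θ L f)| < m * tolerance θ τ f / 2) :
    ∑ f : Fin (2 * h) → Fin n, (empMoment e x f - mixedMoment θ f) ^ 2 ≤ τ ^ 2 := by
  refine le_trans (Finset.sum_le_sum fun f _ => ?_) (sum_tolerance_sq_le (p := 2 * h) hn τ)
  have hm1 : (1 : ℝ) ≤ m := by exact_mod_cast Nat.pos_of_neZero m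
  have hm0 : (0 : ℝ) < m := by linarith
  have hn0 : 0 < (n : ℝ) := by
    rcases (Nat.cast_nonneg n : (0 : ℝ) ≤ n).eq_or_lt with h0 | h0
    · rw [← h0] at hn; norm_num at hn
    · exact h0
  have hM := one_le_momentBound (2 * h)
  -- Here `M = m`. As `L² = 12 log m`, the tail factor is `m⁻⁶`, so the bias is of order `1/m`.
  have hbias := abs_truncMoment_sub_mixedMoment_le θ (by linarith : 0 ≤ L) he f hm0
  have hexp : Real.exp (-(L ^ 2 / 2)) = ((m : ℝ) ^ 6)⁻¹ := by
    rw [hLm, show -(12 * Real.log m / 2) = -(Real.log ((m : ℝ) ^ 6)) by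
      rw [Real.log_pow]; push_cast; ring, Real.exp_neg, Real.exp_log (by positivity)]
  have hbias2 : |truncMoment θ L f - mixedMoment θ f| ≤
      (momentBound (2 * h) ^ (2 * h) + 2) / m := by
    refine hbias.trans ?_
    rw [hexp, add_div]
    refine add_le_add_right ?_ _
    have : (m : ℝ) * (m * (2 * ((m : ℝ) ^ 6)⁻¹)) = 2 / m * ((m : ℝ) ^ 3)⁻¹ := by field_simp
    rw [this]
    exact mul_le_of_le_one_right (by positivity) (inv_le_one_of_one_le₀ (one_le_pow₀ hm1))
  have htl := tolerance_lower hn hτ.le f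
  have hbias3 : (momentBound (2 * h) ^ (2 * h) + 2) / m ≤ tolerance θ τ f / 2 := by
    set W := momentBound (2 * h) ^ (2 * h) with hW
    have hW1 : 1 ≤ W := one_le_pow₀ hM
    set N : ℝ := (((2 * h) ^ 2 + 1 : ℕ) : ℝ) with hN
    have hN1 : 1 ≤ N := by rw [hN]; exact_mod_cast Nat.le_add_left 1 _
    set F : ℝ := ((2 * h).factorial : ℝ) with hF
    have hF0 : 0 < F := by rw [hF]; exact_mod_cast Nat.factorial_pos _
    have hC : concConst (2 * h) = F * (400 * N ^ 2 * (W + 2)) := rfl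
    rw [div_le_iff₀ hm0]
    calc W + 2 ≤ 200 * N ^ 2 * (W + 2) * ℓ * L ^ (2 * h) := by
          have a1 : 1 ≤ L ^ (2 * h) := one_le_pow₀ hL
          have a2 : 1 ≤ N ^ 2 := one_le_pow₀ hN1
          have a3 : 1 ≤ 200 * N ^ 2 * ℓ := by nlinarith
          have a4 : 1 ≤ 200 * N ^ 2 * ℓ * L ^ (2 * h) := by nlinarith
          nlinarith
      _ = concConst (2 * h) * ℓ * L ^ (2 * h) * n ^ h / (F * n ^ h) / 2 := by
          rw [hC]; field_simp
          norm_num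
      _ ≤ m * τ / (F * n ^ h) / 2 := by gcongr
      _ = τ / (F * n ^ h) / 2 * m := by ring
      _ ≤ _ := by gcongr
  have hpos : 0 < tolerance θ τ f := lt_of_lt_of_le (by positivity) htl
  have hemp : empMoment e x f - truncMoment θ L f =
      (m : ℝ)⁻¹ * ∑ i, (∏ j, trunc L (x (i + e (f j))) - truncMoment θ L f) := by
    have : ∀ i, ∏ j, trunc L (x (i + e (f j))) = ∏ j, x (i + e (f j)) :=
      fun i => Finset.prod_congr rfl fun j _ => trunc_of_le (hx _)
    simp_rw [this]
    rw [Finset.sum_sub_distrib, mul_sub, empMoment]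
    simp [hm0.ne']
  have hdev : |empMoment e x f - truncMoment θ L f| ≤ tolerance θ τ f / 2 := by
    rw [hemp, abs_mul, abs_of_pos (by positivity), inv_mul_le_iff₀ hm0]
    linarith [hxf f]
  refine sq_le_sq' ?_ ?_ <;>
  · have := abs_le.1 hdev
    have := abs_le.1 (hbias2.trans hbias3)
    linarith

/-- Constant in the sample size that makes the empirical moments concentrate. -/
noncomputable def sampleConst : ℝ := 10 ^ 11 * (concConst 2 + concConst 4 + 1) ^ 2

lemma concConst_nonneg (p : ℕ) : 0 ≤ concConst p := by
  have := one_le_momentBound p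
  unfold concConst; positivity

lemma one_le_sampleConst : 10 ^ 11 ≤ sampleConst := by
  have h2 := concConst_nonneg 2
  have h4 := concConst_nonneg 4
  have : (1 : ℝ) ≤ (concConst 2 + concConst 4 + 1) ^ 2 := one_le_pow₀ (by linarith)
  unfold sampleConst; linarith

lemma half_le_log {k : ℕ} (hk : 2 ≤ k) : 1 / 2 ≤ Real.log k := by
  have h1 : Real.log 2 ≤ Real.log k := Real.log_le_log (by norm_num) (by exact_mod_cast hk)
  linarith [Real.log_two_gt_d9]

/-- From `log x ≤ 10 x^(1/10)`. -/
lemma log_pow_five_le {x : ℝ} (hx : 1 ≤ x) : Real.log x ^ 5 ≤ 10 ^ 5 * √x := by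
  have h := Real.log_le_rpow_div (by linarith : 0 ≤ x) (by norm_num : (0 : ℝ) < 1 / 10)
  have h0 := Real.log_nonneg hx
  calc Real.log x ^ 5 ≤ (x ^ (1 / 10 : ℝ) / (1 / 10)) ^ 5 := pow_le_pow_left₀ h0 h 5
    _ = 10 ^ 5 * (x ^ (1 / 10 : ℝ)) ^ 5 := by ring
    _ = 10 ^ 5 * √x := by
      rw [← Real.rpow_natCast (x ^ (1 / 10 : ℝ)), ← Real.rpow_mul (by linarith),
        Real.sqrt_eq_rpow]
      norm_num

/-- The truncation level brings in powers of `log m`, while the hypothesis only has `log k`. After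
squaring, `log k · log⁴ m ≤ log⁵ m ≤ 10⁵ √m` and `k² ≤ √m` absorb them into one factor `m`. The
constant `576 = 144 · 4` comes from `L⁴ = 144 log² m` and `(2k)² = 4k²`. -/
lemma sample_size_bounds {k m : ℕ} (hk : 2 ≤ k) {E : ℝ} (hE : 0 < E) (hE1 : E ≤ 1)
    (hm : sampleConst * k ^ 4 * Real.log k ≤ m * E ^ 2) :
    (k : ℝ) ^ 4 ≤ m ∧
    576 * (concConst 2 + concConst 4 + 1) * Real.log k * Real.log m ^ 2 * k ^ 3 ≤ m * E := by
  have hS := one_le_sampleConst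
  have hℓ := half_le_log hk
  have hk2 : (2 : ℝ) ≤ k := by exact_mod_cast hk
  have hk4 : (0 : ℝ) < (k : ℝ) ^ 4 := by positivity
  have hmE : (m : ℝ) * E ^ 2 ≤ m := mul_le_of_le_one_right (Nat.cast_nonneg m)
    (pow_le_one₀ hE.le hE1)
  have hSl : 1 ≤ sampleConst * Real.log k := by nlinarith
  have hm4 : (k : ℝ) ^ 4 ≤ m := by
    refine le_trans ?_ (hm.trans hmE)
    nlinarith
  refine ⟨hm4, ?_⟩
  have hkm : (k : ℝ) ≤ m := le_trans (by
    calc (k : ℝ) = k ^ 1 := (pow_one _).symm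
      _ ≤ k ^ 4 := pow_le_pow_right₀ (by linarith) (by norm_num)) hm4
  have hm1 : (1 : ℝ) ≤ m := by linarith
  have hlog : Real.log k ≤ Real.log m := Real.log_le_log (by linarith) hkm
  have hlm : 0 ≤ Real.log m := Real.log_nonneg hm1
  have hsq : (k : ℝ) ^ 2 ≤ √m := Real.le_sqrt_of_sq_le (by rw [← pow_mul]; exact hm4)
  have h5 := log_pow_five_le hm1
  set c := concConst 2 + concConst 4 + 1 with hc
  have hc1 : 1 ≤ c := by
    have h2 := concConst_nonneg 2
    have h4 := concConst_nonneg 4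
    linarith
  have hSc : sampleConst = 10 ^ 11 * c ^ 2 := rfl
  refine le_of_sq_le_sq ?_ (by positivity)
  calc (576 * c * Real.log k * Real.log m ^ 2 * k ^ 3) ^ 2
      = 331776 * c ^ 2 * (Real.log k * Real.log m ^ 4) * k ^ 2 * (k ^ 4 * Real.log k) := by ring
    _ ≤ 331776 * c ^ 2 * (Real.log m * Real.log m ^ 4) * √m * (k ^ 4 * Real.log k) := by
        gcongr
    _ = 331776 * c ^ 2 * (Real.log m ^ 5) * √m * (k ^ 4 * Real.log k) := by ring
    _ ≤ 331776 * c ^ 2 * (10 ^ 5 * √m) * √m * (k ^ 4 * Real.log k) := by gcongr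
    _ = 331776 * c ^ 2 * 10 ^ 5 * (√m * √m) * (k ^ 4 * Real.log k) := by ring
    _ = 331776 * 10 ^ 5 * c ^ 2 * m * (k ^ 4 * Real.log k) := by
        rw [Real.mul_self_sqrt (by linarith)]; ring
    _ ≤ 10 ^ 11 * c ^ 2 * m * (k ^ 4 * Real.log k) := by gcongr; norm_num
    _ = m * (sampleConst * k ^ 4 * Real.log k) := by rw [hSc]; ring
    _ ≤ m * (m * E ^ 2) := by gcongr
    _ = (m * E) ^ 2 := by ring

/-- With high probability, the empirical second and fourth mixed moments are close to the exact
ones, simultaneously in the Frobenius norm. -/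
theorem exists_good_set {k m n : ℕ} [NeZero m] (hk : 2 ≤ k) (hn : n = 2 * k - 1) {θ : unitInterval}
    (hθ : 1 / (k : ℝ) ≤ θ) {e : Fin n → Fin m} (he : Function.Injective e)
    {E : ℝ} (hE : 0 < E) (hE1 : E ≤ 1)
    (hm : sampleConst * k ^ 4 * Real.log k ≤ m * E ^ 2) :
    ∃ G : Set (Fin m → ℝ), MeasurableSet G ∧
      1 - (48 / (k : ℝ) ^ 7 + 48 / (m : ℝ) ^ 5) ≤ (bernoulliGaussianVec m θ).real G ∧
      ∀ x ∈ G,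
        ∑ f : Fin 2 → Fin n, (empMoment e x f - mixedMoment θ f) ^ 2 ≤ (θ * E) ^ 2 ∧
        ∑ f : Fin 4 → Fin n, (empMoment e x f - mixedMoment θ f) ^ 2 ≤
          (θ * E) ^ 2 := by
  have hS0 : 0 ≤ sampleConst := by linarith [one_le_sampleConst]
  obtain ⟨hm4, hbig⟩ := sample_size_bounds hk hE hE1 hm
  have hℓ := half_le_log hk
  have hk2 : (2 : ℝ) ≤ k := by exact_mod_cast hk
  have hθ0 : 0 < (θ : ℝ) := lt_of_lt_of_le (by positivity) hθ
  have hθ1 := θ.2.2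
  have hkθ : 1 ≤ k * (θ : ℝ) := by rwa [div_le_iff₀' (by linarith)] at hθ
  have hnk : (k : ℝ) ≤ n := by exact_mod_cast (by omega : k ≤ n)
  have hn2k : (n : ℝ) ≤ 2 * k := by exact_mod_cast (by omega : n ≤ 2 * k)
  have hnθ : 1 ≤ n * (θ : ℝ) := hkθ.trans (by gcongr)
  have hm2 : 2 ≤ m := by
    have : (2 : ℝ) ≤ m := le_trans (by nlinarith [pow_le_pow_left₀ (by norm_num) hk2 4]) hm4
    exact_mod_cast this
  have hlm := half_le_log hm2
  set L := √(12 * Real.log m) with hLdef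
  have hL2 : L ^ 2 = 12 * Real.log m := Real.sq_sqrt (by linarith)
  have hL1 : 1 ≤ L := Real.le_sqrt_of_sq_le (by linarith)
  set c := concConst 2 + concConst 4 + 1 with hc
  have hc2 := concConst_nonneg 2
  have hc4 := concConst_nonneg 4
  have hτ : 0 < (θ : ℝ) * E := by positivity
  have hSc : sampleConst = 10 ^ 11 * c ^ 2 := rfl
  have hccS : c ≤ sampleConst / 16 := by rw [hSc]; nlinarith
  -- Degrees `2` and `4` are handled together through the cruder bounds `n^(2h) ≤ 16 k⁴` and `θ^(2h)
  -- ≤ θ²`; the second inequality uses `1/k ≤ θ`.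
  have hA : ∀ h : ℕ, (h = 1 ∨ h = 2) →
      concConst (2 * h) * Real.log k * (n * θ) ^ (2 * h) ≤ m * (θ * E) ^ 2 ∧
      concConst (2 * h) * Real.log k * L ^ (2 * h) * n ^ h ≤ m * (θ * E) := by
    intro h hh
    have hch : concConst (2 * h) ≤ c := by
      rcases hh with rfl | rfl <;> norm_num <;> linarith
    have hch0 := concConst_nonneg (2 * h)
    have hh2 : h ≤ 2 := by omega
    have hh1 : 1 ≤ h := by omega
    constructor
    · calc concConst (2 * h) * Real.log k * (n * θ) ^ (2 * h)
          ≤ (sampleConst / 16) * Real.log k * (16 * k ^ 4 * θ ^ 2) := by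
            have h1 : ((n : ℝ) * θ) ^ (2 * h) ≤ 16 * k ^ 4 * θ ^ 2 := by
              rw [mul_pow]
              have : (n : ℝ) ^ (2 * h) ≤ 16 * k ^ 4 := by
                calc (n : ℝ) ^ (2 * h) ≤ n ^ 4 := pow_le_pow_right₀ (by linarith) (by omega)
                  _ ≤ (2 * k) ^ 4 := by gcongr
                  _ = _ := by ring
              have h2 : (θ : ℝ) ^ (2 * h) ≤ θ ^ 2 := pow_le_pow_of_le_one hθ0.le hθ1 (by omega)
              gcongr
            have := hch.trans hccS
            gcongr
        _ = θ ^ 2 * (sampleConst * k ^ 4 * Real.log k) := by ring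
        _ ≤ θ ^ 2 * (m * E ^ 2) := by gcongr
        _ = _ := by ring
    · calc concConst (2 * h) * Real.log k * L ^ (2 * h) * n ^ h
          ≤ c * Real.log k * L ^ 4 * (2 * k) ^ 2 := by
            have h1 : L ^ (2 * h) ≤ L ^ 4 := pow_le_pow_right₀ hL1 (by omega)
            have h2 : (n : ℝ) ^ h ≤ (2 * k) ^ 2 :=
              (pow_le_pow_right₀ (by linarith) hh2).trans (by gcongr)
            gcongr
        _ = 576 * c * Real.log k * Real.log m ^ 2 * k ^ 3 * (1 / k) := by
            rw [show L ^ 4 = (L ^ 2) ^ 2 by ring, hL2]; field_simp; ring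
        _ ≤ m * E * θ := by gcongr
        _ = _ := by ring
  let B : ℕ → Set (Fin m → ℝ) := fun h => {x | ∃ f : Fin (2 * h) → Fin n,
    m * tolerance θ (θ * E) f / 2 ≤
      |∑ i, (∏ j, trunc L (x (i + e (f j))) - truncMoment θ L f)|}
  let T : Set (Fin m → ℝ) := {x | ∃ i, L < |x i|}
  have hBm : ∀ h, MeasurableSet (B h) := fun h => by
    have : B h = ⋃ f : Fin (2 * h) → Fin n, {x | m * tolerance θ (θ * E) f / 2 ≤
      |∑ i, (∏ j, trunc L (x (i + e (f j))) - truncMoment θ L f)|} := by ext; simp [B]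
    rw [this]
    exact MeasurableSet.iUnion fun f => measurableSet_le measurable_const (by fun_prop)
  have hTm : MeasurableSet T := by
    have : T = ⋃ i, {x | L < |x i|} := by ext; simp [T]
    rw [this]
    exact MeasurableSet.iUnion fun i => measurableSet_lt measurable_const (by fun_prop)
  -- `T` costs at most `48/m⁵`. Each `B h` costs at most `24/k⁷`: a union over at most `16 k⁴`
  -- tuples of events of probability at most `2 k⁻²⁴`.
  refine ⟨(T ∪ (B 1 ∪ B 2))ᶜ, (hTm.union ((hBm 1).union (hBm 2))).compl, ?_, ?_⟩
  · rw [measureReal_compl (hTm.union ((hBm 1).union (hBm 2)))]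
    have hT := bernoulliGaussianVec_tail m θ (zero_le_one.trans hL1)
    have hB : ∀ h, (h = 1 ∨ h = 2) → (bernoulliGaussianVec m θ).real (B h) ≤
        n ^ (2 * h) * (2 * Real.exp (-(24 * Real.log k))) := fun h hh =>
      measureReal_exists_sum_ge_le hL1 hτ hℓ he hnθ (hA h hh).1 (hA h hh).2
    have hU : (bernoulliGaussianVec m θ).real (T ∪ (B 1 ∪ B 2)) ≤
        (bernoulliGaussianVec m θ).real T + ((bernoulliGaussianVec m θ).real (B 1) +
          (bernoulliGaussianVec m θ).real (B 2)) :=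
      (measureReal_union_le _ _).trans (add_le_add_right (measureReal_union_le _ _) _)
    have hm0 : (0 : ℝ) < m := by linarith [show (2 : ℝ) ≤ m by exact_mod_cast hm2]
    have e1 : Real.exp (-(L ^ 2 / 2)) = ((m : ℝ) ^ 6)⁻¹ := by
      rw [hL2, show -(12 * Real.log m / 2) = -(Real.log ((m : ℝ) ^ 6)) by
        rw [Real.log_pow]; push_cast; ring, Real.exp_neg, Real.exp_log (by positivity)]
    have e2 : Real.exp (-(24 * Real.log k)) = ((k : ℝ) ^ 24)⁻¹ := by
      rw [show -(24 * Real.log k) = -(Real.log ((k : ℝ) ^ 24)) by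
        rw [Real.log_pow]; push_cast; ring, Real.exp_neg, Real.exp_log (by positivity)]
    have hT' : (bernoulliGaussianVec m θ).real T ≤ 48 / (m : ℝ) ^ 5 := by
      refine hT.trans ?_
      rw [e1, show (m : ℝ) * (2 * ((m : ℝ) ^ 6)⁻¹) = 2 / (m : ℝ) ^ 5 by field_simp]
      gcongr; norm_num
    have hBB : ∀ h, (h = 1 ∨ h = 2) → (bernoulliGaussianVec m θ).real (B h) ≤
        24 / (k : ℝ) ^ 7 := by
      intro h hh
      refine (hB h hh).trans ?_
      rw [e2]
      have h1 : (n : ℝ) ^ (2 * h) ≤ 16 * k ^ 4 := by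
        calc (n : ℝ) ^ (2 * h) ≤ n ^ 4 := pow_le_pow_right₀ (by linarith) (by omega)
          _ ≤ (2 * k) ^ 4 := by gcongr
          _ = _ := by ring
      have h2 : (2 : ℝ) ^ 13 ≤ (k : ℝ) ^ 13 := by gcongr
      calc (n : ℝ) ^ (2 * h) * (2 * ((k : ℝ) ^ 24)⁻¹)
          ≤ 16 * k ^ 4 * (2 * ((k : ℝ) ^ 24)⁻¹) := by gcongr
        _ = 32 / (k : ℝ) ^ 13 / (k : ℝ) ^ 7 := by field_simp; norm_num
        _ ≤ 24 / (k : ℝ) ^ 7 := by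
          gcongr
          rw [div_le_iff₀ (by positivity)]
          linarith
    have h1 := hBB 1 (Or.inl rfl)
    have h2 := hBB 2 (Or.inr rfl)
    have e3 : 48 / (k : ℝ) ^ 7 = 24 / (k : ℝ) ^ 7 + 24 / (k : ℝ) ^ 7 := by ring
    rw [probReal_univ]
    linarith
  · intro x hx
    simp only [Set.mem_compl_iff, Set.mem_union, not_or] at hx
    obtain ⟨hxT, hx1, hx2⟩ := hx
    have hxL : ∀ i, |x i| ≤ L := fun i => by
      by_contra h; exact hxT ⟨i, not_le.1 h⟩
    exact ⟨sum_empMoment_sub_mixedMoment_sq_le (h := 1) hL1 hL2 hτ hℓ he hnθ (hA 1 (Or.inl rfl)).2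
        hxL fun f => by by_contra h; exact hx1 ⟨f, not_lt.1 h⟩,
      sum_empMoment_sub_mixedMoment_sq_le (h := 2) hL1 hL2 hτ hℓ he hnθ (hA 2 (Or.inr rfl)).2
        hxL fun f => by by_contra h; exact hx2 ⟨f, not_lt.1 h⟩⟩

end Concentration


/-! ### The convolution matrix and the factorisation of the observation -/

section ConvMatrix

variable {k : ℕ}

lemma convMatrix_apply_shift (a : EuclideanSpace ℝ (Fin k)) (r s : Fin k) :
    convMatrix a r ⟨r + (k - 1) - s, by omega⟩ = a s := by
  have h1 : (r : ℕ) + (k - 1) - s ≤ r + (k - 1) := by omega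
  have h2 : (r : ℕ) + (k - 1) - (r + (k - 1) - s) = s := by omega
  simp [convMatrix, h2]

lemma sum_convMatrix_mul (a : EuclideanSpace ℝ (Fin k)) (r : Fin k) (g : Fin (2 * k - 1) → ℝ) :
    ∑ c, convMatrix a r c * g c = ∑ s : Fin k, a s * g ⟨r + (k - 1) - s, by omega⟩ := by
  symm
  refine Finset.sum_of_injOn (fun s : Fin k => (⟨r + (k - 1) - s, by omega⟩ : Fin (2 * k - 1)))
    ?_ (by simp) ?_ ?_
  · intro s _ t _ h
    simp only [Fin.mk.injEq] at h
    ext; omega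
  · intro c _ hc
    rw [convMatrix, Matrix.of_apply, dif_neg, zero_mul]
    rintro ⟨h1, h2⟩
    refine hc ⟨⟨r + (k - 1) - c, h2⟩, by simp, ?_⟩
    ext; simp only; omega
  · intro s _
    rw [convMatrix_apply_shift]

lemma dotProduct_convMatrix_row (a : EuclideanSpace ℝ (Fin k)) (r : Fin k) :
    convMatrix a r ⬝ᵥ convMatrix a r = ‖a‖ ^ 2 := by
  rw [dotProduct, sum_convMatrix_mul, EuclideanSpace.norm_sq_eq]
  refine Finset.sum_congr rfl fun s _ => ?_
  rw [convMatrix_apply_shift, Real.norm_eq_abs, sq_abs, sq]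

/-- An extreme coefficient cannot cancel: with `s` the last index in the support of `a` and `r` the
first in that of `v`, the entry at `r + (k - 1) - s` is the single product `a s * v r`. -/
lemma convMatrix_transpose_mulVec_ne_zero {a : EuclideanSpace ℝ (Fin k)} (ha : a ≠ 0)
    {v : Fin k → ℝ} (hv : v ≠ 0) : (convMatrix a)ᵀ *ᵥ v ≠ 0 := by
  have ha' : (Finset.univ.filter fun s => a s ≠ 0).Nonempty := by
    by_contra h
    refine ha (PiLp.ext fun s => ?_)
    by_contra hs
    exact h ⟨s, by simpa using hs⟩
  have hv' : (Finset.univ.filter fun r => v r ≠ 0).Nonempty := by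
    by_contra h
    refine hv (funext fun s => ?_)
    by_contra hs
    exact h ⟨s, by simpa using hs⟩
  set s := Finset.max' _ ha' with hs
  set r := Finset.min' _ hv' with hr
  have has : a s ≠ 0 := (Finset.mem_filter.1 (Finset.max'_mem _ ha')).2
  have hvr : v r ≠ 0 := (Finset.mem_filter.1 (Finset.min'_mem _ hv')).2
  have hs_max : ∀ t, s < t → a t = 0 := fun t ht => by
    by_contra h
    exact absurd (Finset.le_max' _ t (by simpa using h)) (not_le.2 ht)
  have hr_min : ∀ t, t < r → v t = 0 := fun t ht => by
    by_contra h
    exact absurd (Finset.min'_le _ t (by simpa using h)) (not_le.2 ht)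
  intro h0
  have h1 := congrFun h0 ⟨r + (k - 1) - s, by omega⟩
  rw [Matrix.mulVec, dotProduct, Finset.sum_eq_single r] at h1
  · rw [Matrix.transpose_apply, convMatrix_apply_shift] at h1
    exact mul_ne_zero has hvr h1
  · intro t _ htr
    rw [Matrix.transpose_apply]
    rcases lt_or_gt_of_ne htr with h | h
    · rw [hr_min t h, mul_zero]
    · rw [convMatrix, Matrix.of_apply]
      split_ifs with h2
      · rw [hs_max _ _, zero_mul]
        rw [Fin.lt_def] at h ⊢
        simp only
        omega
      · rw [zero_mul]
  · simp

/-- The offsets of the entries of `x` that enter a window of `a ⊛ x`. -/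
def offset (k m : ℕ) [NeZero m] (c : Fin (2 * k - 1)) : Fin m :=
  Fin.ofNat m c - Fin.ofNat m (k - 1)

/-- Ensures that a window does not wrap onto itself, so that its entries are independent. -/
lemma offset_injective {m : ℕ} [NeZero m] (h : 2 * k - 1 ≤ m) :
    Function.Injective (offset k m) := by
  intro c d hcd
  have h1 : Fin.ofNat m c = Fin.ofNat m d := sub_left_injective hcd
  have h2 := congrArg Fin.val h1
  simp only [Fin.val_ofNat] at h2
  rw [Nat.mod_eq_of_lt (by omega), Nat.mod_eq_of_lt (by omega)] at h2
  exact Fin.ext h2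

/-- The matrix whose columns are the windows of `x` of length `2 * k - 1`. -/
def windowMatrix {m : ℕ} [NeZero m] (k : ℕ) (x : Fin m → ℝ) : Matrix (Fin (2 * k - 1)) (Fin m) ℝ :=
  Matrix.of fun c i => x (i + offset k m c)

/-- Column `c = r + (k - 1) - s` of row `r` holds `a s` and meets the entry of `x` at `i + c - (k -
1) = i + r - s`. All indices are modulo `m`, so wrapping is harmless here. -/
lemma obs_eq_mul {m : ℕ} [NeZero m] (a : EuclideanSpace ℝ (Fin k)) (x : Fin m → ℝ) :
    obs a x = convMatrix a * windowMatrix k x := by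
  ext r i
  rw [Matrix.mul_apply, sum_convMatrix_mul]
  simp only [obs, windows, circConv, windowMatrix, Matrix.of_apply, offset]
  refine Finset.sum_congr rfl fun s _ => ?_
  congr 2
  have h : Fin.ofNat m (r + (k - 1) - s) + Fin.ofNat m s =
      Fin.ofNat m r + Fin.ofNat m (k - 1) := by
    ext
    simp only [Fin.val_add, Fin.val_ofNat, Nat.add_mod_mod, Nat.mod_add_mod]
    congr 1; omega
  have h' : Fin.ofNat m (r + (k - 1) - s) =
    Fin.ofNat m r + Fin.ofNat m (k - 1) - Fin.ofNat m s := by rw [← h]; abel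
  rw [h']; abel

end ConvMatrix

/-! ### Extreme singular values of a surjective map -/

section SingularValues

variable {E F : Type*} [NormedAddCommGroup E] [InnerProductSpace ℝ E] [FiniteDimensional ℝ E]
  [NormedAddCommGroup F] [InnerProductSpace ℝ F] [FiniteDimensional ℝ F]

lemma norm_sq_map_eq_sum (T : E →ₗ[ℝ] F) (u : E) :
    ‖T u‖ ^ 2 = ∑ i : Fin (Module.finrank ℝ E), T.singularValues i ^ 2 *
      inner ℝ (T.isSymmetric_adjoint_comp_self.eigenvectorBasis rfl i) u ^ 2 := by
  have hS := T.isSymmetric_adjoint_comp_self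
  set b := T.isSymmetric_adjoint_comp_self.eigenvectorBasis rfl with hb
  have h1 : ‖T u‖ ^ 2 = inner ℝ ((LinearMap.adjoint T ∘ₗ T) u) u := by
    rw [LinearMap.comp_apply, LinearMap.adjoint_inner_left, real_inner_self_eq_norm_sq]
  rw [h1, ← b.sum_inner_mul_inner]
  refine Finset.sum_congr rfl fun i _ => ?_
  rw [hS u (b i), hb, T.isSymmetric_adjoint_comp_self.apply_eigenvectorBasis rfl i, ← hb,
    inner_smul_right, T.sq_singularValues_fin rfl i, real_inner_comm u]
  simp
  ring

lemma norm_map_le_singularValues_zero (T : E →ₗ[ℝ] F) (u : E) :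
    ‖T u‖ ≤ T.singularValues 0 * ‖u‖ := by
  set b := T.isSymmetric_adjoint_comp_self.eigenvectorBasis rfl with hb
  refine le_of_sq_le_sq ?_ (mul_nonneg (T.singularValues_nonneg 0) (norm_nonneg _))
  rw [norm_sq_map_eq_sum, mul_pow, ← b.sum_sq_inner_right u, Finset.mul_sum]
  refine Finset.sum_le_sum fun i _ => mul_le_mul_of_nonneg_right ?_ (sq_nonneg _)
  exact pow_le_pow_left₀ (T.singularValues_nonneg _) (T.singularValues_antitone (Nat.zero_le _)) 2

lemma norm_adjoint_le_singularValues_zero (T : E →ₗ[ℝ] F) (v : F) :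
    ‖LinearMap.adjoint T v‖ ≤ T.singularValues 0 * ‖v‖ := by
  rcases (norm_nonneg (LinearMap.adjoint T v)).eq_or_lt with h | h
  · rw [← h]; exact mul_nonneg (T.singularValues_nonneg 0) (norm_nonneg _)
  · have h1 : ‖LinearMap.adjoint T v‖ * ‖LinearMap.adjoint T v‖ ≤
        ‖LinearMap.adjoint T v‖ * (T.singularValues 0 * ‖v‖) := by
      calc _ = inner ℝ (T (LinearMap.adjoint T v)) v := by
            rw [← LinearMap.adjoint_inner_right, real_inner_self_eq_norm_mul_norm]
        _ ≤ ‖T (LinearMap.adjoint T v)‖ * ‖v‖ := real_inner_le_norm _ _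
        _ ≤ T.singularValues 0 * ‖LinearMap.adjoint T v‖ * ‖v‖ := by
            gcongr; exact norm_map_le_singularValues_zero T _
        _ = _ := by ring
    exact le_of_mul_le_mul_left h1 h

variable {T : E →ₗ[ℝ] F} (hT : Function.Injective (LinearMap.adjoint T))
include hT

lemma surjective_comp_adjoint : Function.Surjective (T ∘ₗ LinearMap.adjoint T) := by
  rw [← LinearMap.injective_iff_surjective, ← LinearMap.ker_eq_bot, LinearMap.ker_eq_bot']
  intro w hw
  have h1 : inner ℝ (LinearMap.adjoint T w) (LinearMap.adjoint T w) = 0 := by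
    rw [LinearMap.adjoint_inner_right, ← LinearMap.comp_apply, hw, inner_zero_left]
  exact hT (by rw [inner_self_eq_zero.1 h1, map_zero])

lemma singularValues_pos_of_injective_adjoint {n : ℕ} (hn : n < Module.finrank ℝ F) :
    0 < T.singularValues n := by
  rw [T.singularValues_pos_iff_lt_finrank_range, LinearMap.range_eq_top.2, finrank_top]
  · exact hn
  · intro v
    obtain ⟨w, hw⟩ := surjective_comp_adjoint hT v
    exact ⟨_, hw⟩

/-- Singular values are defined through `T* T` on the larger space, which has a kernel. Writing `v =
T u` with `u` in the range of `T*` avoids it: there `s‖u‖ ≤ ‖T u‖`, and `‖T u‖² ≤ ‖u‖ ‖T* T u‖`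
passes the bound to the adjoint. -/
lemma singularValues_mul_norm_le_norm_adjoint (v : F) :
    T.singularValues (Module.finrank ℝ F - 1) * ‖v‖ ≤ ‖LinearMap.adjoint T v‖ := by
  set s := T.singularValues (Module.finrank ℝ F - 1) with hs
  have hs0 : 0 ≤ s := T.singularValues_nonneg _
  obtain ⟨w, rfl⟩ := surjective_comp_adjoint hT v
  set u := LinearMap.adjoint T w with hu
  change s * ‖T u‖ ≤ ‖LinearMap.adjoint T (T u)‖
  have hlow : s * ‖u‖ ≤ ‖T u‖ := by
    set b := T.isSymmetric_adjoint_comp_self.eigenvectorBasis rfl with hb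
    refine le_of_sq_le_sq ?_ (norm_nonneg _)
    rw [norm_sq_map_eq_sum, mul_pow, ← b.sum_sq_inner_right u, Finset.mul_sum]
    refine Finset.sum_le_sum fun i _ => ?_
    by_cases hi : T.singularValues i = 0
    -- An eigenvector with zero singular value lies in the kernel of `T`, hence is orthogonal to
    -- `u`.
    · have h1 : ‖T (b i)‖ ^ 2 = 0 := by
        rw [norm_sq_map_eq_sum, Finset.sum_eq_zero]
        intro j _
        by_cases hij : j = i
        · rw [hij, hi]; simp
        · have : inner ℝ (b j) (b i) = 0 := b.orthonormal.2 hij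
          rw [← hb, this]; simp
      have h2 : T (b i) = 0 := by simpa using h1
      have h3 : inner ℝ (b i) u = 0 := by
        rw [hu, LinearMap.adjoint_inner_right, h2, inner_zero_left]
      rw [← hb, h3]; simp
    · refine mul_le_mul_of_nonneg_right (pow_le_pow_left₀ hs0 ?_ 2) (sq_nonneg _)
      refine T.singularValues_antitone ?_
      have h1 := (T.singularValues_pos_iff_ne_zero i).2 hi
      rw [T.singularValues_pos_iff_lt_finrank_range] at h1
      have := T.range.finrank_le
      omega
  have h1 : ‖T u‖ * ‖T u‖ ≤ ‖u‖ * ‖LinearMap.adjoint T (T u)‖ := by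
    rw [← real_inner_self_eq_norm_mul_norm, ← LinearMap.adjoint_inner_right]
    exact real_inner_le_norm _ _
  rcases (norm_nonneg (T u)).eq_or_lt with h | h
  · rw [← h, mul_zero]; exact norm_nonneg _
  · refine le_of_mul_le_mul_left ?_ h
    calc ‖T u‖ * (s * ‖T u‖) = s * (‖T u‖ * ‖T u‖) := by ring
      _ ≤ s * (‖u‖ * ‖LinearMap.adjoint T (T u)‖) := by gcongr
      _ = (s * ‖u‖) * ‖LinearMap.adjoint T (T u)‖ := by ring
      _ ≤ _ := by gcongr

end SingularValues

/-! ### Bounds for `σ_min`, `σ_max` and `κ` -/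

section SigmaBounds

variable {k : ℕ} {a : EuclideanSpace ℝ (Fin k)}

lemma adjoint_toEuclideanLin_apply {l : ℕ} (A : Matrix (Fin k) (Fin l) ℝ) (v : EuclideanSpace ℝ (Fin k)) :
    LinearMap.adjoint (Matrix.toEuclideanLin A) v = WithLp.toLp 2 (Aᵀ *ᵥ v.ofLp) := by
  rw [← Matrix.toEuclideanLin_conjTranspose_eq_adjoint, Matrix.conjTranspose_eq_transpose_of_trivial]
  rfl

lemma adjoint_convMatrix_injective (ha : a ≠ 0) :
    Function.Injective (LinearMap.adjoint (Matrix.toEuclideanLin (convMatrix a))) := by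
  rw [← LinearMap.ker_eq_bot, LinearMap.ker_eq_bot']
  intro v hv
  rw [adjoint_toEuclideanLin_apply] at hv
  by_contra h
  refine convMatrix_transpose_mulVec_ne_zero ha (v := v.ofLp) (by simpa using h) ?_
  simpa using hv

lemma sigmaMin_pos (ha : a ≠ 0) : 0 < sigmaMin a := by
  have hk : 0 < k := by
    rcases Nat.eq_zero_or_pos k with rfl | h
    · exact absurd (Subsingleton.elim a 0) ha
    · exact h
  exact singularValues_pos_of_injective_adjoint (adjoint_convMatrix_injective ha)
    (by rw [finrank_euclideanSpace_fin]; omega)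

lemma norm_toLp_sq {l : ℕ} (v : Fin l → ℝ) : ‖WithLp.toLp 2 v‖ ^ 2 = v ⬝ᵥ v := by
  rw [EuclideanSpace.norm_sq_eq, dotProduct]
  exact Finset.sum_congr rfl fun i _ => by rw [Real.norm_eq_abs, sq_abs, sq]

lemma sigmaMin_sq_mul_le (ha : a ≠ 0) (v : Fin k → ℝ) :
    sigmaMin a ^ 2 * (v ⬝ᵥ v) ≤ ((convMatrix a)ᵀ *ᵥ v) ⬝ᵥ ((convMatrix a)ᵀ *ᵥ v) := by
  have h := singularValues_mul_norm_le_norm_adjoint (adjoint_convMatrix_injective ha)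
    (WithLp.toLp 2 v)
  rw [adjoint_toEuclideanLin_apply, finrank_euclideanSpace_fin] at h
  rw [← norm_toLp_sq, ← norm_toLp_sq, ← mul_pow]
  exact pow_le_pow_left₀ (mul_nonneg (sigmaMin_pos ha).le (norm_nonneg _)) h 2

lemma le_sigmaMax_sq_mul (v : Fin k → ℝ) :
    ((convMatrix a)ᵀ *ᵥ v) ⬝ᵥ ((convMatrix a)ᵀ *ᵥ v) ≤ sigmaMax a ^ 2 * (v ⬝ᵥ v) := by
  have h := norm_adjoint_le_singularValues_zero (Matrix.toEuclideanLin (convMatrix a))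
    (WithLp.toLp 2 v)
  rw [adjoint_toEuclideanLin_apply] at h
  rw [← norm_toLp_sq, ← norm_toLp_sq, ← mul_pow]
  exact pow_le_pow_left₀ (norm_nonneg _) h 2

lemma one_le_kappa (ha : a ≠ 0) : 1 ≤ kappa a := by
  rw [kappa, one_le_div (sigmaMin_pos ha)]
  exact LinearMap.singularValues_antitone _ (Nat.zero_le _)

/-- Tested on a coordinate vector, since the rows of `A₀` have norm `‖a‖`. -/
lemma sigmaMin_le_one (ha : ‖a‖ = 1) : sigmaMin a ≤ 1 := by
  have ha0 : a ≠ 0 := by rintro rfl; simp at ha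
  have hk : 0 < k := by
    rcases Nat.eq_zero_or_pos k with rfl | h
    · exact absurd (Subsingleton.elim a 0) ha0
    · exact h
  have h := sigmaMin_sq_mul_le ha0 (Pi.single ⟨0, hk⟩ 1)
  rw [Matrix.mulVec_single_one] at h
  have h2 : ((convMatrix a)ᵀ.col ⟨0, hk⟩) ⬝ᵥ ((convMatrix a)ᵀ.col ⟨0, hk⟩) = ‖a‖ ^ 2 :=
    dotProduct_convMatrix_row a ⟨0, hk⟩
  rw [h2, ha] at h
  simp only [dotProduct_single, Pi.single_eq_same, mul_one, one_pow] at h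
  exact (sq_le_one_iff₀ (sigmaMin_pos ha0).le).1 h

end SigmaBounds


/-! ### Square roots of positive definite matrices and their perturbation -/

section SquareRoot

variable {n : ℕ} {A M : Matrix (Fin n) (Fin n) ℝ}

lemma dotProduct_self_eq_sum (b : OrthonormalBasis (Fin n) ℝ (EuclideanSpace ℝ (Fin n)))
    (v : Fin n → ℝ) : v ⬝ᵥ v = ∑ i, ((b i).ofLp ⬝ᵥ v) ^ 2 := by
  rw [← norm_toLp_sq, ← b.sum_sq_inner_right]
  refine Finset.sum_congr rfl fun i _ => ?_
  rw [EuclideanSpace.inner_eq_star_dotProduct, dotProduct_comm]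
  rfl

lemma eigenvectorBasis_dotProduct_mulVec (hA : A.IsHermitian) (v : Fin n → ℝ) (i : Fin n) :
    (hA.eigenvectorBasis i).ofLp ⬝ᵥ (A *ᵥ v) =
      hA.eigenvalues i * ((hA.eigenvectorBasis i).ofLp ⬝ᵥ v) := by
  have hT : Aᵀ = A := by simpa using hA.eq
  rw [Matrix.dotProduct_mulVec, ← Matrix.mulVec_transpose, hT, hA.mulVec_eigenvectorBasis,
    smul_dotProduct, smul_eq_mul]

lemma mulVec_dotProduct_mulVec_le (hA : A.IsHermitian) {r : ℝ}
    (h : ∀ i, |hA.eigenvalues i| ≤ r) (v : Fin n → ℝ) :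
    (A *ᵥ v) ⬝ᵥ (A *ᵥ v) ≤ r ^ 2 * (v ⬝ᵥ v) := by
  rw [dotProduct_self_eq_sum hA.eigenvectorBasis, dotProduct_self_eq_sum hA.eigenvectorBasis v,
    Finset.mul_sum]
  refine Finset.sum_le_sum fun i _ => ?_
  rw [eigenvectorBasis_dotProduct_mulVec, mul_pow]
  refine mul_le_mul_of_nonneg_right ?_ (sq_nonneg _)
  rw [← sq_abs]
  exact pow_le_pow_left₀ (abs_nonneg _) (h i) 2

lemma eigenvectorBasis_dotProduct_self (hA : A.IsHermitian) (i : Fin n) :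
    (hA.eigenvectorBasis i).ofLp ⬝ᵥ (hA.eigenvectorBasis i).ofLp = 1 := by
  rw [← norm_toLp_sq]
  simp

/-- Perturbation bound for square roots of positive semidefinite matrices. -/
lemma sub_mulVec_dotProduct_le {S T : Matrix (Fin n) (Fin n) ℝ} (hS : S.IsHermitian)
    (hT : T.IsHermitian) {r β : ℝ} (hr : 0 < r) (hSr : ∀ v, r * (v ⬝ᵥ v) ≤ v ⬝ᵥ (S *ᵥ v))
    (hT0 : ∀ v, 0 ≤ v ⬝ᵥ (T *ᵥ v))
    (hβ : ∀ v, |v ⬝ᵥ ((S * S) *ᵥ v) - v ⬝ᵥ ((T * T) *ᵥ v)| ≤ β * (v ⬝ᵥ v)) (v : Fin n → ℝ) :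
    ((S - T) *ᵥ v) ⬝ᵥ ((S - T) *ᵥ v) ≤ (β / r) ^ 2 * (v ⬝ᵥ v) := by
  have hD : (S - T).IsHermitian := hS.sub hT
  refine mulVec_dotProduct_mulVec_le hD (fun i => ?_) v
  set e := (hD.eigenvectorBasis i).ofLp with he
  set l := hD.eigenvalues i with hl
  have hee : e ⬝ᵥ e = 1 := eigenvectorBasis_dotProduct_self hD i
  have hDe : (S - T) *ᵥ e = l • e := hD.mulVec_eigenvectorBasis i
  have hST : S *ᵥ e = T *ᵥ e + l • e := by rw [← hDe, Matrix.sub_mulVec]; simp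
  have hSt : Sᵀ = S := by simpa using hS.eq
  have hTt : Tᵀ = T := by simpa using hT.eq
  -- On an eigenvector of `S - T` the form of `S² - T²` factors although `S` and `T` need not
  -- commute; the second factor is at least `r`.
  have h1 : e ⬝ᵥ ((S * S) *ᵥ e) - e ⬝ᵥ ((T * T) *ᵥ e) =
      l * (e ⬝ᵥ (S *ᵥ e) + e ⬝ᵥ (T *ᵥ e)) := by
    have a1 : e ⬝ᵥ ((S * S) *ᵥ e) = (S *ᵥ e) ⬝ᵥ (S *ᵥ e) := by
      rw [← Matrix.mulVec_mulVec, Matrix.dotProduct_mulVec, ← Matrix.mulVec_transpose, hSt]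
    have a2 : e ⬝ᵥ ((T * T) *ᵥ e) = (T *ᵥ e) ⬝ᵥ (T *ᵥ e) := by
      rw [← Matrix.mulVec_mulVec, Matrix.dotProduct_mulVec, ← Matrix.mulVec_transpose, hTt]
    rw [a1, a2, hST]
    simp only [add_dotProduct, dotProduct_add, smul_dotProduct, dotProduct_smul, smul_eq_mul, hee,
      dotProduct_comm (T *ᵥ e) e]
    ring
  have h2 := hβ e
  have h3 := hSr e
  have h4 := hT0 e
  rw [h1, abs_mul, hee, mul_one] at h2
  rw [hee, mul_one] at h3
  rw [le_div_iff₀ hr]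
  refine le_trans (mul_le_mul_of_nonneg_left ?_ (abs_nonneg l)) h2
  exact le_trans (by linarith) (le_abs_self _)

/-- The spectrum is finite, so the functional calculus accepts functions such as `t ↦ (√t)⁻¹` that
are discontinuous at `0`. -/
lemma continuousOn_spectrum (f : ℝ → ℝ) (s : ℝ → ℝ) : ContinuousOn f (s '' spectrum ℝ M) :=
  (M.finite_real_spectrum.image s).continuousOn f

lemma continuousOn_spectrum' (f : ℝ → ℝ) : ContinuousOn f (spectrum ℝ M) :=
  M.finite_real_spectrum.continuousOn f

lemma spectrum_pos (hM : M.PosDef) {x : ℝ} (hx : x ∈ spectrum ℝ M) : 0 < x := by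
  rw [hM.isHermitian.spectrum_real_eq_range_eigenvalues] at hx
  obtain ⟨i, rfl⟩ := hx
  exact hM.eigenvalues_pos i

/-- The square root of a positive definite matrix. -/
noncomputable def matSqrt (M : Matrix (Fin n) (Fin n) ℝ) : Matrix (Fin n) (Fin n) ℝ :=
  cfc Real.sqrt M

lemma matSqrt_isHermitian : (matSqrt M).IsHermitian := cfc_predicate (R := ℝ) Real.sqrt M

lemma invSqrt_isHermitian : (invSqrt M).IsHermitian :=
  cfc_predicate (R := ℝ) (fun t : ℝ => (Real.sqrt t)⁻¹) M

lemma matSqrt_mul_self (hM : M.PosDef) : matSqrt M * matSqrt M = M := by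
  have hsa : IsSelfAdjoint M := hM.isHermitian
  rw [matSqrt, ← cfc_mul _ _ M (continuousOn_spectrum' _) (continuousOn_spectrum' _)]
  conv_rhs => rw [← cfc_id' ℝ M]
  exact cfc_congr fun x hx => Real.mul_self_sqrt (spectrum_pos hM hx).le

lemma matSqrt_mul_invSqrt (hM : M.PosDef) : matSqrt M * invSqrt M = 1 := by
  have hsa : IsSelfAdjoint M := hM.isHermitian
  rw [matSqrt, invSqrt, ← cfc_mul _ _ M (continuousOn_spectrum' _) (continuousOn_spectrum' _),
    ← cfc_one ℝ M]
  exact cfc_congr fun x hx => mul_inv_cancel₀ (Real.sqrt_pos.2 (spectrum_pos hM hx)).ne'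

open scoped MatrixOrder in
lemma matSqrt_nonneg (v : Fin n → ℝ) : 0 ≤ v ⬝ᵥ (matSqrt M *ᵥ v) := by
  have h : 0 ≤ matSqrt M := cfc_nonneg fun x _ => Real.sqrt_nonneg x
  simpa using (Matrix.nonneg_iff_posSemidef.1 h).dotProduct_mulVec_nonneg v

lemma invSqrt_smul (hM : M.IsHermitian) {c : ℝ} (hc : 0 < c) :
    invSqrt (c • M) = (√c)⁻¹ • invSqrt M := by
  have hsa : IsSelfAdjoint M := hM
  rw [invSqrt, ← cfc_comp_const_mul c _ M (continuousOn_spectrum _ _), invSqrt,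
    ← cfc_smul _ _ _ (continuousOn_spectrum' _)]
  refine cfc_congr fun x _ => ?_
  simp [Real.sqrt_mul hc.le, mul_comm]

lemma le_matSqrt (hM : M.PosDef) {r : ℝ}
    (h : ∀ v, r ^ 2 * (v ⬝ᵥ v) ≤ v ⬝ᵥ (M *ᵥ v)) (v : Fin n → ℝ) :
    r * (v ⬝ᵥ v) ≤ v ⬝ᵥ (matSqrt M *ᵥ v) := by
  set S := matSqrt M with hS
  have hH : S.IsHermitian := matSqrt_isHermitian
  have hSt : Sᵀ = S := by simpa using hH.eq
  have hev : ∀ i, r ≤ hH.eigenvalues i := fun i => by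
    set e := (hH.eigenvectorBasis i).ofLp with he
    have hee : e ⬝ᵥ e = 1 := eigenvectorBasis_dotProduct_self hH i
    have hSe : S *ᵥ e = hH.eigenvalues i • e := hH.mulVec_eigenvectorBasis i
    have h1 := h e
    rw [← matSqrt_mul_self hM, ← hS, ← Matrix.mulVec_mulVec, hSe, Matrix.mulVec_smul, hSe, hee] at h1
    have h2 := matSqrt_nonneg (M := M) e
    rw [← hS, hSe] at h2
    simp only [dotProduct_smul, hee, smul_eq_mul, mul_one] at h1 h2
    nlinarith
  have h1 : v ⬝ᵥ (S *ᵥ v) = ∑ i, hH.eigenvalues i * ((hH.eigenvectorBasis i).ofLp ⬝ᵥ v) ^ 2 := by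
    have := hH.eigenvectorBasis.sum_inner_mul_inner (WithLp.toLp 2 v) (WithLp.toLp 2 (S *ᵥ v))
    simp only [EuclideanSpace.inner_eq_star_dotProduct] at this
    simp only [star_trivial] at this
    rw [dotProduct_comm, ← this]
    refine Finset.sum_congr rfl fun i _ => ?_
    rw [dotProduct_comm (S *ᵥ v), eigenvectorBasis_dotProduct_mulVec hH]
    ring
  rw [h1, dotProduct_self_eq_sum hH.eigenvectorBasis v, Finset.mul_sum]
  exact Finset.sum_le_sum fun i _ => mul_le_mul_of_nonneg_right (hev i) (sq_nonneg _)

lemma invSqrt_mul_matSqrt (hM : M.PosDef) : invSqrt M * matSqrt M = 1 :=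
  mul_eq_one_comm.1 (matSqrt_mul_invSqrt hM)

lemma dotProduct_mul_self_mulVec {S : Matrix (Fin n) (Fin n) ℝ} (hS : S.IsHermitian)
    (v : Fin n → ℝ) : v ⬝ᵥ ((S * S) *ᵥ v) = (S *ᵥ v) ⬝ᵥ (S *ᵥ v) := by
  have hSt : Sᵀ = S := by simpa using hS.eq
  rw [← Matrix.mulVec_mulVec, Matrix.dotProduct_mulVec, ← Matrix.mulVec_transpose, hSt]

/-- If `M` is close to `N`, then `N^{1/2} M^{-1/2}` is close to the identity. -/
lemma invSqrt_sub_invSqrt_le {N : Matrix (Fin n) (Fin n) ℝ} (hM : M.PosDef) (hN : N.PosDef)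
    {r b β : ℝ} (hr : 0 < r) (hb : 0 < b)
    (hNr : ∀ v, r ^ 2 * (v ⬝ᵥ v) ≤ v ⬝ᵥ (N *ᵥ v)) (hMb : ∀ v, b ^ 2 * (v ⬝ᵥ v) ≤ v ⬝ᵥ (M *ᵥ v))
    (hβ : ∀ v, |v ⬝ᵥ (N *ᵥ v) - v ⬝ᵥ (M *ᵥ v)| ≤ β * (v ⬝ᵥ v)) (v : Fin n → ℝ) :
    ((invSqrt M - invSqrt N) *ᵥ v) ⬝ᵥ (N *ᵥ ((invSqrt M - invSqrt N) *ᵥ v)) ≤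
      (β / r / b) ^ 2 * (v ⬝ᵥ v) := by
  set S := matSqrt N with hS
  have hSH : S.IsHermitian := matSqrt_isHermitian
  set T := matSqrt M with hT
  set w := invSqrt M *ᵥ v with hw
  -- This is `N^{1/2} (M^{-1/2} - N^{-1/2}) = (N^{1/2} - M^{1/2}) M^{-1/2}`: both sides equal
  -- `N^{1/2} M^{-1/2} - 1`.
  have h1 : ((invSqrt M - invSqrt N) *ᵥ v) ⬝ᵥ (N *ᵥ ((invSqrt M - invSqrt N) *ᵥ v)) =
      ((S - T) *ᵥ w) ⬝ᵥ ((S - T) *ᵥ w) := by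
    have hN' : ∀ u, u ⬝ᵥ (N *ᵥ u) = (S *ᵥ u) ⬝ᵥ (S *ᵥ u) := fun u => by
      rw [← dotProduct_mul_self_mulVec hSH, hS, matSqrt_mul_self hN]
    rw [hN', hw, Matrix.mulVec_mulVec, Matrix.mulVec_mulVec, mul_sub,
      sub_mul, hS, hT, matSqrt_mul_invSqrt hN, matSqrt_mul_invSqrt hM]
  have h2 : ((S - T) *ᵥ w) ⬝ᵥ ((S - T) *ᵥ w) ≤ (β / r) ^ 2 * (w ⬝ᵥ w) :=
    sub_mulVec_dotProduct_le hSH matSqrt_isHermitian hr (le_matSqrt hN hNr) matSqrt_nonneg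
      (fun u => by rw [hS, matSqrt_mul_self hN, matSqrt_mul_self hM]; exact hβ u) w
  have h3 : b ^ 2 * (w ⬝ᵥ w) ≤ v ⬝ᵥ v := by
    refine (hMb w).trans (le_of_eq ?_)
    have hM' : ∀ u, u ⬝ᵥ (M *ᵥ u) = (T *ᵥ u) ⬝ᵥ (T *ᵥ u) := fun u => by
      rw [← dotProduct_mul_self_mulVec matSqrt_isHermitian, matSqrt_mul_self hM]
    rw [hM', hw, hT, Matrix.mulVec_mulVec,
      matSqrt_mul_invSqrt hM, Matrix.one_mulVec]
  rw [h1]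
  refine h2.trans ?_
  rw [div_pow (β / r) b, div_mul_eq_mul_div, le_div_iff₀ (by positivity), mul_assoc, mul_comm _ (b ^ 2)]
  exact mul_le_mul_of_nonneg_left h3 (sq_nonneg _)

end SquareRoot


/-! ### Moment tensors and their contractions -/

section Tensor

variable {n p : ℕ}

/-- The value of the multilinear form with coefficients `D` at the vectors `v`. -/
def contract (D : (Fin p → Fin n) → ℝ) (v : Fin p → Fin n → ℝ) : ℝ := ∑ f, D f * ∏ j, v j (f j)

/-- Cauchy-Schwarz against the rank one tensor of the `v j`, whose Frobenius norm is the product of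
their norms. -/
lemma contract_sq_le (D : (Fin p → Fin n) → ℝ) (v : Fin p → Fin n → ℝ) :
    contract D v ^ 2 ≤ (∑ f, D f ^ 2) * ∏ j, (v j ⬝ᵥ v j) := by
  have h : ∏ j, (v j ⬝ᵥ v j) = ∑ f : Fin p → Fin n, (∏ j, v j (f j)) ^ 2 := by
    simp only [dotProduct, Finset.prod_univ_sum, Fintype.piFinset_univ, ← sq, ← Finset.prod_pow]
  rw [h]
  exact Finset.sum_mul_sq_le_sq_mul_sq _ _ _

lemma contract_sub (D D' : (Fin p → Fin n) → ℝ) (v : Fin p → Fin n → ℝ) :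
    contract (fun f => D f - D' f) v = contract D v - contract D' v := by
  simp [contract, sub_mul]

lemma contract_empMoment {m : ℕ} [NeZero m] (e : Fin n → Fin m) (x : Fin m → ℝ)
    (v : Fin p → Fin n → ℝ) :
    contract (empMoment e x) v = (m : ℝ)⁻¹ * ∑ i, ∏ j, ∑ a, x (i + e a) * v j a := by
  simp only [contract, empMoment, Finset.prod_univ_sum, Fintype.piFinset_univ]
  rw [Finset.sum_comm, Finset.mul_sum]
  refine Finset.sum_congr rfl fun f _ => ?_
  rw [mul_assoc, Finset.sum_mul]
  simp_rw [Finset.prod_mul_distrib]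

lemma sum_fin_succ_fun (F : (Fin (p + 1) → Fin n) → ℝ) :
    ∑ f, F f = ∑ a, ∑ g, F (Fin.cons a g : Fin (p + 1) → Fin n) := by
  rw [← (Fin.consEquiv fun _ => Fin n).sum_comp, Fintype.sum_prod_type]
  rfl

lemma mixedMoment_two (θ : unitInterval) (f : Fin 2 → Fin n) :
    mixedMoment θ f = if f 0 = f 1 then (θ : ℝ) else 0 := by
  have hm : ∀ y, multiplicity f y = (if f 0 = y then 1 else 0) + (if f 1 = y then 1 else 0) := by
    intro y
    rw [multiplicity, Finset.card_filter, Fin.sum_univ_two]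
  split_ifs with h
  · rw [mixedMoment, Finset.prod_eq_single (f 0), hm, if_pos rfl, if_pos h.symm, coordMoment_two]
    · intro y _ hy
      rw [hm, if_neg hy.symm, if_neg (h ▸ hy.symm), coordMoment_zero]
    · simp
  · refine Finset.prod_eq_zero (Finset.mem_univ (f 0)) ?_
    rw [hm, if_pos rfl, if_neg (Ne.symm h)]
    exact coordMoment_odd θ odd_one

lemma contract_mixedMoment_two (θ : unitInterval) (v : Fin 2 → Fin n → ℝ) :
    contract (mixedMoment θ) v = θ * (v 0 ⬝ᵥ v 1) := by
  simp only [contract, mixedMoment_two, sum_fin_succ_fun, Fin.prod_univ_succ]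
  simp [dotProduct, Finset.mul_sum]

/-- The Kronecker delta. -/
def delta (a b : Fin n) : ℝ := if a = b then 1 else 0

lemma sum_delta_mul (a : Fin n) (X : Fin n → ℝ) : ∑ b, delta a b * X b = X a := by
  simp [delta]

/-- Odd multiplicities give zero, which leaves two distinct pairs, with moment `θ²`, and four equal
indices, with moment `3θ`. The latter match all three pairings and so already receive `3θ²`; the
difference `3θ - 3θ²` is the diagonal coefficient. -/
lemma mixedMoment_four (θ : unitInterval) (f : Fin 4 → Fin n) :
    mixedMoment θ f =
      (θ : ℝ) ^ 2 * ((delta (f 0) (f 1) * delta (f 2) (f 3)) +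
        (delta (f 0) (f 2) * delta (f 1) (f 3)) +
        (delta (f 0) (f 3) * delta (f 1) (f 2))) +
      3 * θ * (1 - θ) * (delta (f 0) (f 1) * delta (f 0) (f 2) *
        delta (f 0) (f 3)) := by
  simp only [delta]
  have hm : ∀ y, multiplicity f y = (if f 0 = y then 1 else 0) + (if f 1 = y then 1 else 0) +
      (if f 2 = y then 1 else 0) + (if f 3 = y then 1 else 0) := by
    intro y
    rw [multiplicity, Finset.card_filter, Fin.sum_univ_four]
  have hzero : ∀ y, multiplicity f y = 1 → mixedMoment θ f = 0 := fun y hy =>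
    Finset.prod_eq_zero (Finset.mem_univ y) (by rw [hy]; exact coordMoment_odd θ odd_one)
  have hpair : ∀ y z, y ≠ z → (∀ w, multiplicity f w = if w = y then 2 else if w = z then 2 else 0) →
      mixedMoment θ f = (θ : ℝ) ^ 2 := by
    intro y z hyz h
    rw [mixedMoment, Finset.prod_eq_mul y z hyz]
    · rw [h, h, if_pos rfl, if_neg hyz.symm, if_pos rfl, coordMoment_two, sq]
    · intro w _ hw
      rw [h, if_neg hw.1, if_neg hw.2, coordMoment_zero]
    · simp
    · simp
  by_cases h01 : f 0 = f 1
  · by_cases h23 : f 2 = f 3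
    · by_cases h02 : f 0 = f 2
      · have : mixedMoment θ f = 3 * θ := by
          rw [mixedMoment, Finset.prod_eq_single (f 0), hm, ← h01, ← h23, ← h02]
          · simpa using coordMoment_four θ
          · intro y _ hy
            rw [hm, ← h01, ← h23, ← h02, if_neg hy.symm, coordMoment_zero]
          · simp
        rw [this, ← h01, ← h23, ← h02]
        simp; ring
      · rw [hpair (f 0) (f 2) h02 fun w => by rw [hm]; grind]
        rw [← h01, ← h23]; simp [h02]
    · by_cases h02 : f 0 = f 2
      · rw [hzero (f 3) (by rw [hm]; grind)]; grind
      · rw [hzero (f 2) (by rw [hm]; grind)]; grind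
  · by_cases h02 : f 0 = f 2
    · by_cases h13 : f 1 = f 3
      · rw [hpair (f 0) (f 1) h01 fun w => by rw [hm]; grind]; grind
      · rw [hzero (f 1) (by rw [hm]; grind)]; grind
    · by_cases h03 : f 0 = f 3
      · by_cases h12 : f 1 = f 2
        · rw [hpair (f 0) (f 1) h01 fun w => by rw [hm]; grind]; grind
        · rw [hzero (f 1) (by rw [hm]; grind)]; grind
      · rw [hzero (f 0) (by rw [hm]; grind)]; grind

lemma sum_fin_four_fun (F : (Fin 4 → Fin n) → ℝ) :
    ∑ f, F f = ∑ a, ∑ b, ∑ c, ∑ d, F ![a, b, c, d] := by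
  simp only [sum_fin_succ_fun]
  simp only [Finset.univ_unique, Finset.sum_singleton]
  rfl

lemma contract_mixedMoment_four (θ : unitInterval) (v : Fin 4 → Fin n → ℝ) :
    contract (mixedMoment θ) v =
      (θ : ℝ) ^ 2 * ((v 0 ⬝ᵥ v 1) * (v 2 ⬝ᵥ v 3) + (v 0 ⬝ᵥ v 2) * (v 1 ⬝ᵥ v 3) +
        (v 0 ⬝ᵥ v 3) * (v 1 ⬝ᵥ v 2)) +
      3 * θ * (1 - θ) * ∑ a, v 0 a * v 1 a * v 2 a * v 3 a := by
  have h1 : ∑ f : Fin 4 → Fin n, (delta (f 0) (f 1) * delta (f 2) (f 3)) *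
      ∏ j, v j (f j) = (v 0 ⬝ᵥ v 1) * (v 2 ⬝ᵥ v 3) := by
    simp only [sum_fin_four_fun, Fin.prod_univ_four, dotProduct, Finset.sum_mul_sum,
      Matrix.cons_val, mul_assoc, ← Finset.mul_sum]
    simp only [sum_delta_mul]
    simp only [Finset.mul_sum]
  have h2 : ∑ f : Fin 4 → Fin n, (delta (f 0) (f 2) * delta (f 1) (f 3)) *
      ∏ j, v j (f j) = (v 0 ⬝ᵥ v 2) * (v 1 ⬝ᵥ v 3) := by
    simp only [sum_fin_four_fun, Fin.prod_univ_four, dotProduct, Finset.sum_mul_sum,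
      Matrix.cons_val, mul_assoc, ← Finset.mul_sum]
    simp only [sum_delta_mul]
    simp only [Finset.mul_sum]; grind
  have h3 : ∑ f : Fin 4 → Fin n, (delta (f 1) (f 2) * delta (f 0) (f 3)) *
      ∏ j, v j (f j) = (v 0 ⬝ᵥ v 3) * (v 1 ⬝ᵥ v 2) := by
    simp only [sum_fin_four_fun, Fin.prod_univ_four, dotProduct, Finset.sum_mul_sum,
      Matrix.cons_val, mul_assoc, ← Finset.mul_sum]
    simp only [sum_delta_mul]
    simp only [Finset.mul_sum]; grind
  have h4 : ∑ f : Fin 4 → Fin n, (delta (f 0) (f 1) * delta (f 0) (f 2) *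
      delta (f 0) (f 3)) * ∏ j, v j (f j) = ∑ a, v 0 a * v 1 a * v 2 a * v 3 a := by
    simp only [sum_fin_four_fun, Fin.prod_univ_four,
      Matrix.cons_val, mul_assoc, ← Finset.mul_sum]
    simp only [sum_delta_mul]
  rw [← h1, ← h2, ← h3, ← h4]
  simp only [contract, mixedMoment_four, Finset.mul_sum, ← Finset.sum_add_distrib]
  exact Finset.sum_congr rfl fun f _ => by ring

end Tensor


lemma norm4_pow_four {n : ℕ} (v : Fin n → ℝ) : norm4 v ^ 4 = ∑ i, v i ^ 4 := by
  have h : norm4 v = (∑ i, v i ^ 4) ^ (1 / (4 : ℝ)) := by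
    rw [norm4, PiLp.norm_eq_sum (by norm_num)]
    have : ∀ i, ‖v i‖ ^ (ENNReal.toReal 4) = v i ^ 4 := fun i => by
      rw [show ENNReal.toReal 4 = ((4 : ℕ) : ℝ) by norm_num, Real.rpow_natCast, Real.norm_eq_abs]
      exact (even_two_mul 2).pow_abs (v i)
    simp only [this]
    norm_num
  have h0 : 0 ≤ ∑ i, v i ^ 4 := Finset.sum_nonneg fun i _ => (even_two_mul 2).pow_nonneg (v i)
  rw [h, ← Real.rpow_natCast, ← Real.rpow_mul h0]
  norm_num

/-! ### Riemannian Hessians of quartic forms -/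

section Quartic

variable {k l : ℕ} (C : Matrix (Fin l) (Fin k) ℝ) (α : ℝ)

/-- The form `q ↦ α ‖C q‖₄⁴`. -/
noncomputable def quartic (q : EuclideanSpace ℝ (Fin k)) : ℝ := α * norm4 (C *ᵥ q.ofLp) ^ 4

lemma inner_toLp_row (i : Fin l) (q : EuclideanSpace ℝ (Fin k)) :
    inner ℝ (WithLp.toLp 2 (C i)) q = (C *ᵥ q.ofLp) i := by
  rw [EuclideanSpace.inner_eq_star_dotProduct, dotProduct_comm]
  rfl

lemma hasGradientAt_quartic (q : EuclideanSpace ℝ (Fin k)) :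
    HasGradientAt (quartic C α)
      (∑ i, (4 * α * inner ℝ (WithLp.toLp 2 (C i)) q ^ 3) • WithLp.toLp 2 (C i)) q := by
  rw [hasGradientAt_iff_hasFDerivAt]
  have h1 : ∀ i : Fin l, HasFDerivAt
      (fun q : EuclideanSpace ℝ (Fin k) => innerSL ℝ (WithLp.toLp 2 (C i)) q ^ 4)
      ((4 * innerSL ℝ (WithLp.toLp 2 (C i)) q ^ 3) • innerSL ℝ (WithLp.toLp 2 (C i))) q := by
    intro i
    have := (innerSL ℝ (WithLp.toLp 2 (C i))).hasFDerivAt (x := q) |>.pow 4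
    simpa using this
  have h2 := (HasFDerivAt.fun_sum fun i (_ : i ∈ Finset.univ) => h1 i).const_mul α
  have h3 : (fun q : EuclideanSpace ℝ (Fin k) =>
      α * ∑ i, innerSL ℝ (WithLp.toLp 2 (C i)) q ^ 4) = quartic C α := by
    ext q
    rw [quartic, norm4_pow_four]
    simp only [innerSL_apply_apply, inner_toLp_row]
  rw [h3] at h2
  refine h2.congr_fderiv ?_
  ext v
  simp [Finset.mul_sum]
  exact Finset.sum_congr rfl fun i _ => by ring

lemma gradient_quartic : ∇ (quartic C α) = fun q =>
    ∑ i, (4 * α * inner ℝ (WithLp.toLp 2 (C i)) q ^ 3) • WithLp.toLp 2 (C i) :=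
  funext fun q => (hasGradientAt_quartic C α q).gradient

lemma fderiv_gradient_quartic (q v : EuclideanSpace ℝ (Fin k)) :
    fderiv ℝ (∇ (quartic C α)) q v =
      ∑ i, (12 * α * (C *ᵥ q.ofLp) i ^ 2 * (C *ᵥ v.ofLp) i) • WithLp.toLp 2 (C i) := by
  rw [gradient_quartic]
  have h1 : ∀ i : Fin l, HasFDerivAt
      (fun q : EuclideanSpace ℝ (Fin k) =>
        (4 * α * inner ℝ (WithLp.toLp 2 (C i)) q ^ 3) • WithLp.toLp 2 (C i))
      (((12 * α * inner ℝ (WithLp.toLp 2 (C i)) q ^ 2) •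
        innerSL ℝ (WithLp.toLp 2 (C i))).smulRight (WithLp.toLp 2 (C i))) q := by
    intro i
    have h := (((innerSL ℝ (WithLp.toLp 2 (C i))).hasFDerivAt (x := q)).pow 3).const_mul (4 * α)
    have h' := h.smul_const (WithLp.toLp 2 (C i))
    refine h'.congr_fderiv ?_
    ext v
    simp
    left
    ring
  rw [(HasFDerivAt.fun_sum fun i (_ : i ∈ Finset.univ) => h1 i).fderiv]
  simp [inner_toLp_row]

lemma inner_tangentProj_right (q u w : EuclideanSpace ℝ (Fin k)) :
    inner ℝ (tangentProj q u) w = inner ℝ u (tangentProj q w) := by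
  simp [tangentProj, inner_sub_left, inner_sub_right, inner_smul_left, inner_smul_right]
  rw [real_inner_comm q u]; ring

/-- Powers are spelled out as products of four factors so that the sums match contractions of fourth
order tensors. -/
lemma inner_riemHess_quartic (q u w : EuclideanSpace ℝ (Fin k)) :
    inner ℝ (riemHess (quartic C α) q u) w =
      12 * α * ∑ i, (C *ᵥ q.ofLp) i * (C *ᵥ q.ofLp) i * (C *ᵥ (tangentProj q u).ofLp) i *
        (C *ᵥ (tangentProj q w).ofLp) i -
      4 * α * (∑ i, (C *ᵥ q.ofLp) i * (C *ᵥ q.ofLp) i * (C *ᵥ q.ofLp) i * (C *ᵥ q.ofLp) i) *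
        inner ℝ (tangentProj q u) (tangentProj q w) := by
  have hg : inner ℝ (∇ (quartic C α) q) q = 4 * α * ∑ i, (C *ᵥ q.ofLp) i * (C *ᵥ q.ofLp) i *
      (C *ᵥ q.ofLp) i * (C *ᵥ q.ofLp) i := by
    rw [gradient_quartic]
    simp only [sum_inner, inner_smul_left, inner_toLp_row, Finset.mul_sum]
    refine Finset.sum_congr rfl fun i _ => ?_
    simp; ring
  rw [riemHess, ContinuousLinearMap.comp_apply, inner_tangentProj_right,
    ContinuousLinearMap.comp_apply, _root_.sub_apply, inner_sub_left,
    fderiv_gradient_quartic, hg]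
  simp only [sum_inner, inner_smul_left, inner_toLp_row, Finset.mul_sum,
    _root_.smul_apply, ContinuousLinearMap.id_apply]
  congr 1
  refine Finset.sum_congr rfl fun i _ => ?_
  simp; ring

lemma inner_tangentProj_self {q : EuclideanSpace ℝ (Fin k)} (hq : ‖q‖ = 1)
    (u : EuclideanSpace ℝ (Fin k)) : inner ℝ q (tangentProj q u) = 0 := by
  simp [tangentProj, inner_sub_right, inner_smul_right, hq]

lemma norm_tangentProj_le {q : EuclideanSpace ℝ (Fin k)} (hq : ‖q‖ = 1)
    (u : EuclideanSpace ℝ (Fin k)) : ‖tangentProj q u‖ ≤ ‖u‖ := by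
  have h1 : inner ℝ (tangentProj q u) (tangentProj q u) = inner ℝ u (tangentProj q u) := by
    have h2 : inner ℝ (tangentProj q u) (tangentProj q u) =
      inner ℝ (u - inner ℝ q u • q) (tangentProj q u) := by simp [tangentProj]
    rw [h2, inner_sub_left, inner_smul_left, inner_tangentProj_self hq]; simp
  have h3 : ‖tangentProj q u‖ * ‖tangentProj q u‖ ≤ ‖u‖ * ‖tangentProj q u‖ := by
    rw [← real_inner_self_eq_norm_mul_norm, h1]; exact real_inner_le_norm _ _
  rcases (norm_nonneg (tangentProj q u)).eq_or_lt with h | h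
  · rw [← h]; exact norm_nonneg _
  · exact le_of_mul_le_mul_right h3 h

lemma phi_eq_quartic {k : ℕ} (a : EuclideanSpace ℝ (Fin k)) :
    phi a = quartic (precond a)ᵀ (-(1 / 4)) := rfl

lemma psi_eq_quartic {k m : ℕ} (Y : Matrix (Fin k) (Fin m) ℝ) :
    psi Y = quartic (Yᵀ * invSqrt (Y * Yᵀ)) (-(1 / (4 * (m : ℝ)))) := by
  ext q
  rw [psi, quartic, Matrix.mulVec_mulVec]

end Quartic


/-! ### Norm and perturbation bounds for contractions -/

section Multilinear

variable {n : ℕ}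

/-- The Euclidean norm of a vector. -/
noncomputable def l2 (v : Fin n → ℝ) : ℝ := ‖WithLp.toLp 2 v‖

lemma l2_nonneg (v : Fin n → ℝ) : 0 ≤ l2 v := norm_nonneg _

lemma l2_sq (v : Fin n → ℝ) : l2 v ^ 2 = v ⬝ᵥ v := norm_toLp_sq v

lemma l2_add_le (v w : Fin n → ℝ) : l2 (v + w) ≤ l2 v + l2 w := by
  rw [l2, WithLp.toLp_add]; exact norm_add_le _ _

lemma abs_dotProduct_le (v w : Fin n → ℝ) : |v ⬝ᵥ w| ≤ l2 v * l2 w := by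
  have := abs_real_inner_le_norm (WithLp.toLp 2 w) (WithLp.toLp 2 v)
  rw [EuclideanSpace.inner_eq_star_dotProduct] at this
  simpa [l2, mul_comm] using this

lemma abs_le_l2 (v : Fin n → ℝ) (i : Fin n) : |v i| ≤ l2 v := by
  simpa [l2] using PiLp.norm_apply_le (WithLp.toLp 2 v) i

lemma abs_sum_mul_four_le (v : Fin 4 → Fin n → ℝ) :
    |∑ a, v 0 a * v 1 a * v 2 a * v 3 a| ≤ ∏ j, l2 (v j) := by
  have h1 : |∑ a, v 0 a * v 1 a * v 2 a * v 3 a| ≤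
      l2 (v 2) * l2 (v 3) * ∑ a, |v 0 a| * |v 1 a| := by
    refine (Finset.abs_sum_le_sum_abs _ _).trans ?_
    rw [Finset.mul_sum]
    refine Finset.sum_le_sum fun a _ => ?_
    rw [abs_mul, abs_mul, abs_mul]
    have h2 := abs_le_l2 (v 2) a
    have h3 := abs_le_l2 (v 3) a
    have h4 := l2_nonneg (v 2)
    calc |v 0 a| * |v 1 a| * |v 2 a| * |v 3 a|
        ≤ |v 0 a| * |v 1 a| * l2 (v 2) * l2 (v 3) := by gcongr
      _ = _ := by ring
  have habs : ∀ w : Fin n → ℝ, l2 (fun a => |w a|) = l2 w := fun w => by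
    simp [l2, EuclideanSpace.norm_eq]
  have h2 : ∑ a, |v 0 a| * |v 1 a| ≤ l2 (v 0) * l2 (v 1) := by
    have := (le_abs_self _).trans (abs_dotProduct_le (fun a => |v 0 a|) fun a => |v 1 a|)
    rwa [habs, habs] at this
  rw [Fin.prod_univ_four]
  calc _ ≤ _ := h1
    _ ≤ l2 (v 2) * l2 (v 3) * (l2 (v 0) * l2 (v 1)) :=
      mul_le_mul_of_nonneg_left h2 (mul_nonneg (l2_nonneg _) (l2_nonneg _))
    _ = _ := by ring

lemma abs_contract_le {p : ℕ} {D : (Fin p → Fin n) → ℝ} {τ : ℝ} (hτ : 0 ≤ τ)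
    (hD : ∑ f, D f ^ 2 ≤ τ ^ 2) (v : Fin p → Fin n → ℝ) :
    |contract D v| ≤ τ * ∏ j, l2 (v j) := by
  have hp : 0 ≤ ∏ j, l2 (v j) := Finset.prod_nonneg fun j _ => l2_nonneg _
  refine abs_le_of_sq_le_sq ?_ (mul_nonneg hτ hp)
  refine (contract_sq_le D v).trans ?_
  rw [mul_pow, ← Finset.prod_pow]
  simp_rw [l2_sq]
  exact mul_le_mul_of_nonneg_right hD (Finset.prod_nonneg fun j _ => by
    rw [← l2_sq]; exact sq_nonneg _)

/-- Three pairings and one diagonal term, each at most the product of the norms: `3θ² + 3θ(1-θ) =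
3θ`. -/
lemma abs_contract_mixedMoment_four_le (θ : unitInterval) (v : Fin 4 → Fin n → ℝ) :
    |contract (mixedMoment θ) v| ≤ 3 * θ * ∏ j, l2 (v j) := by
  have h0 := θ.2.1
  have h1 := θ.2.2
  set N := ∏ j, l2 (v j) with hN
  have hd : ∀ i j i' j', l2 (v i) * l2 (v j) * (l2 (v i') * l2 (v j')) = N →
      |(v i ⬝ᵥ v j) * (v i' ⬝ᵥ v j')| ≤ N := by
    intro i j i' j' h
    rw [abs_mul, ← h]
    exact mul_le_mul (abs_dotProduct_le _ _) (abs_dotProduct_le _ _) (abs_nonneg _)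
      (mul_nonneg (l2_nonneg _) (l2_nonneg _))
  have a1 := hd 0 1 2 3 (by rw [hN, Fin.prod_univ_four]; ring)
  have a2 := hd 0 2 1 3 (by rw [hN, Fin.prod_univ_four]; ring)
  have a3 := hd 0 3 1 2 (by rw [hN, Fin.prod_univ_four]; ring)
  have a4 := abs_sum_mul_four_le v
  rw [← hN] at a4
  rw [contract_mixedMoment_four]
  have b1 : |(v 0 ⬝ᵥ v 1) * (v 2 ⬝ᵥ v 3) + (v 0 ⬝ᵥ v 2) * (v 1 ⬝ᵥ v 3) +
      (v 0 ⬝ᵥ v 3) * (v 1 ⬝ᵥ v 2)| ≤ 3 * N := by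
    refine (abs_add_three _ _ _).trans ?_
    linarith
  refine (abs_add_le _ _).trans ?_
  rw [abs_mul, abs_mul, abs_of_nonneg (sq_nonneg (θ : ℝ)),
    abs_of_nonneg (by have : 0 ≤ 1 - (θ : ℝ) := by linarith
                      positivity : 0 ≤ 3 * (θ : ℝ) * (1 - θ))]
  calc _ ≤ (θ : ℝ) ^ 2 * (3 * N) + 3 * θ * (1 - θ) * N := by
        have : 0 ≤ 1 - (θ : ℝ) := by linarith
        gcongr
    _ = _ := by ring

lemma contract_sub_contract (D : (Fin 4 → Fin n) → ℝ) (v w : Fin 4 → Fin n → ℝ) :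
    contract D v - contract D w = contract D ![v 0 - w 0, v 1, v 2, v 3] +
      contract D ![w 0, v 1 - w 1, v 2, v 3] + contract D ![w 0, w 1, v 2 - w 2, v 3] +
      contract D ![w 0, w 1, w 2, v 3 - w 3] := by
  simp only [contract, ← Finset.sum_add_distrib, ← Finset.sum_sub_distrib]
  refine Finset.sum_congr rfl fun f _ => ?_
  simp only [Fin.prod_univ_four, Matrix.cons_val, Pi.sub_apply]
  ring

lemma mul_four_le {a b c d a' b' c' d' : ℝ} (ha : 0 ≤ a) (hb : 0 ≤ b) (hc : 0 ≤ c) (hd : 0 ≤ d)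
    (h1 : a ≤ a') (h2 : b ≤ b') (h3 : c ≤ c') (h4 : d ≤ d') :
    a * b * c * d ≤ a' * b' * c' * d' := by
  have ha' := ha.trans h1
  have hb' := hb.trans h2
  have hc' := hc.trans h3
  gcongr

/-- The vectors are exchanged one at a time. Those not yet exchanged have norm at most `2 r j`, so
the constant is `3 (8 + 4 + 2 + 1) = 45`. -/
lemma abs_contract_mixedMoment_four_sub_le (θ : unitInterval) {v w : Fin 4 → Fin n → ℝ}
    {η : ℝ} (hη1 : η ≤ 1) {r : Fin 4 → ℝ} (hw : ∀ j, l2 (w j) ≤ r j)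
    (hvw : ∀ j, l2 (v j - w j) ≤ η * r j) :
    |contract (mixedMoment θ) v - contract (mixedMoment θ) w| ≤ 45 * θ * η * ∏ j, r j := by
  have h0 := θ.2.1
  have hr : ∀ j, 0 ≤ r j := fun j => (l2_nonneg _).trans (hw j)
  have hv : ∀ j, l2 (v j) ≤ 2 * r j := fun j => by
    have := l2_add_le (v j - w j) (w j)
    rw [sub_add_cancel] at this
    nlinarith [hw j, hvw j, hr j, mul_le_mul_of_nonneg_right hη1 (hr j)]
  rw [contract_sub_contract]
  have c1 := abs_contract_mixedMoment_four_le θ ![v 0 - w 0, v 1, v 2, v 3]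
  have c2 := abs_contract_mixedMoment_four_le θ ![w 0, v 1 - w 1, v 2, v 3]
  have c3 := abs_contract_mixedMoment_four_le θ ![w 0, w 1, v 2 - w 2, v 3]
  have c4 := abs_contract_mixedMoment_four_le θ ![w 0, w 1, w 2, v 3 - w 3]
  simp only [Fin.prod_univ_four, Matrix.cons_val] at c1 c2 c3 c4
  have d1 : l2 (v 0 - w 0) * l2 (v 1) * l2 (v 2) * l2 (v 3) ≤
      (η * r 0) * (2 * r 1) * (2 * r 2) * (2 * r 3) :=
    mul_four_le (l2_nonneg _) (l2_nonneg _) (l2_nonneg _) (l2_nonneg _) (hvw 0) (hv 1) (hv 2) (hv 3)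
  have d2 : l2 (w 0) * l2 (v 1 - w 1) * l2 (v 2) * l2 (v 3) ≤
      r 0 * (η * r 1) * (2 * r 2) * (2 * r 3) :=
    mul_four_le (l2_nonneg _) (l2_nonneg _) (l2_nonneg _) (l2_nonneg _) (hw 0) (hvw 1) (hv 2) (hv 3)
  have d3 : l2 (w 0) * l2 (w 1) * l2 (v 2 - w 2) * l2 (v 3) ≤
      r 0 * r 1 * (η * r 2) * (2 * r 3) :=
    mul_four_le (l2_nonneg _) (l2_nonneg _) (l2_nonneg _) (l2_nonneg _) (hw 0) (hw 1) (hvw 2) (hv 3)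
  have d4 : l2 (w 0) * l2 (w 1) * l2 (w 2) * l2 (v 3 - w 3) ≤
      r 0 * r 1 * r 2 * (η * r 3) :=
    mul_four_le (l2_nonneg _) (l2_nonneg _) (l2_nonneg _) (l2_nonneg _) (hw 0) (hw 1) (hw 2) (hvw 3)
  have h3 : 0 ≤ 3 * (θ : ℝ) := by linarith
  have e1 := mul_le_mul_of_nonneg_left d1 h3
  have e2 := mul_le_mul_of_nonneg_left d2 h3
  have e3 := mul_le_mul_of_nonneg_left d3 h3
  have e4 := mul_le_mul_of_nonneg_left d4 h3
  rw [Fin.prod_univ_four]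
  have tri := abs_add_le (contract (mixedMoment θ) ![v 0 - w 0, v 1, v 2, v 3] +
      contract (mixedMoment θ) ![w 0, v 1 - w 1, v 2, v 3] +
      contract (mixedMoment θ) ![w 0, w 1, v 2 - w 2, v 3])
      (contract (mixedMoment θ) ![w 0, w 1, w 2, v 3 - w 3])
  have tri' := abs_add_three (contract (mixedMoment θ) ![v 0 - w 0, v 1, v 2, v 3])
      (contract (mixedMoment θ) ![w 0, v 1 - w 1, v 2, v 3])
      (contract (mixedMoment θ) ![w 0, w 1, v 2 - w 2, v 3])
  linarith

end Multilinear


/-! ### The empirical preconditioner against the exact one -/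

section Preconditioning

variable {k m : ℕ} [NeZero m] {a : EuclideanSpace ℝ (Fin k)} {x : Fin m → ℝ}
  {θ : unitInterval} {E : ℝ}

lemma dotProduct_gram_mulVec {n l : ℕ} (Y : Matrix (Fin n) (Fin l) ℝ) (v : Fin n → ℝ) :
    v ⬝ᵥ ((Y * Yᵀ) *ᵥ v) = (Yᵀ *ᵥ v) ⬝ᵥ (Yᵀ *ᵥ v) := by
  rw [← Matrix.mulVec_mulVec, Matrix.dotProduct_mulVec, ← Matrix.mulVec_transpose]

lemma posDef_of_forall_le {n : ℕ} {M : Matrix (Fin n) (Fin n) ℝ} (hM : M.IsHermitian) {b : ℝ}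
    (hb : 0 < b) (h : ∀ v, b ^ 2 * (v ⬝ᵥ v) ≤ v ⬝ᵥ (M *ᵥ v)) : M.PosDef := by
  refine Matrix.PosDef.of_dotProduct_mulVec_pos hM fun v hv => ?_
  have h1 : 0 < v ⬝ᵥ v := by
    rw [← l2_sq]
    exact pow_pos (norm_pos_iff.2 (by simpa using hv)) 2
  simpa using lt_of_lt_of_le (by positivity) (h v)

lemma gram_isHermitian {n l : ℕ} (Y : Matrix (Fin n) (Fin l) ℝ) : (Y * Yᵀ).IsHermitian := by
  simpa using Matrix.isHermitian_mul_conjTranspose_self Y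

/-- The normalized Gram matrix of the observation. -/
noncomputable def normGram (a : EuclideanSpace ℝ (Fin k)) (x : Fin m → ℝ) (θ : ℝ) :
    Matrix (Fin k) (Fin k) ℝ :=
  (θ * m)⁻¹ • (obs a x * (obs a x)ᵀ)

lemma normGram_isHermitian (θ : ℝ) : (normGram a x θ).IsHermitian := by
  have h := gram_isHermitian (obs a x)
  rw [Matrix.IsHermitian] at h ⊢
  rw [normGram, Matrix.conjTranspose_smul, h]
  simp

lemma contract_empMoment_offset {p : ℕ} (v : Fin p → Fin (2 * k - 1) → ℝ) :
    contract (empMoment (offset k m) x) v =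
      (m : ℝ)⁻¹ * ∑ i, ∏ j, ((windowMatrix k x)ᵀ *ᵥ v j) i :=
  contract_empMoment _ _ _

/-- The second moment deviation is contracted twice with `A₀ᵀ v`. Dividing the Gram matrix by `θ m`
makes `A₀ A₀ᵀ` its target. -/
lemma abs_normGram_sub_le (hθ : 0 < (θ : ℝ)) (hE : 0 ≤ E)
    (h2 : ∑ f : Fin 2 → Fin (2 * k - 1),
      (empMoment (offset k m) x f - mixedMoment θ f) ^ 2 ≤ (θ * E) ^ 2) (v : Fin k → ℝ) :
    |((convMatrix a)ᵀ *ᵥ v) ⬝ᵥ ((convMatrix a)ᵀ *ᵥ v) - v ⬝ᵥ (normGram a x θ *ᵥ v)| ≤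
      E * (((convMatrix a)ᵀ *ᵥ v) ⬝ᵥ ((convMatrix a)ᵀ *ᵥ v)) := by
  set w := (convMatrix a)ᵀ *ᵥ v with hw
  have hm : 0 < (m : ℝ) := Nat.cast_pos.2 (NeZero.pos m)
  have h1 := abs_contract_le (mul_nonneg hθ.le hE) h2 ![w, w]
  rw [contract_sub, contract_mixedMoment_two, contract_empMoment_offset] at h1
  simp only [Fin.prod_univ_two, Matrix.cons_val_zero, Matrix.cons_val_one, ← sq (l2 w),
    l2_sq] at h1
  have h3 : v ⬝ᵥ (normGram a x θ *ᵥ v) = (θ : ℝ)⁻¹ *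
      ((m : ℝ)⁻¹ * (((windowMatrix k x)ᵀ *ᵥ w) ⬝ᵥ ((windowMatrix k x)ᵀ *ᵥ w))) := by
    rw [normGram, Matrix.smul_mulVec, dotProduct_smul, dotProduct_gram_mulVec, obs_eq_mul,
      Matrix.transpose_mul, ← Matrix.mulVec_mulVec, mul_inv, smul_eq_mul, mul_assoc]
  change |(m : ℝ)⁻¹ * (((windowMatrix k x)ᵀ *ᵥ w) ⬝ᵥ ((windowMatrix k x)ᵀ *ᵥ w)) - _| ≤ _ at h1
  rw [h3]
  set s := (m : ℝ)⁻¹ * (((windowMatrix k x)ᵀ *ᵥ w) ⬝ᵥ ((windowMatrix k x)ᵀ *ᵥ w))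
  have h4 : w ⬝ᵥ w - (θ : ℝ)⁻¹ * s = -((θ : ℝ)⁻¹ * (s - θ * (w ⬝ᵥ w))) := by
    field_simp; ring
  rw [h4, abs_neg, abs_mul, abs_of_pos (inv_pos.2 hθ), inv_mul_le_iff₀ hθ]
  linarith

lemma le_normGram (ha : a ≠ 0) (hθ : 0 < (θ : ℝ)) (hE : 0 ≤ E) (hE1 : E ≤ 1 / 2)
    (h2 : ∑ f : Fin 2 → Fin (2 * k - 1),
      (empMoment (offset k m) x f - mixedMoment θ f) ^ 2 ≤ (θ * E) ^ 2) (v : Fin k → ℝ) :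
    (sigmaMin a / 2) ^ 2 * (v ⬝ᵥ v) ≤ v ⬝ᵥ (normGram a x θ *ᵥ v) := by
  have h1 := (abs_le.1 (abs_normGram_sub_le (a := a) hθ hE h2 v)).2
  have h3 := sigmaMin_sq_mul_le ha v
  have h4 : 0 ≤ sigmaMin a ^ 2 * (v ⬝ᵥ v) := by
    rw [← l2_sq]; positivity
  nlinarith

lemma obs_gram_posDef (ha : a ≠ 0) (hθ : 0 < (θ : ℝ)) (hE : 0 ≤ E) (hE1 : E ≤ 1 / 2)
    (h2 : ∑ f : Fin 2 → Fin (2 * k - 1),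
      (empMoment (offset k m) x f - mixedMoment θ f) ^ 2 ≤ (θ * E) ^ 2) :
    (obs a x * (obs a x)ᵀ).PosDef := by
  have hm : 0 < (m : ℝ) := Nat.cast_pos.2 (NeZero.pos m)
  have hσ := sigmaMin_pos ha
  have hc : 0 < (θ : ℝ) * m := mul_pos hθ hm
  have hl := le_normGram (m := m) ha hθ hE hE1 h2
  refine posDef_of_forall_le (gram_isHermitian _)
    (b := √(θ * m) * (sigmaMin a / 2)) (by positivity) fun v => ?_
  have h1 := mul_le_mul_of_nonneg_left (hl v) hc.le
  rw [normGram, Matrix.smul_mulVec, dotProduct_smul, smul_eq_mul, mul_inv_cancel_left₀ hc.ne'] at h1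
  rw [mul_pow, Real.sq_sqrt hc.le, mul_assoc]
  exact h1

/-- The transposed convolution matrix, preconditioned with the observation. -/
noncomputable def precondObs (a : EuclideanSpace ℝ (Fin k)) (x : Fin m → ℝ) (θ : ℝ) :
    Matrix (Fin (2 * k - 1)) (Fin k) ℝ :=
  (convMatrix a)ᵀ * invSqrt (normGram a x θ)

lemma precond_transpose (a : EuclideanSpace ℝ (Fin k)) :
    (precond a)ᵀ = (convMatrix a)ᵀ * invSqrt (convMatrix a * (convMatrix a)ᵀ) := by
  have h := (invSqrt_isHermitian (M := convMatrix a * (convMatrix a)ᵀ)).eq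
  rw [Matrix.conjTranspose_eq_transpose_of_trivial] at h
  rw [precond, Matrix.transpose_mul, h]

lemma obs_transpose_mul_invSqrt (hθ : 0 < (θ : ℝ)) :
    (obs a x)ᵀ * invSqrt (obs a x * (obs a x)ᵀ) =
      (√(θ * m))⁻¹ • ((windowMatrix k x)ᵀ * precondObs a x θ) := by
  have hm : 0 < (m : ℝ) := Nat.cast_pos.2 (NeZero.pos m)
  have hc : 0 < (θ : ℝ) * m := mul_pos hθ hm
  have h1 : obs a x * (obs a x)ᵀ = ((θ : ℝ) * m) • normGram a x θ := by
    rw [normGram, smul_smul, mul_inv_cancel₀ hc.ne', one_smul]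
  rw [h1, invSqrt_smul (normGram_isHermitian _) hc, Matrix.mul_smul, precondObs, ← Matrix.mul_assoc]
  congr 2
  rw [obs_eq_mul, Matrix.transpose_mul]

lemma convMatrix_gram_posDef (ha : a ≠ 0) : (convMatrix a * (convMatrix a)ᵀ).PosDef :=
  posDef_of_forall_le (gram_isHermitian _) (sigmaMin_pos ha) fun v => by
    rw [dotProduct_gram_mulVec]; exact sigmaMin_sq_mul_le ha v

lemma precond_transpose_dotProduct (ha : a ≠ 0) (u v : Fin k → ℝ) :
    ((precond a)ᵀ *ᵥ u) ⬝ᵥ ((precond a)ᵀ *ᵥ v) = u ⬝ᵥ v := by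
  set N := convMatrix a * (convMatrix a)ᵀ with hN
  have hNp : N.PosDef := convMatrix_gram_posDef ha
  have h1 : precond a * (precond a)ᵀ = 1 := by
    rw [precond_transpose, precond, ← hN, Matrix.mul_assoc, ← Matrix.mul_assoc (convMatrix a), ← hN]
    nth_rewrite 2 [← matSqrt_mul_self hNp]
    rw [Matrix.mul_assoc (matSqrt N), matSqrt_mul_invSqrt hNp, Matrix.mul_one,
      invSqrt_mul_matSqrt hNp]
  rw [Matrix.mulVec_transpose, ← Matrix.dotProduct_mulVec, Matrix.mulVec_mulVec, h1,
    Matrix.one_mulVec]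

lemma l2_precond_transpose_mulVec (ha : a ≠ 0) (v : Fin k → ℝ) :
    l2 ((precond a)ᵀ *ᵥ v) = l2 v := by
  rw [← sq_eq_sq₀ (l2_nonneg _) (l2_nonneg _), l2_sq, l2_sq, precond_transpose_dotProduct ha]

/-- Applies `invSqrt_sub_invSqrt_le` with `N = A₀ A₀ᵀ`, whose quadratic form is `‖A₀ᵀ u‖²`. The
error `E σ_max²` is divided by the lower bounds `σ_min` and `σ_min / 2` of the two square roots. -/
lemma l2_precondObs_sub_le (ha : a ≠ 0) (hθ : 0 < (θ : ℝ)) (hE : 0 ≤ E) (hE1 : E ≤ 1 / 2)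
    (h2 : ∑ f : Fin 2 → Fin (2 * k - 1),
      (empMoment (offset k m) x f - mixedMoment θ f) ^ 2 ≤ (θ * E) ^ 2) (v : Fin k → ℝ) :
    l2 (precondObs a x θ *ᵥ v - (precond a)ᵀ *ᵥ v) ≤ 2 * E * kappa a ^ 2 * l2 v := by
  have hσ := sigmaMin_pos ha
  have hl := le_normGram (m := m) ha hθ hE hE1 h2
  have h1 := invSqrt_sub_invSqrt_le (posDef_of_forall_le (normGram_isHermitian _) (by positivity) hl)
    (convMatrix_gram_posDef ha) hσ (by positivity : 0 < sigmaMin a / 2)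
    (fun v => by rw [dotProduct_gram_mulVec]; exact sigmaMin_sq_mul_le ha v) hl
    (β := E * sigmaMax a ^ 2) (fun v => by
      rw [dotProduct_gram_mulVec, mul_assoc]
      exact (abs_normGram_sub_le hθ hE h2 v).trans
        (mul_le_mul_of_nonneg_left (le_sigmaMax_sq_mul v) hE)) v
  have h3 : E * sigmaMax a ^ 2 / sigmaMin a / (sigmaMin a / 2) = 2 * E * kappa a ^ 2 := by
    rw [kappa]; field_simp
  rw [h3, dotProduct_gram_mulVec, ← l2_sq, ← l2_sq, ← mul_pow] at h1
  have h4 : (convMatrix a)ᵀ *ᵥ ((invSqrt (normGram a x θ) -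
      invSqrt (convMatrix a * (convMatrix a)ᵀ)) *ᵥ v) =
      precondObs a x θ *ᵥ v - (precond a)ᵀ *ᵥ v := by
    rw [precond_transpose, precondObs, Matrix.sub_mulVec, Matrix.mulVec_sub, Matrix.mulVec_mulVec,
      Matrix.mulVec_mulVec]
  rw [h4] at h1
  exact le_of_sq_le_sq h1 (by have := l2_nonneg v; positivity)

end Preconditioning


/-! ### Comparison of the two Hessians -/

section HessianBound

variable {k m : ℕ} [NeZero m] {a : EuclideanSpace ℝ (Fin k)} {x : Fin m → ℝ}
  {θ : unitInterval} {E : ℝ}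

/-- The tensor is exchanged first, at the cost of `2⁴ = 16` because the perturbed vectors have at
most twice the norm, then the vectors, at the cost of `45 · 2 = 90`. -/
lemma abs_contract_empMoment_sub_le (ha : a ≠ 0) (hθ : 0 < (θ : ℝ)) (hE : 0 ≤ E) (hE1 : E ≤ 1 / 2)
    (hEκ : 2 * E * kappa a ^ 2 ≤ 1)
    (h2 : ∑ f : Fin 2 → Fin (2 * k - 1),
      (empMoment (offset k m) x f - mixedMoment θ f) ^ 2 ≤ (θ * E) ^ 2)
    (h4 : ∑ f : Fin 4 → Fin (2 * k - 1),
      (empMoment (offset k m) x f - mixedMoment θ f) ^ 2 ≤ (θ * E) ^ 2)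
    (p : Fin 4 → EuclideanSpace ℝ (Fin k)) :
    |contract (empMoment (offset k m) x) (fun j => precondObs a x θ *ᵥ (p j).ofLp) -
      contract (mixedMoment θ) (fun j => (precond a)ᵀ *ᵥ (p j).ofLp)| ≤
      106 * θ * (E * kappa a ^ 2) * ∏ j, ‖p j‖ := by
  set v : Fin 4 → Fin (2 * k - 1) → ℝ := fun j => precondObs a x θ *ᵥ (p j).ofLp with hv
  set w : Fin 4 → Fin (2 * k - 1) → ℝ := fun j => (precond a)ᵀ *ᵥ (p j).ofLp with hw
  have hw' : ∀ j, l2 (w j) = ‖p j‖ := fun j => l2_precond_transpose_mulVec ha _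
  have hvw : ∀ j, l2 (v j - w j) ≤ 2 * E * kappa a ^ 2 * ‖p j‖ := fun j =>
    l2_precondObs_sub_le ha hθ hE hE1 h2 _
  have hv' : ∀ j, l2 (v j) ≤ 2 * ‖p j‖ := fun j => by
    have := l2_add_le (v j - w j) (w j)
    rw [sub_add_cancel] at this
    nlinarith [hw' j, hvw j, mul_le_mul_of_nonneg_right hEκ (norm_nonneg (p j))]
  have b1 := abs_contract_le (mul_nonneg hθ.le hE) h4 v
  rw [contract_sub] at b1
  have b2 := abs_contract_mixedMoment_four_sub_le θ hEκ (fun j => (hw' j).le) hvw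
  have b3 : ∏ j, l2 (v j) ≤ 16 * ∏ j, ‖p j‖ := by
    refine (Finset.prod_le_prod (fun j _ => l2_nonneg _) fun j _ => hv' j).trans (le_of_eq ?_)
    rw [Finset.prod_mul_distrib]; norm_num
  have hN : 0 ≤ ∏ j, ‖p j‖ := Finset.prod_nonneg fun j _ => norm_nonneg _
  have hκ : 1 ≤ kappa a ^ 2 := one_le_pow₀ (one_le_kappa ha)
  have b4 := abs_sub_le (contract (empMoment (offset k m) x) v) (contract (mixedMoment θ) v)
    (contract (mixedMoment θ) w)
  have b5 := mul_le_mul_of_nonneg_left b3 (mul_nonneg hθ.le hE)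
  have b6 : θ * E * (16 * ∏ j, ‖p j‖) ≤ 16 * θ * (E * kappa a ^ 2) * ∏ j, ‖p j‖ := by
    have := mul_le_mul_of_nonneg_left hκ (by positivity : 0 ≤ 16 * (θ * E * ∏ j, ‖p j‖))
    linarith
  linarith

lemma inner_riemHess_psi_obs (hθ : 0 < (θ : ℝ)) (q u w : EuclideanSpace ℝ (Fin k)) :
    inner ℝ (riemHess (psi (obs a x)) q u) w = -((θ : ℝ) * m)⁻¹ ^ 2 *
      (3 * contract (empMoment (offset k m) x)
          (fun j => precondObs a x θ *ᵥ (![q, q, tangentProj q u, tangentProj q w] j).ofLp) -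
        contract (empMoment (offset k m) x) (fun j => precondObs a x θ *ᵥ (![q, q, q, q] j).ofLp) *
          inner ℝ (tangentProj q u) (tangentProj q w)) := by
  have hm : 0 < (m : ℝ) := Nat.cast_pos.2 (NeZero.pos m)
  have hc : 0 < (θ : ℝ) * m := mul_pos hθ hm
  rw [psi_eq_quartic, obs_transpose_mul_invSqrt hθ, inner_riemHess_quartic,
    contract_empMoment_offset, contract_empMoment_offset]
  have hs : (√((θ : ℝ) * m))⁻¹ ^ 4 = ((θ : ℝ) * m)⁻¹ ^ 2 := by
    rw [show (4 : ℕ) = 2 * 2 from rfl, pow_mul, inv_pow, Real.sq_sqrt hc.le]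
  simp only [Fin.prod_univ_four, Matrix.cons_val, Matrix.smul_mulVec, Pi.smul_apply, smul_eq_mul,
    ← Matrix.mulVec_mulVec]
  rw [← hs]
  set s := (√((θ : ℝ) * m))⁻¹
  have key : ∀ f g h l : Fin m → ℝ, ∑ i, s * f i * (s * g i) * (s * h i) * (s * l i) =
      s ^ 4 * ∑ i, f i * g i * h i * l i := fun f g h l => by
    rw [Finset.mul_sum]; exact Finset.sum_congr rfl fun i _ => by ring
  rw [key, key]
  field_simp
  ring

/-- With `u`, `w` tangent at the unit vector `q`, the pairings contribute `3θ²⟨u, w⟩` to the first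
term and the same to the second, so they cancel. Only the diagonal part of the moment tensor
survives. -/
lemma inner_riemHess_phi (ha : a ≠ 0) (hθ : 0 < (θ : ℝ)) {q : EuclideanSpace ℝ (Fin k)}
    (hq : ‖q‖ = 1) (u w : EuclideanSpace ℝ (Fin k)) :
    3 * (1 - (θ : ℝ)) / (θ * (m : ℝ) ^ 2) * inner ℝ (riemHess (phi a) q u) w =
      -((θ : ℝ) * m)⁻¹ ^ 2 *
      (3 * contract (mixedMoment θ)
          (fun j => (precond a)ᵀ *ᵥ (![q, q, tangentProj q u, tangentProj q w] j).ofLp) -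
        contract (mixedMoment θ) (fun j => (precond a)ᵀ *ᵥ (![q, q, q, q] j).ofLp) *
          inner ℝ (tangentProj q u) (tangentProj q w)) := by
  have hm : 0 < (m : ℝ) := Nat.cast_pos.2 (NeZero.pos m)
  have hin : ∀ u v : EuclideanSpace ℝ (Fin k), u.ofLp ⬝ᵥ v.ofLp = inner ℝ u v := fun u v => by
    rw [EuclideanSpace.inner_eq_star_dotProduct, dotProduct_comm]; rfl
  rw [phi_eq_quartic, inner_riemHess_quartic, contract_mixedMoment_four, contract_mixedMoment_four]
  simp only [Matrix.cons_val, precond_transpose_dotProduct ha, hin, inner_tangentProj_self hq,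
    real_inner_self_eq_norm_sq, hq]
  field_simp
  ring

/-- The two contractions enter with coefficients `3` and `1`, so the constant is `4 · 106 = 424`. -/
lemma norm_riemHess_sub_le (ha : a ≠ 0) (hθ : 0 < (θ : ℝ)) (hE : 0 ≤ E) (hE1 : E ≤ 1 / 2)
    (hEκ : 2 * E * kappa a ^ 2 ≤ 1)
    (h2 : ∑ f : Fin 2 → Fin (2 * k - 1),
      (empMoment (offset k m) x f - mixedMoment θ f) ^ 2 ≤ (θ * E) ^ 2)
    (h4 : ∑ f : Fin 4 → Fin (2 * k - 1),
      (empMoment (offset k m) x f - mixedMoment θ f) ^ 2 ≤ (θ * E) ^ 2)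
    {q : EuclideanSpace ℝ (Fin k)} (hq : ‖q‖ = 1) :
    ‖riemHess (psi (obs a x)) q - (3 * (1 - (θ : ℝ)) / (θ * (m : ℝ) ^ 2)) • riemHess (phi a) q‖ ≤
      424 * (E * kappa a ^ 2) / (θ * (m : ℝ) ^ 2) := by
  have hm : 0 < (m : ℝ) := Nat.cast_pos.2 (NeZero.pos m)
  set T := riemHess (psi (obs a x)) q -
    (3 * (1 - (θ : ℝ)) / (θ * (m : ℝ) ^ 2)) • riemHess (phi a) q with hT
  set c := 424 * (E * kappa a ^ 2) / (θ * (m : ℝ) ^ 2) with hc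
  have hc0 : 0 ≤ c := by positivity
  have key : ∀ u w, |inner ℝ (T u) w| ≤ c * (‖u‖ * ‖w‖) := by
    intro u w
    rw [hT, _root_.sub_apply, _root_.smul_apply, inner_sub_left, real_inner_smul_left,
      inner_riemHess_phi ha hθ hq, inner_riemHess_psi_obs hθ]
    have b1 := abs_contract_empMoment_sub_le ha hθ hE hE1 hEκ h2 h4
      ![q, q, tangentProj q u, tangentProj q w]
    have b2 := abs_contract_empMoment_sub_le ha hθ hE hE1 hEκ h2 h4 ![q, q, q, q]
    have b3 := abs_real_inner_le_norm (tangentProj q u) (tangentProj q w)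
    have b4 : ‖tangentProj q u‖ * ‖tangentProj q w‖ ≤ ‖u‖ * ‖w‖ :=
      mul_le_mul (norm_tangentProj_le hq u) (norm_tangentProj_le hq w) (norm_nonneg _)
        (norm_nonneg _)
    set T1 := contract (empMoment (offset k m) x)
      (fun j => precondObs a x θ *ᵥ (![q, q, tangentProj q u, tangentProj q w] j).ofLp)
    set T2 := contract (empMoment (offset k m) x)
      (fun j => precondObs a x θ *ᵥ (![q, q, q, q] j).ofLp)
    set S1 := contract (mixedMoment θ)
      (fun j => (precond a)ᵀ *ᵥ (![q, q, tangentProj q u, tangentProj q w] j).ofLp)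
    set S2 := contract (mixedMoment θ) (fun j => (precond a)ᵀ *ᵥ (![q, q, q, q] j).ofLp)
    simp only [Fin.prod_univ_four, Matrix.cons_val, hq, one_mul, mul_one] at b1 b2
    set I := (inner ℝ (tangentProj q u) (tangentProj q w) : ℝ)
    set δ := 106 * (θ : ℝ) * (E * kappa a ^ 2) with hδ
    have hδ0 : 0 ≤ δ := by positivity
    have e1 : |T1 - S1| ≤ δ * (‖u‖ * ‖w‖) := b1.trans
      (mul_le_mul_of_nonneg_left b4 hδ0)
    have e2 : |(T2 - S2) * I| ≤ δ * (‖u‖ * ‖w‖) := by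
      rw [abs_mul]; exact mul_le_mul b2 (b3.trans b4) (abs_nonneg _) hδ0
    have e3 : -((θ : ℝ) * m)⁻¹ ^ 2 * (3 * T1 - T2 * I) - -((θ : ℝ) * m)⁻¹ ^ 2 * (3 * S1 - S2 * I) =
      -((θ : ℝ) * m)⁻¹ ^ 2 * (3 * (T1 - S1) - (T2 - S2) * I) := by ring
    have e4 : |3 * (T1 - S1) - (T2 - S2) * I| ≤ 4 * δ * (‖u‖ * ‖w‖) := by
      refine (abs_sub _ _).trans ?_
      rw [abs_mul, abs_of_pos (by norm_num : (0 : ℝ) < 3)]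
      linarith
    rw [e3, abs_mul, abs_neg, abs_of_nonneg (by positivity : 0 ≤ ((θ : ℝ) * m)⁻¹ ^ 2)]
    refine (mul_le_mul_of_nonneg_left e4 (by positivity)).trans (le_of_eq ?_)
    rw [hc, hδ]; field_simp; ring
  refine ContinuousLinearMap.opNorm_le_bound _ hc0 fun u => ?_
  have h1 := (le_abs_self _).trans (key u (T u))
  rw [real_inner_self_eq_norm_mul_norm, ← mul_assoc] at h1
  rcases (norm_nonneg (T u)).eq_or_lt with h | h
  · rw [← h]; positivity
  · exact le_of_mul_le_mul_right h1 h

end HessianBound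


/-! ### The region, the size factor and the sample size -/

section Region

variable {k : ℕ} {a : EuclideanSpace ℝ (Fin k)} {Cstar : ℝ}

lemma mu_nonneg (a : EuclideanSpace ℝ (Fin k)) : 0 ≤ mu a :=
  Real.iSup_nonneg fun _ => abs_nonneg _

lemma norm4_nonneg {n : ℕ} (v : Fin n → ℝ) : 0 ≤ norm4 v := by
  rw [norm4, PiLp.norm_eq_sum (by norm_num)]
  positivity

lemma norm4_le_one {n : ℕ} {v : Fin n → ℝ} (hv : v ⬝ᵥ v = 1) : norm4 v ≤ 1 := by
  have h1 : ∀ i, v i ^ 2 ≤ 1 := fun i => by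
    rw [← hv, dotProduct]
    simp_rw [← sq]
    exact Finset.single_le_sum (f := fun i => v i ^ 2) (fun j _ => sq_nonneg _) (Finset.mem_univ i)
  have h2 : norm4 v ^ 4 ≤ 1 := by
    rw [norm4_pow_four, ← hv, dotProduct]
    refine Finset.sum_le_sum fun i _ => ?_
    have := mul_le_mul_of_nonneg_left (h1 i) (sq_nonneg (v i))
    nlinarith
  exact (pow_le_one_iff_of_nonneg (norm4_nonneg v) (by norm_num)).1 h2

lemma one_le_mul_norm4_pow_four {n : ℕ} {v : Fin n → ℝ} (hv : v ⬝ᵥ v = 1) :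
    1 ≤ n * norm4 v ^ 4 := by
  have h := sq_sum_le_card_mul_sum_sq (s := Finset.univ) (f := fun i => v i ^ 2)
  have h1 : ∑ i, v i ^ 2 = 1 := by rw [← hv, dotProduct]; simp_rw [← sq]
  rw [h1, Finset.card_univ, Fintype.card_fin] at h
  rw [norm4_pow_four]
  simpa [← pow_mul] using h

/-- Let `p = 2 C⋆ μ κ²`. A point of the region has `p ≤ ‖Aᵀq‖₄⁶ ≤ 1`, hence `p^(-4/3) ≥ 1`, and
`‖Aᵀq‖₄⁴ ≥ p^(2/3)`, the inverse square root of `p^(-4/3)`. For the branch `k²`, Cauchy-Schwarz in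
dimension `2k - 1` gives `‖Aᵀq‖₄⁴ ≥ 1/(2k)`, which is where the factor `2` comes from. -/
lemma one_le_sizeFactor_and_le_norm4 (ha : a ≠ 0) (hk : 1 ≤ k) (hC : 0 < Cstar)
    {q : EuclideanSpace ℝ (Fin k)} (hq : q ∈ regionHat (2 * Cstar) a) :
    1 ≤ sizeFactor Cstar a ∧
      1 / (2 * √(sizeFactor Cstar a)) ≤ norm4 ((precond a)ᵀ *ᵥ q.ofLp) ^ 4 := by
  obtain ⟨hq1, hq2⟩ := hq
  set v := (precond a)ᵀ *ᵥ q.ofLp with hv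
  have hv1 : v ⬝ᵥ v = 1 := by
    rw [hv, precond_transpose_dotProduct ha, ← norm_toLp_sq]
    simp [hq1]
  have hN0 := norm4_nonneg v
  have hN1 := norm4_le_one hv1
  have hkR : (1 : ℝ) ≤ k := by exact_mod_cast hk
  have hsq : (1 : ℝ) ≤ (k : ℝ) ^ 2 := one_le_pow₀ hkR
  have hsqk : 1 / (2 * √((k : ℝ) ^ 2)) ≤ norm4 v ^ 4 := by
    rw [Real.sqrt_sq (by linarith), div_le_iff₀ (by linarith)]
    have h1 := one_le_mul_norm4_pow_four hv1
    have h2 : ((2 * k - 1 : ℕ) : ℝ) ≤ 2 * k := by exact_mod_cast Nat.sub_le _ _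
    have h3 := mul_le_mul_of_nonneg_right h2 (pow_nonneg hN0 4)
    linarith
  rw [sizeFactor]
  split_ifs with hμ
  · exact ⟨hsq, hsqk⟩
  have hκ := one_le_kappa ha
  have hμ0 : 0 < mu a := (mu_nonneg a).lt_of_ne' hμ
  set p := 2 * Cstar * mu a * kappa a ^ 2 with hp
  have hp0 : 0 < p := by positivity
  have hp1 : p ≤ 1 := hq2.trans (pow_le_one₀ hN0 hN1)
  refine ⟨le_min (Real.one_le_rpow_of_pos_of_le_one_of_nonpos hp0 hp1 (by norm_num)) hsq, ?_⟩
  rcases min_choice (p ^ (-(4 / 3) : ℝ)) ((k : ℝ) ^ 2) with h | h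
  · rw [h]
    have h1 : √(p ^ (-(4 / 3) : ℝ)) = (p ^ (2 / 3 : ℝ))⁻¹ := by
      rw [Real.sqrt_eq_rpow, ← Real.rpow_mul hp0.le, ← Real.rpow_neg hp0.le]
      norm_num
    have h2 : p ^ (2 / 3 : ℝ) ≤ norm4 v ^ 4 := by
      refine (Real.rpow_le_rpow hp0.le hq2 (by norm_num)).trans (le_of_eq ?_)
      rw [← Real.rpow_natCast, ← Real.rpow_mul hN0, ← Real.rpow_natCast]
      norm_num
    have h3 := Real.rpow_pos_of_pos hp0 (2 / 3 : ℝ)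
    rw [h1]
    refine le_trans (le_of_eq ?_) ((half_le_self h3.le).trans h2)
    field_simp
  · rw [h]; exact hsqk

/-- Only these two terms are spent by the concentration argument; the others are nonnegative. -/
lemma failBound_ge (k m : ℕ) (θ : ℝ) : 48 / (k : ℝ) ^ 7 + 48 / (m : ℝ) ^ 5 ≤ failBound k m θ := by
  have h1 := Real.exp_nonneg (-(k : ℝ))
  have h2 : 0 ≤ θ ^ 2 * (1 - θ) ^ 2 / (k : ℝ) ^ 4 := by positivity
  have h3 := Real.exp_nonneg (-(θ * k))
  have h4 : 0 ≤ 24 * k * Real.exp (-(1 / 144) * min (k : ℝ) (3 * Real.sqrt (θ * m))) := by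
    positivity
  rw [failBound]
  linarith

lemma le_three_mul (hC : 10 ≤ Cstar) :
    0.048 ≤ 3 * (1 - 6 * Cstar⁻¹ - 36 * Cstar⁻¹ ^ 2 - 24 * Cstar⁻¹ ^ 3) := by
  have h0 : 0 ≤ Cstar⁻¹ := by positivity
  have h1 : Cstar⁻¹ ≤ 1 / 10 := by
    rw [one_div]; exact inv_anti₀ (by norm_num) hC
  have h2 := pow_le_pow_left₀ h0 h1 2
  have h3 := pow_le_pow_left₀ h0 h1 3
  norm_num at h2 h3 ⊢
  linarith

/-- The sample size condition in terms of the accuracy of the empirical moments. -/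
lemma sampleConst_mul_le {θ σ κ c s l : ℝ} {m : ℕ} (hk : 2 ≤ k) (hθ : θ < 1) (hσ : 0 < σ)
    (hσ1 : σ ≤ 1) (hκ : 1 ≤ κ) (hc : 0 < c) (hs : 0 < s) (hl : l = Real.log (κ * k))
    (hm : 16 * 424 ^ 2 * sampleConst / c ^ 2 * (s / ((1 - θ) ^ 2 * σ ^ 2)) * κ ^ 6 * (k : ℝ) ^ 4 *
      l ^ 3 ≤ m) :
    sampleConst * (k : ℝ) ^ 4 * Real.log k ≤
      m * ((1 - θ) * (c / (2 * √s)) / (424 * κ ^ 2)) ^ 2 := by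
  have hθ' : 0 < 1 - θ := by linarith
  have hkR : (2 : ℝ) ≤ k := by exact_mod_cast hk
  have hlk := half_le_log hk
  have hll : Real.log k ≤ l := by
    rw [hl]; exact Real.log_le_log (by linarith) (by nlinarith)
  -- Since `l ≥ log k ≥ 1/2`, passing to the cube loses at most a factor `4`.
  have hl3 : Real.log k ≤ 4 * l ^ 3 := by
    have h1 : 1 / 4 ≤ l ^ 2 := by nlinarith
    nlinarith
  have hS : 0 < sampleConst := lt_of_lt_of_le (by norm_num) one_le_sampleConst
  have hE : 0 < ((1 - θ) * (c / (2 * √s)) / (424 * κ ^ 2)) ^ 2 := by positivity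
  refine le_trans ?_ (mul_le_mul_of_nonneg_right hm hE.le)
  have h1 : 16 * 424 ^ 2 * sampleConst / c ^ 2 * (s / ((1 - θ) ^ 2 * σ ^ 2)) * κ ^ 6 * (k : ℝ) ^ 4 *
      l ^ 3 * ((1 - θ) * (c / (2 * √s)) / (424 * κ ^ 2)) ^ 2 =
      sampleConst * (k : ℝ) ^ 4 * (4 * l ^ 3) * (κ ^ 2 / σ ^ 2) := by
    have hss : √s ^ 2 = s := Real.sq_sqrt hs.le
    have h2 : √s ≠ 0 := (Real.sqrt_pos.2 hs).ne'
    rw [div_pow, mul_pow, div_pow, mul_pow 2, hss]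
    field_simp
    ring
  rw [h1]
  have h2 : 1 ≤ κ ^ 2 / σ ^ 2 := by
    rw [one_le_div (by positivity)]
    exact (pow_le_one₀ hσ.le hσ1).trans (one_le_pow₀ hκ)
  have h3 : 0 ≤ l := by linarith
  calc _ ≤ sampleConst * (k : ℝ) ^ 4 * (4 * l ^ 3) := by gcongr
    _ ≤ _ := le_mul_of_one_le_right (by positivity) h2

end Region

end BlindDeconv

/-! ### The main theorem -/

open BlindDeconv in
theorem mainTheorem5 (c : ℝ) (hc0 : 0 < c) (hc : c ≤ 0.048) :
    ∃ C : ℝ, 0 < C ∧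
      ∀ (k m : ℕ) [NeZero m] (a₀ : EuclideanSpace ℝ (Fin k)) (_ : ‖a₀‖ = 1)
        (Cstar : ℝ) (_ : 10 ≤ Cstar)
        (θ : unitInterval) (_ : 1 / (k : ℝ) ≤ θ) (_ : (θ : ℝ) < 1)
        (_ : C * (BlindDeconv.sizeFactor Cstar a₀ /
              ((1 - (θ : ℝ)) ^ 2 * BlindDeconv.sigmaMin a₀ ^ 2)) *
            BlindDeconv.kappa a₀ ^ 6 * (k : ℝ) ^ 4 *
            Real.log (BlindDeconv.kappa a₀ * k) ^ 3 ≤ m)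
        (Ω : Type*) [MeasurableSpace Ω] (P : Measure Ω) [IsProbabilityMeasure P]
        (x₀ : Ω → Fin m → ℝ) (_ : HasLaw x₀ (BlindDeconv.bernoulliGaussianVec m θ) P),
        0.048 ≤ 3 * (1 - 6 * Cstar⁻¹ - 36 * Cstar⁻¹ ^ 2 - 24 * Cstar⁻¹ ^ 3) ∧
        1 - BlindDeconv.failBound k m θ ≤
          P.real {ω | ∀ q ∈ BlindDeconv.regionHat (2 * Cstar) a₀,
            (BlindDeconv.obs a₀ (x₀ ω) * (BlindDeconv.obs a₀ (x₀ ω))ᵀ).PosDef ∧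
            ‖BlindDeconv.riemHess (BlindDeconv.psi (BlindDeconv.obs a₀ (x₀ ω))) q -
                (3 * (1 - (θ : ℝ)) / (θ * (m : ℝ) ^ 2)) •
                  BlindDeconv.riemHess (BlindDeconv.phi a₀) q‖ ≤
              c * ((1 - (θ : ℝ)) / (θ * (m : ℝ) ^ 2)) *
                BlindDeconv.norm4 ((BlindDeconv.precond a₀)ᵀ *ᵥ q.ofLp) ^ 4} := by

  have hS : 0 < sampleConst := lt_of_lt_of_le (by norm_num) one_le_sampleConst
  -- Here `(424/c)²` and a factor `4` come from `E⁻²`, and another factor `4` from `log k ≤ 4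
  -- log³(κk)`.
  refine ⟨16 * 424 ^ 2 * sampleConst / c ^ 2, by positivity, ?_⟩
  intro k m _ a₀ ha Cstar hC θ hθk hθ1 hm Ω _ P _ x₀ hx₀
  refine ⟨le_three_mul hC, ?_⟩
  have ha0 : a₀ ≠ 0 := by rintro rfl; simp at ha
  -- `k = 1` is excluded by `1/k ≤ θ < 1`.
  have hk : 2 ≤ k := by
    rcases Nat.eq_zero_or_pos k with rfl | h
    · exact absurd (Subsingleton.elim a₀ 0) ha0
    by_contra hk
    obtain rfl : k = 1 := by omega
    norm_num at hθk
    linarith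
  have hkR : (2 : ℝ) ≤ k := by exact_mod_cast hk
  have hθ0 : 0 < (θ : ℝ) := lt_of_lt_of_le (by positivity) hθk
  -- On an empty region the event is certain. Otherwise a point of it yields `1 ≤ s`, needed for `E
  -- ≤ 1/2`.
  rcases Set.eq_empty_or_nonempty (regionHat (2 * Cstar) a₀) with hR | ⟨q₀, hq₀⟩
  · have h0 : 0 ≤ failBound k m θ := le_trans (by positivity) (failBound_ge k m θ)
    simp only [hR, Set.mem_empty_iff_false, false_imp_iff, implies_true, Set.ofPred_true,
      probReal_univ]
    linarith
  have hs1 := (one_le_sizeFactor_and_le_norm4 ha0 (by omega) (by linarith) hq₀).1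
  set s := sizeFactor Cstar a₀ with hs
  have hκ := one_le_kappa ha0
  have hσ := sigmaMin_pos ha0
  have hθ' : 0 < 1 - (θ : ℝ) := by linarith
  -- Chosen so that `424 E κ²` equals `c (1 - θ) / (2√s)`, which the lower bound on `‖Aᵀq‖₄⁴` turns
  -- into the claim.
  set E := (1 - (θ : ℝ)) * (c / (2 * √s)) / (424 * kappa a₀ ^ 2) with hE
  have hsq : 1 ≤ √s := Real.one_le_sqrt.2 hs1
  have hE0 : 0 < E := by positivity
  have hEκ : E * kappa a₀ ^ 2 = (1 - (θ : ℝ)) * (c / (2 * √s)) / 424 := by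
    rw [hE]; field_simp
  have hEκ' : E * kappa a₀ ^ 2 ≤ 1 / 2 := by
    have h1 : c / (2 * √s) ≤ 1 := by rw [div_le_one (by positivity)]; linarith
    have h2 : (1 - (θ : ℝ)) * (c / (2 * √s)) ≤ 1 := mul_le_one₀ (by linarith) (by positivity) h1
    rw [hEκ]; linarith
  have hE1 : E ≤ 1 / 2 := (le_mul_of_one_le_right hE0.le (one_le_pow₀ hκ)).trans hEκ'
  have hsamp : sampleConst * (k : ℝ) ^ 4 * Real.log k ≤ m * E ^ 2 :=
    sampleConst_mul_le hk hθ1 hσ (sigmaMin_le_one ha) hκ hc0 (by linarith) rfl hm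
  have hmk : 2 * k - 1 ≤ m := by
    have h1 : (k : ℝ) ^ 4 ≤ m := (sample_size_bounds hk hE0 (by linarith) hsamp).1
    have h2 : k ^ 4 ≤ m := by exact_mod_cast h1
    have h3 : 2 * k ≤ k ^ 4 := by
      calc 2 * k ≤ k * k := Nat.mul_le_mul_right k hk
        _ = k ^ 2 := (sq k).symm
        _ ≤ k ^ 4 := Nat.pow_le_pow_right (by omega) (by norm_num)
    omega
  obtain ⟨G, hGm, hG, hGx⟩ := exists_good_set hk rfl hθk (offset_injective hmk) hE0
    (by linarith) hsamp
  have hPG : (bernoulliGaussianVec m θ).real G = P.real (x₀ ⁻¹' G) :=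
    (hx₀.measureReal_eq hGm).symm
  calc 1 - failBound k m θ ≤ 1 - (48 / (k : ℝ) ^ 7 + 48 / (m : ℝ) ^ 5) := by
        linarith [failBound_ge k m θ]
    _ ≤ P.real (x₀ ⁻¹' G) := hPG ▸ hG
    _ ≤ _ := measureReal_mono ?_
  intro ω hω q hq
  obtain ⟨h2, h4⟩ := hGx _ hω
  refine ⟨obs_gram_posDef ha0 hθ0 hE0.le hE1 h2, ?_⟩
  refine (norm_riemHess_sub_le ha0 hθ0 hE0.le hE1 (by linarith) h2 h4 hq.1).trans ?_
  have h5 := (one_le_sizeFactor_and_le_norm4 ha0 (by omega) (by linarith) hq).2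
  rw [hEκ]
  have h6 : 424 * ((1 - (θ : ℝ)) * (c / (2 * √s)) / 424) / (θ * (m : ℝ) ^ 2) =
      c * ((1 - (θ : ℝ)) / (θ * (m : ℝ) ^ 2)) * (1 / (2 * √s)) := by ring
  rw [h6]
  exact mul_le_mul_of_nonneg_left h5 (by positivity)
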